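/- Let $K$ be a separably closed field of characteristic $p>0$ with algebraic closure $\overline K$, let $C$ be a geometrically integral curve over $K$ (a separated, geometrically integral $K$-scheme of finite type of dimension $1$), and let $P\in C$ be a closed point at which $C$ is regular, with local ring $\mathcal O_{C,P}$ and residue field $\mathbf k(C,P)$. Let $\overline K\mathcal O_{C,P}=\overline K\otimes_K\mathcal O_{C,P}$, which is a domain, and let $\widetilde{\mathcal O}$ be its integral closure in its field of fractions, which is a discrete valuation ring, with normalized valuation $\nu_0$. Put $\Gamma=\{\nu_0(x) : 0\neq x\in\overline K\mathcal O_{C,P}\}$, a semigroup with only finitely many gaps in $\mathbb Z_{\ge 0}$. Let the conductor $c(C,P)$ be the largest positive integer $c\in\Gamma$ such that $c-1\notin\Gamma$, with $c(C,P)=0$ if $\Gamma=\mathbb Z_{\ge 0}$. Let the differential degree be $d(C,P)=1+\dim_{\overline K}\operatorname{Coker}(\alpha)$, where $$\alpha\colon \widetilde{\mathcal O}\otimes_{\overline K\mathcal O_{C,P}}\Omega_{\overline K\mathcal O_{C,P}/\overline K}\to\Omega_{\widetilde{\mathcal O}/\overline K}$$ is the natural map; this cokernel is finite-dimensional. Then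 $[\mathbf k(C,P):K]$ is finite and $$[\mathbf k(C,P):K]\ \text{ divides }\ c(C,P)+d(C,P)-1 .$$ -/

import Mathlib

open AlgebraicGeometry CategoryTheory
open scoped TensorProduct

universe u

noncomputable section

namespace RegularCurve

/-! ### The local ring of a `K`-scheme at a point, as a `K`-algebra -/

section LocalRing

variable {K : Type u} [Field K] {C : Scheme.{u}}

/-- The local ring `𝒪_{C,P}` of a `K`-scheme `f : C ⟶ Spec K` at a point `P`. -/
def LocalRing (_f : C ⟶ Spec (.of K)) (P : C) : Type u := C.presheaf.stalk P

variable (f : C ⟶ Spec (.of K)) (P : C)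

instance : CommRing (LocalRing f P) := inferInstanceAs (CommRing (C.presheaf.stalk P))

instance : IsLocalRing (LocalRing f P) := inferInstanceAs (IsLocalRing (C.presheaf.stalk P))

/-- The structure map `K → Γ(C, 𝒪_C) → 𝒪_{C,P}`. -/
def structureMap : K →+* C.presheaf.stalk P :=
  ((Scheme.ΓSpecIso (.of K)).inv ≫ f.appTop ≫ C.presheaf.germ ⊤ P trivial).hom

instance : Algebra K (LocalRing f P) := (structureMap f P).toAlgebra

/-- The degree `[k(C,P) : K]` of a point. -/
def pointDegree : ℕ := Module.finrank K (IsLocalRing.ResidueField (LocalRing f P))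

end LocalRing

/-! ### Differential degree and conductor of a ring extension

These are applied to `k = K̄`, `A = K̄𝒪_{C,P}` and `B` the normalization of `A`. -/

section Invariants

section Differentials

variable (k A B : Type u) [Field k] [CommRing A] [CommRing B] [Algebra k A] [Algebra A B]
  [Algebra k B] [IsScalarTower k A B]

/-- The cokernel of the natural map `α : B ⊗_A Ω_{A/k} → Ω_{B/k}`. -/
abbrev CokerAlpha : Type u :=
  Ω[B⁄k] ⧸ LinearMap.range (KaehlerDifferential.mapBaseChange k A B)

/-- The differential degree `1 + dim_k Coker α`. -/
def diffDegree : ℕ := 1 + Module.finrank k (CokerAlpha k A B)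

end Differentials

section Semigroup

variable (A B : Type u) [CommRing A] [CommRing B] [Algebra A B] [IsDomain B]
  [IsDiscreteValuationRing B]

/-- The semigroup of the values `ν(x)` of the nonzero `x ∈ A`, where `ν` is the normalized discrete
valuation with valuation ring `B`. (The element `0` has value `⊤` and contributes nothing.) -/
def valueSemigroup : Set ℕ :=
  {l | ∃ x : A, IsDiscreteValuationRing.addVal B (algebraMap A B x) = (l : ℕ∞)}

/-- The conductor of a semigroup `Γ` of natural numbers with finitely many gaps: the largest
positive `c ∈ Γ` such that `c - 1` is a gap, and `0` if there is no such `c` (that is, `Γ = ℕ`). -/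
def semigroupConductor (Γ : Set ℕ) : ℕ := sSup {c | 0 < c ∧ c ∈ Γ ∧ c - 1 ∉ Γ}

/-- The conductor of the value semigroup of `A`. -/
def conductor : ℕ := semigroupConductor (valueSemigroup A B)

end Semigroup

end Invariants

/-! ### The local rings over the algebraic closure

Here `R` stands for the local ring `𝒪_{C,P}`, regarded as a `K`-algebra. -/

section Geometric

variable (K : Type u) [Field K] (R : Type u) [CommRing R] [Algebra K R]

/-- The extended ring `K̄R = K̄ ⊗_K R`: for `K` separably closed and `R = 𝒪_{C,P}` this is the
local ring of `C ×_K K̄` at the unique point over `P`. -/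
abbrev GeomRing : Type u := AlgebraicClosure K ⊗[K] R

/-- The normalization of `K̄R`, that is, its integral closure in its ring of fractions. -/
abbrev GeomNormalization : Type u := integralClosure (GeomRing K R) (FractionRing (GeomRing K R))

end Geometric

end RegularCurve

end

/-! Write `R` for the local ring at `P`, `k` for the algebraic closure of `K`, `A = k ⊗ R`, `E` for
the fraction field of `A`, `B` for the normalization, `v` for its valuation and `L` for the fraction
field of `R` inside `E`. As `K` is separably closed, `k/K` is purely inseparable, so every element
of `E` has a `p ^ n`-th power in `L`. On `R` the valuation `v` takes only multiples of `[k(C,P) :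
K]`: the value of a uniformizer `ϖ` of `R` is the colength of `ϖ` in `A`, and `A/ϖA` is the base
change to `k` of the residue field of `R`. It is therefore enough to exhibit a nonzero element of
`R` whose value is `c + d - 1`.

Both invariants are read off from a generator `η` of `R`, an element whose powers `1, η, …, η ^ (p -
1)` span `R` over its subring of elements that are `p`-th powers in `E` (`exists_isGenerator`). Let
`t` be a uniformizer of `B` and `D` the derivation of `E` over its subfield of `p`-th powers with `D
t = 1`. Then `D(A)` lies in `B · D η`, so the cokernel of `α` has dimension `v (D η)`
(`finrank_cokerAlpha`), which is `d - 1`. The conductor is the least `c` such that every element of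
value at least `c` lies in `A`, the `k`-span of the valuation ring of `L` (`conductor_eq`,
`mem_valSpan_iff`).

The heart is a Frobenius recursion. Let `L₁` be the field of elements of `E` with `p`-th power in
`L`, with conductor exponent `c₁` and generator `η₁`. A duality argument for the top coefficient in
powers of `η` gives `c = (p - 1) v (D η) + p c₁` (`fil_le_valSpan_iff`). Moreover `D η = y · D η₁`
with `y` in the valuation ring of `L₁`. Hence `c + v (D η) = p (v y + c₁ + v (D η₁))`. If the last
two terms sum to `v r₁` with `r₁` in the valuation ring of `L₁`, then `c + v (D η)` is the value of
`(y r₁) ^ p`, an element of `R`. The recursion ends when `t` lies in the field, where the conductor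
and `v (D η)` both vanish (`exists_val_eq_conductor_add`).

What remains is to meet the hypotheses: finiteness of the normalization, `[E : E ^ p] = p`, residue
field `k` for `B`, and the passage from the scheme to a discrete valuation ring of transcendence
degree one. -/

namespace RegularCurve

/-! ### Integer-valued valuations on a field -/

section IntegerValuation

variable {E : Type u} [Field E]

/-- The nonzero elements of a field carry an integer-valued valuation `v`; the value `v 0` is
irrelevant. -/
structure IsIntVal (v : E → ℤ) : Prop where
  map_mul : ∀ {x y : E}, x ≠ 0 → y ≠ 0 → v (x * y) = v x + v y
  map_add : ∀ {x y : E}, x ≠ 0 → y ≠ 0 → x + y ≠ 0 → min (v x) (v y) ≤ v (x + y)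

namespace IsIntVal

variable {v : E → ℤ} (hv : IsIntVal v)
include hv

theorem map_one : v 1 = 0 := by
  have := hv.map_mul (one_ne_zero (α := E)) one_ne_zero
  rw [mul_one] at this
  omega

theorem map_neg (x : E) : v (-x) = v x := by
  by_cases hx : x = 0
  · simp [hx]
  have h1 : v (-1) = 0 := by
    have := hv.map_mul (x := -1) (y := -1) (by simp) (by simp)
    rw [neg_mul_neg, mul_one, hv.map_one] at this
    omega
  rw [neg_eq_neg_one_mul, hv.map_mul (by simp) hx, h1, zero_add]

theorem map_inv {x : E} (hx : x ≠ 0) : v x⁻¹ = -v x := by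
  have := hv.map_mul hx (inv_ne_zero hx)
  rw [mul_inv_cancel₀ hx, hv.map_one] at this
  omega

theorem map_pow {x : E} (hx : x ≠ 0) (n : ℕ) : v (x ^ n) = n * v x := by
  induction n with
  | zero => simp [hv.map_one]
  | succ n ih =>
    rw [pow_succ, hv.map_mul (pow_ne_zero n hx) hx, ih]
    push_cast
    ring

theorem map_zpow {x : E} (hx : x ≠ 0) (n : ℤ) : v (x ^ n) = n * v x := by
  obtain ⟨m, rfl | rfl⟩ := n.eq_nat_or_neg
  · rw [zpow_natCast, hv.map_pow hx]
  · rw [zpow_neg, zpow_natCast, hv.map_inv (pow_ne_zero m hx), hv.map_pow hx]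
    ring

/-- The additive subgroup of the elements of value at least `n`. -/
def fil (n : ℤ) : AddSubgroup E where
  carrier := {x | x ≠ 0 → n ≤ v x}
  zero_mem' h := absurd rfl h
  neg_mem' {x} hx h := by
    rw [hv.map_neg]
    exact hx (neg_ne_zero.mp h)
  add_mem' {x y} hx hy h := by
    by_cases hx0 : x = 0
    · subst hx0
      rw [zero_add] at h ⊢
      exact hy h
    by_cases hy0 : y = 0
    · subst hy0
      rw [add_zero] at h ⊢
      exact hx h
    exact (le_min (hx hx0) (hy hy0)).trans (hv.map_add hx0 hy0 h)

theorem mem_fil {n : ℤ} {x : E} : x ∈ hv.fil n ↔ (x ≠ 0 → n ≤ v x) := Iff.rfl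

theorem mem_fil_val (x : E) : x ∈ hv.fil (v x) := fun _ ↦ le_rfl

theorem fil_mono {m n : ℤ} (h : m ≤ n) : hv.fil n ≤ hv.fil m := fun _ hx h0 ↦ h.trans (hx h0)

theorem mul_mem_fil {m n : ℤ} {x y : E} (hx : x ∈ hv.fil m) (hy : y ∈ hv.fil n) :
    x * y ∈ hv.fil (m + n) := by
  intro h
  rw [hv.map_mul (left_ne_zero_of_mul h) (right_ne_zero_of_mul h)]
  exact add_le_add (hx (left_ne_zero_of_mul h)) (hy (right_ne_zero_of_mul h))

theorem mul_mem_fil_zero {x y : E} (hx : x ∈ hv.fil 0) (hy : y ∈ hv.fil 0) :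
    x * y ∈ hv.fil 0 := hv.mul_mem_fil hx hy

theorem mul_mem_fil_of_mem_zero {n : ℤ} {x y : E} (hx : x ∈ hv.fil 0) (hy : y ∈ hv.fil n) :
    x * y ∈ hv.fil n := by
  simpa using hv.mul_mem_fil hx hy

theorem one_mem_fil : (1 : E) ∈ hv.fil 0 := fun _ ↦ hv.map_one.ge

theorem pow_mem_fil_zero {x : E} (hx : x ∈ hv.fil 0) (n : ℕ) : x ^ n ∈ hv.fil 0 := by
  induction n with
  | zero => simpa using hv.one_mem_fil
  | succ n ih => exact pow_succ x n ▸ hv.mul_mem_fil_zero ih hx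

theorem val_add_of_mem {x y : E} (hx : x ≠ 0) (hy : y ∈ hv.fil (v x + 1)) :
    x + y ≠ 0 ∧ v (x + y) = v x := by
  by_cases hy0 : y = 0
  · simp [hy0, hx]
  have hlt := hy hy0
  have hne : x + y ≠ 0 := by
    intro h
    rw [eq_neg_of_add_eq_zero_left h, hv.map_neg] at hlt
    omega
  refine ⟨hne, le_antisymm ?_ ?_⟩
  · have h2 := hv.map_add hne (neg_ne_zero.mpr hy0) (by simpa using hx)
    rw [hv.map_neg, add_neg_cancel_right] at h2
    omega
  · have := hv.map_add hx hy0 hne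
    omega

/-- The value of a sum of elements of distinct values. -/
theorem exists_val_sum {ι : Type*} (s : Finset ι) (f : ι → E)
    (hd : ∀ i ∈ s, ∀ j ∈ s, f i ≠ 0 → f j ≠ 0 → v (f i) = v (f j) → i = j)
    (hne : ∃ i ∈ s, f i ≠ 0) :
    ∃ i ∈ s, f i ≠ 0 ∧ ∑ j ∈ s, f j ≠ 0 ∧ v (∑ j ∈ s, f j) = v (f i) ∧
      ∀ j ∈ s, f j ∈ hv.fil (v (f i)) := by
  classical
  obtain ⟨i₀, hi₀, hi₀'⟩ := hne
  obtain ⟨i, hi, hmin⟩ := Finset.exists_min_image (s.filter fun i ↦ f i ≠ 0) (fun i ↦ v (f i))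
    ⟨i₀, by simp [hi₀, hi₀']⟩
  simp only [Finset.mem_filter] at hi hmin
  have h2 : ∑ j ∈ s.erase i, f j ∈ hv.fil (v (f i) + 1) := by
    refine sum_mem fun j hj h0 ↦ ?_
    rw [Finset.mem_erase] at hj
    have := hmin j ⟨hj.2, h0⟩
    have : v (f i) ≠ v (f j) := fun h ↦ hj.1 (hd i hi.1 j hj.2 hi.2 h0 h).symm
    omega
  obtain ⟨h3, h4⟩ := hv.val_add_of_mem hi.2 h2
  rw [Finset.add_sum_erase s f hi.1] at h3 h4
  exact ⟨i, hi.1, hi.2, h3, h4, fun j hj h0 ↦ hmin j ⟨hj, h0⟩⟩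

/-- Distinct values rule out cancellation, so a bound on the sum bounds each term. This is how
coefficients of expansions are controlled throughout. -/
theorem mem_fil_of_sum_mem {ι : Type*} (s : Finset ι) (f : ι → E)
    (hd : ∀ i ∈ s, ∀ j ∈ s, f i ≠ 0 → f j ≠ 0 → v (f i) = v (f j) → i = j) {n : ℤ}
    (hs : ∑ j ∈ s, f j ∈ hv.fil n) {j : ι} (hj : j ∈ s) : f j ∈ hv.fil n := by
  by_cases h0 : f j = 0
  · rw [h0]
    exact zero_mem _
  obtain ⟨i, -, -, h1, h2, h3⟩ := hv.exists_val_sum s f hd ⟨j, hj, h0⟩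
  exact hv.fil_mono (h2 ▸ hs h1) (h3 j hj)

end IsIntVal

end IntegerValuation

/-! ### Fields of degree `p` over their `p`-th powers: power bases, top coefficient, derivation -/

section Frobenius

variable (E : Type u) [Field E] (p : ℕ) [Fact p.Prime] [CharP E p]

/-- The subfield of `p`-th powers. -/
abbrev powField : Subfield E := (frobenius E p).fieldRange

variable {E}

theorem mem_powField {x : E} : x ∈ powField E p ↔ ∃ y, y ^ p = x := by
  simp [powField, frobenius_def]

theorem pow_mem_powField (x : E) : x ^ p ∈ powField E p := (mem_powField p).mpr ⟨x, rfl⟩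

theorem pow_p_injective {x y : E} (h : x ^ p = y ^ p) : x = y := frobenius_inj E p h

variable {p}

/-- The degree of `η` over the `p`-th powers divides the prime `p` and is not `1`, so it is `p`. -/
theorem exists_pow_basis (hfr : Module.finrank (powField E p) E = p) {η : E}
    (hη : η ∉ powField E p) :
    ∃ b : Module.Basis (Fin p) (powField E p) E, ∀ i, b i = η ^ (i : ℕ) := by
  have hp := Fact.out (p := p.Prime)
  have hfd : FiniteDimensional (powField E p) E :=
    FiniteDimensional.of_finrank_pos (by rw [hfr]; exact hp.pos)
  have hint : IsIntegral (powField E p) η := Algebra.IsIntegral.isIntegral η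
  have hdvd : Module.finrank (powField E p) (IntermediateField.adjoin (powField E p) {η}) ∣ p :=
    ⟨_, (hfr ▸ (Module.finrank_mul_finrank (powField E p)
      (IntermediateField.adjoin (powField E p) {η}) E).symm)⟩
  have hdeg : (minpoly (powField E p) η).natDegree = p := by
    rw [← IntermediateField.adjoin.finrank hint]
    refine ((Nat.dvd_prime hp).mp hdvd).resolve_left fun h1 ↦ hη ?_
    rw [IntermediateField.finrank_adjoin_simple_eq_one_iff, IntermediateField.mem_bot] at h1
    obtain ⟨y, rfl⟩ := h1
    exact y.2
  have hli := linearIndependent_pow (K := powField E p) η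
  rw [hdeg] at hli
  have : Nonempty (Fin p) := ⟨⟨0, hp.pos⟩⟩
  exact ⟨basisOfLinearIndependentOfCardEqFinrank hli (by simp [hfr]), by simp⟩

/-- The coordinates with respect to the powers of an element that is not a `p`-th power. -/
theorem exists_pow_coeff (hfr : Module.finrank (powField E p) E = p) {η : E}
    (hη : η ∉ powField E p) (x : E) :
    ∃ u : ℕ → E, (∀ a, u a ∈ powField E p) ∧ x = ∑ a ∈ Finset.range p, u a * η ^ a := by
  obtain ⟨b, hb⟩ := exists_pow_basis hfr hη
  refine ⟨fun a ↦ if h : a < p then b.repr x ⟨a, h⟩ else 0, fun a ↦ ?_, ?_⟩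
  · dsimp only
    split_ifs
    exacts [Subtype.prop _, zero_mem _]
  · conv_lhs => rw [← b.sum_repr x]
    rw [Finset.sum_range]
    refine Finset.sum_congr rfl fun i _ ↦ ?_
    simp [hb, Subfield.smul_def]

/-- The functional of the top coefficient with respect to the powers of `η`. -/
theorem exists_topCoeff (hfr : Module.finrank (powField E p) E = p) {η : E}
    (hη : η ∉ powField E p) :
    ∃ l : E →ₗ[powField E p] E,
      (∀ n < p - 1, l (η ^ n) = 0) ∧ l (η ^ (p - 1)) = 1 ∧
        (∀ n, p ≤ n → n < 2 * p - 1 → l (η ^ n) = 0) := by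
  have hp := Fact.out (p := p.Prime)
  have hp1 : p - 1 < p := Nat.sub_lt hp.pos one_pos
  obtain ⟨b, hb⟩ := exists_pow_basis hfr hη
  let l : E →ₗ[powField E p] E :=
    (Algebra.linearMap (powField E p) E).comp (b.coord ⟨p - 1, hp1⟩)
  have hl (n : ℕ) (hn : n < p) : l (η ^ n) = if n = p - 1 then 1 else 0 := by
    have := hb ⟨n, hn⟩
    simp only at this
    simp only [← this, l, LinearMap.comp_apply, Module.Basis.coord_apply, Module.Basis.repr_self,
      Algebra.linearMap_apply]
    by_cases h : n = p - 1
    · subst h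
      simp
    · rw [Finsupp.single_apply, if_neg (by simpa using h), if_neg h, map_zero]
  refine ⟨l, fun n hn ↦ ?_, ?_, fun n hn hn' ↦ ?_⟩
  · rw [hl n (by omega), if_neg (by omega)]
  · rw [hl _ hp1, if_pos rfl]
  -- `η ^ p` is a scalar, and `n < 2 * p - 1` leaves an exponent below `p - 1`. This range covers
  -- the products `η ^ i * η ^ a` with `i, a < p` whose exponent is at least `p`.
  · have : η ^ n = (⟨η ^ p, pow_mem_powField p η⟩ : powField E p) • η ^ (n - p) := by
      rw [Subfield.smul_def, smul_eq_mul, ← pow_add, Nat.add_sub_cancel' hn]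
    rw [this, map_smul, hl _ (by omega), if_neg (by omega), smul_zero]

theorem linearMap_mul {l : E →ₗ[powField E p] E} {u : E} (hu : u ∈ powField E p) (x : E) :
    l (u * x) = u * l x := l.map_smul (⟨u, hu⟩ : powField E p) x

/-- The derivation with respect to an element that is not a `p`-th power. -/
theorem exists_derivation (hfr : Module.finrank (powField E p) E = p) {t : E}
    (ht : t ∉ powField E p) : ∃ D : Derivation (powField E p) E E, D t = 1 := by
  have hp := Fact.out (p := p.Prime)
  obtain ⟨b, hb⟩ := exists_pow_basis hfr ht
  let d : E →ₗ[powField E p] E := b.constr ℕ fun i ↦ ((i : ℕ) : E) * t ^ ((i : ℕ) - 1)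
  -- The formula survives beyond the basis because `t ^ p` is a scalar and `n` and `n - p` agree in
  -- `E`.
  have hd (n : ℕ) : d (t ^ n) = (n : E) * t ^ (n - 1) := by
    induction n using Nat.strong_induction_on with
    | _ n ih =>
      by_cases hn : n < p
      · have h1 := b.constr_basis ℕ (fun i : Fin p ↦ ((i : ℕ) : E) * t ^ ((i : ℕ) - 1)) ⟨n, hn⟩
        rw [hb] at h1
        exact h1
      · push Not at hn
        have : t ^ n = (⟨t ^ p, pow_mem_powField p t⟩ : powField E p) • t ^ (n - p) := by
          rw [Subfield.smul_def, smul_eq_mul, ← pow_add, Nat.add_sub_cancel' hn]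
        rw [this, map_smul, ih (n - p) (by have := hp.pos; omega), Subfield.smul_def, smul_eq_mul]
        rw [Nat.cast_sub hn, CharP.cast_eq_zero E p, sub_zero]
        by_cases h : n = p
        · simp [h]
        · rw [mul_left_comm, ← pow_add]
          congr 2
          omega
  refine ⟨Derivation.mk' d ?_, ?_⟩
  · intro x y
    have hb' : ∀ i, b i = t ^ (i : ℕ) := hb
    -- Both sides of the Leibniz rule are bilinear over the `p`-th powers, so powers of `t` suffice.
    have h1 : (LinearMap.mul (powField E p) E).compr₂ d =
        LinearMap.mk₂ (powField E p) (fun x y ↦ x * d y + y * d x)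
          (fun a b c ↦ by rw [map_add]; ring)
          (fun c a b ↦ by
            rw [map_smul]
            simp only [Subfield.smul_def, smul_eq_mul]
            ring)
          (fun a b c ↦ by rw [map_add]; ring)
          (fun c a b ↦ by
            rw [map_smul]
            simp only [Subfield.smul_def, smul_eq_mul]
            ring) := by
      refine b.ext fun i ↦ b.ext fun j ↦ ?_
      simp only [LinearMap.compr₂_apply, LinearMap.mul_apply', LinearMap.mk₂_apply, hb']
      rw [← pow_add, hd, hd, hd]
      rcases Nat.eq_zero_or_pos (i : ℕ) with hi | hi
      · simp [hi]
      rcases Nat.eq_zero_or_pos (j : ℕ) with hj | hj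
      · simp [hj]
      rw [mul_left_comm, ← pow_add, mul_left_comm (t ^ (j : ℕ)), ← pow_add]
      have e1 : (i : ℕ) + (j - 1) = i + j - 1 := by omega
      have e2 : (j : ℕ) + (i - 1) = i + j - 1 := by omega
      rw [e1, e2]
      push_cast
      ring
    simpa using LinearMap.congr_fun₂ h1 x y
  · simpa using hd 1

end Frobenius

/-! ### Valuations of function fields, and descent of the field of constants -/

section CurveValuation

variable {E : Type u} [Field E] (p : ℕ) [Fact p.Prime] [CharP E p]

/-- `v` is the normalized valuation of a discrete valuation ring of the function field `E` of a
curve over a perfect field `k`, with residue field `k` and uniformizer `t`. -/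
structure IsCurveVal (v : E → ℤ) (k : Subfield E) (t : E) : Prop extends IsIntVal v where
  val_t : v t = 1
  t_ne : t ≠ 0
  val_k : ∀ c ∈ k, c ≠ 0 → v c = 0
  root : ∀ c ∈ k, ∃ d ∈ k, d ^ p = c
  residue : ∀ x ∈ toIsIntVal.fil 0, ∃ c ∈ k, x - c ∈ toIsIntVal.fil 1
  finite : Module.Finite (powField E p) E
  finrank_le : Module.finrank (powField E p) E ≤ p

variable {p} {v : E → ℤ} {k : Subfield E} {t : E}

namespace IsCurveVal

variable (h : IsCurveVal p v k t)
include h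

theorem mem_powField_of_mem {c : E} (hc : c ∈ k) : c ∈ powField E p := by
  obtain ⟨d, -, rfl⟩ := h.root c hc
  exact pow_mem_powField p d

theorem mem_fil_of_mem {c : E} (hc : c ∈ k) : c ∈ h.fil 0 := fun h0 ↦ (h.val_k c hc h0).ge

theorem eq_zero_of_mem {c : E} (hc : c ∈ k) (hc' : c ∈ h.fil 1) : c = 0 := by
  by_contra h0
  have := hc' h0
  rw [h.val_k c hc h0] at this
  omega

theorem dvd_val {x : E} (hx : x ∈ powField E p) (h0 : x ≠ 0) : (p : ℤ) ∣ v x := by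
  obtain ⟨y, rfl⟩ := (mem_powField p).mp hx
  have hy : y ≠ 0 := fun hy ↦ h0 (by simp [hy, (Fact.out : p.Prime).ne_zero])
  exact ⟨v y, h.map_pow hy p⟩

/-- Modulo `p`, the value of the `i`-th term is `i * v x`, and `v x` is invertible modulo `p`. -/
theorem distinct_val {x : E} (hx : x ≠ 0) (hpx : ¬ (p : ℤ) ∣ v x) {u : ℕ → E}
    (hu : ∀ a, u a ∈ powField E p) :
    ∀ i ∈ Finset.range p, ∀ j ∈ Finset.range p, u i * x ^ i ≠ 0 → u j * x ^ j ≠ 0 →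
      v (u i * x ^ i) = v (u j * x ^ j) → i = j := by
  intro i hi j hj hi0 hj0 hij
  rw [Finset.mem_range] at hi hj
  rw [h.map_mul (left_ne_zero_of_mul hi0) (right_ne_zero_of_mul hi0),
    h.map_mul (left_ne_zero_of_mul hj0) (right_ne_zero_of_mul hj0), h.map_pow hx,
    h.map_pow hx] at hij
  obtain ⟨a, ha⟩ := h.dvd_val (hu i) (left_ne_zero_of_mul hi0)
  obtain ⟨b, hb⟩ := h.dvd_val (hu j) (left_ne_zero_of_mul hj0)
  have h1 : (p : ℤ) ∣ ((i : ℤ) - j) * v x := ⟨b - a, by rw [mul_sub, ← ha, ← hb]; linarith⟩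
  have h2 := ((Nat.prime_iff_prime_int.mp (Fact.out : p.Prime)).dvd_mul.mp h1).resolve_right hpx
  have h3 := Int.eq_zero_of_abs_lt_dvd h2 (by rw [abs_lt]; omega)
  omega

theorem not_dvd_val_t : ¬ (p : ℤ) ∣ v t := fun ht ↦ by
  rw [h.val_t] at ht
  exact (Fact.out : p.Prime).one_lt.ne'
    (Nat.dvd_one.mp (Int.natCast_dvd_natCast.mp (by exact_mod_cast ht)))

theorem t_notMem : t ∉ powField E p := fun ht ↦ h.not_dvd_val_t (h.dvd_val ht h.t_ne)

/-- The powers of `t` below `p` have values distinct modulo `p`, hence are independent; this gives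
the lower bound matching `finrank_le`. -/
theorem finrank : Module.finrank (powField E p) E = p := by
  have := h.finite
  have hli : LinearIndependent (powField E p) fun i : Fin p ↦ t ^ (i : ℕ) := by
    rw [Fintype.linearIndependent_iff]
    intro g hg i
    by_contra hi
    let u : ℕ → E := fun a ↦ if ha : a < p then g ⟨a, ha⟩ else 0
    have hu (a : ℕ) : u a ∈ powField E p := by
      dsimp only [u]
      split_ifs
      exacts [Subtype.prop _, zero_mem _]
    have hui (i : Fin p) : u i = g i := dif_pos i.2
    obtain ⟨-, -, -, hne, -⟩ := h.exists_val_sum (Finset.range p) (fun a ↦ u a * t ^ a)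
      (h.distinct_val h.t_ne h.not_dvd_val_t hu) ⟨i, Finset.mem_range.mpr i.2, by
        simpa [hui, h.t_ne] using hi⟩
    apply hne
    rw [Finset.sum_range, ← hg]
    exact Finset.sum_congr rfl fun j _ ↦ by rw [hui, Subfield.smul_def, smul_eq_mul]
  exact le_antisymm h.finrank_le (by simpa using hli.fintype_card_le_finrank)

/-- Modulo `p`-th powers, an element that is not a `p`-th power has value prime to `p`. -/
theorem exists_sub_val {η : E} (hη : η ∉ powField E p) :
    ∃ w ∈ powField E p, η - w ≠ 0 ∧ ¬ (p : ℤ) ∣ v (η - w) := by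
  obtain ⟨u, hu, hsum⟩ := exists_pow_coeff h.finrank h.t_notMem η
  have hp := (Fact.out : p.Prime)
  have h0 : 0 ∈ Finset.range p := by simpa using hp.pos
  -- Subtracting the coefficient of `t ^ 0` leaves terms of value congruent to `a` modulo `p` with
  -- `0 < a < p`.
  have hsub : η - u 0 = ∑ a ∈ (Finset.range p).erase 0, u a * t ^ a := by
    rw [hsum, ← Finset.add_sum_erase _ _ h0, pow_zero, mul_one, add_sub_cancel_left]
  have hne : η - u 0 ≠ 0 := fun h0 ↦ hη (by rw [sub_eq_zero.mp h0]; exact hu 0)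
  obtain ⟨i, hi, hi0, -, hval, -⟩ := h.exists_val_sum ((Finset.range p).erase 0)
    (fun a ↦ u a * t ^ a)
    (fun i hi j hj ↦ h.distinct_val h.t_ne h.not_dvd_val_t hu i (Finset.mem_of_mem_erase hi) j
      (Finset.mem_of_mem_erase hj))
    (by
      by_contra! hall
      exact hne (hsub.trans (Finset.sum_eq_zero hall)))
  refine ⟨u 0, hu 0, hne, ?_⟩
  rw [hsub, hval, h.map_mul (left_ne_zero_of_mul hi0) (right_ne_zero_of_mul hi0),
    h.map_pow h.t_ne, h.val_t, mul_one]
  intro hdvd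
  have h1 := (Int.dvd_add_right (h.dvd_val (hu i) (left_ne_zero_of_mul hi0))).mp hdvd
  rw [Finset.mem_erase, Finset.mem_range] at hi
  exact hi.1 (Nat.eq_zero_of_dvd_of_lt (Int.natCast_dvd_natCast.mp h1) hi.2)

omit h in
theorem derivation_mul (D : Derivation (powField E p) E E) {u : E} (hu : u ∈ powField E p)
    (x : E) : D (u * x) = u * D x := D.map_smul (⟨u, hu⟩ : powField E p) x

omit h in
theorem derivation_eq_zero (D : Derivation (powField E p) E E) {u : E} (hu : u ∈ powField E p) :
    D u = 0 := D.map_algebraMap (⟨u, hu⟩ : powField E p)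

/-- The terms of the expansion in powers of `t` have distinct values, so each lies in `h.fil s`; on
the `a`-th term `D` is multiplication by `a * t⁻¹`. -/
theorem derivation_mem_fil (D : Derivation (powField E p) E E) (hD : D t = 1) {s : ℤ} {x : E}
    (hx : x ∈ h.fil s) : D x ∈ h.fil (s - 1) := by
  obtain ⟨u, hu, hsum⟩ := exists_pow_coeff h.finrank h.t_notMem x
  rw [hsum, map_sum]
  refine sum_mem fun a ha ↦ ?_
  have h1 := h.mem_fil_of_sum_mem (Finset.range p) (fun a ↦ u a * t ^ a)
    (h.distinct_val h.t_ne h.not_dvd_val_t hu) (hsum ▸ hx) ha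
  rcases Nat.eq_zero_or_pos a with rfl | ha0
  · rw [pow_zero, mul_one, derivation_eq_zero D (hu 0)]
    exact zero_mem _
  have h2 : D (u a * t ^ a) = (a : E) * ((u a * t ^ a) * t⁻¹) := by
    rw [derivation_mul D (hu a), D.leibniz_pow, hD]
    obtain ⟨b, rfl⟩ := Nat.exists_eq_add_of_lt ha0
    have := h.t_ne
    simp only [nsmul_eq_mul, smul_eq_mul]
    field_simp
    rw [Nat.add_sub_cancel, mul_assoc, ← pow_succ]
  rw [h2]
  refine h.mul_mem_fil_of_mem_zero (h.mem_fil_of_mem (natCast_mem k a)) ?_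
  rw [sub_eq_add_neg]
  refine h.mul_mem_fil h1 fun _ ↦ ?_
  rw [h.map_inv h.t_ne, h.val_t]

/-- The leading term `c * t ^ m`, with `m = v x` prime to `p`, has derivative `m * c * t ^ (m - 1) ≠
0`, and the remainder contributes only higher value. -/
theorem derivation_val (D : Derivation (powField E p) E E) (hD : D t = 1) {x : E} (hx : x ≠ 0)
    (hpx : ¬ (p : ℤ) ∣ v x) : D x ≠ 0 ∧ v (D x) = v x - 1 := by
  have ht := h.t_ne
  have hres : x * t ^ (-v x) ∈ h.fil 0 := by
    intro _
    rw [h.map_mul hx (zpow_ne_zero _ ht), h.map_zpow ht, h.val_t]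
    omega
  obtain ⟨c, hc, hc1⟩ := h.residue _ hres
  have hc0 : c ≠ 0 := by
    rintro rfl
    rw [sub_zero] at hc1
    have := hc1 (mul_ne_zero hx (zpow_ne_zero _ ht))
    rw [h.map_mul hx (zpow_ne_zero _ ht), h.map_zpow ht, h.val_t] at this
    omega
  have hm : ((v x : ℤ) : E) ≠ 0 := by
    rwa [Ne, CharP.intCast_eq_zero_iff E p]
  have hmk : ((v x : ℤ) : E) ∈ k := intCast_mem k _
  set y := (x * t ^ (-v x) - c) * t ^ v x with hy
  have hxy : x = c * t ^ v x + y := by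
    rw [hy, sub_mul, mul_assoc, ← zpow_add₀ ht]
    simp
  have hyf : y ∈ h.fil (v x + 1) := by
    rw [add_comm]
    refine h.mul_mem_fil hc1 fun _ ↦ ?_
    rw [h.map_zpow ht, h.val_t, mul_one]
  have hDy := h.derivation_mem_fil D hD hyf
  have hDc : D (c * t ^ v x) = ((v x : ℤ) : E) * (c * t ^ (v x - 1)) := by
    rw [derivation_mul D (h.mem_powField_of_mem hc), D.leibniz_zpow, hD]
    simp only [smul_eq_mul, zsmul_eq_mul]
    ring
  have hne : D (c * t ^ v x) ≠ 0 := by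
    rw [hDc]
    exact mul_ne_zero hm (mul_ne_zero hc0 (zpow_ne_zero _ ht))
  have hv : v (D (c * t ^ v x)) = v x - 1 := by
    rw [hDc, h.map_mul hm (mul_ne_zero hc0 (zpow_ne_zero _ ht)), h.val_k _ hmk hm,
      h.map_mul hc0 (zpow_ne_zero _ ht), h.val_k _ hc hc0, h.map_zpow ht, h.val_t]
    ring
  have h3 := h.val_add_of_mem hne (y := D y) (by rw [hv]; convert hDy using 2; ring)
  rw [← map_add, ← hxy, hv] at h3
  exact h3

end IsCurveVal

/-- `E` is obtained from `L` by extending the field of constants to `k`. -/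
def Descends (k L : Subfield E) : Prop :=
  ∃ (ι : Type u) (b : Module.Basis ι L E) (i₀ : ι), b i₀ = 1 ∧ (∀ i, b i ∈ k) ∧
    ∀ c ∈ k, ∀ i, (b.repr c i : E) ∈ k

variable (p) in
/-- The subfield of the elements whose `p`-th power lies in `L`. -/
abbrev rootField (L : Subfield E) : Subfield E := L.comap (frobenius E p)

theorem mem_rootField {L : Subfield E} {x : E} : x ∈ rootField p L ↔ x ^ p ∈ L := Iff.rfl

theorem le_rootField (L : Subfield E) : L ≤ rootField p L := fun _ hx ↦ pow_mem hx p

namespace IsCurveVal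

variable (h : IsCurveVal p v k t)
include h

/-- If `y = z ^ p`, raising the expansion of `z` to the `p`-th power writes `y` with coefficients
that are `p`-th powers in `L` and vectors `b i ^ p` in `k`; the coordinates of the latter lie in
`k`, which consists of `p`-th powers. -/
theorem repr_mem_powField {L : Subfield E} {ι : Type u} {b : Module.Basis ι L E}
    (hbk : ∀ i, b i ∈ k) (hkk : ∀ c ∈ k, ∀ i, (b.repr c i : E) ∈ k) {y : E}
    (hy : y ∈ powField E p) (j : ι) : (b.repr y j : E) ∈ powField E p := by
  obtain ⟨z, rfl⟩ := (mem_powField p).mp hy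
  have h1 : z ^ p = ∑ i ∈ (b.repr z).support, (b.repr z i) ^ p • (b i) ^ p := by
    conv_lhs => rw [← b.linearCombination_repr z, Finsupp.linearCombination_apply, Finsupp.sum]
    rw [sum_pow_char]
    refine Finset.sum_congr rfl fun i _ ↦ ?_
    simp [Subfield.smul_def, mul_pow]
  rw [h1, map_sum, Finsupp.finsetSum_apply]
  push_cast
  refine sum_mem fun i _ ↦ ?_
  rw [map_smul, Finsupp.smul_apply, smul_eq_mul]
  push_cast
  exact mul_mem (pow_mem_powField p _)
    (h.mem_powField_of_mem (hkk _ (pow_mem (hbk i) p) j))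

/-- The `p`-th roots of the given basis form the new one. Independence follows by applying
Frobenius; spanning holds because the coordinates of `y ^ p` are `p`-th powers. -/
theorem descends_rootField {L : Subfield E} (hL : Descends k L) : Descends k (rootField p L) := by
  obtain ⟨ι, b, i₀, hb1, hbk, hkk⟩ := hL
  choose b' hb'k hb' using fun i ↦ h.root (b i) (hbk i)
  have hli : LinearIndependent (rootField p L) b' := by
    rw [linearIndependent_iff']
    intro s g hg i hi
    have h1 : ∑ j ∈ s, (⟨(g j : E) ^ p, (g j).2⟩ : L) • b j = 0 := by
      have := congrArg (· ^ p) hg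
      simp only [zero_pow (Fact.out : p.Prime).ne_zero, sum_pow_char] at this
      rw [← this]
      refine Finset.sum_congr rfl fun j _ ↦ ?_
      simp [Subfield.smul_def, mul_pow, hb']
    have h2 := linearIndependent_iff'.mp b.linearIndependent s _ h1 i hi
    have h3 : (g i : E) ^ p = 0 := congrArg Subtype.val h2
    exact Subtype.ext (eq_zero_of_pow_eq_zero h3)
  have hsp : ⊤ ≤ Submodule.span (rootField p L) (Set.range b') := by
    intro y _
    choose n hn using fun j ↦
      (mem_powField p).mp (h.repr_mem_powField hbk hkk (pow_mem_powField p y) j)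
    have h1 : y = ∑ j ∈ (b.repr (y ^ p)).support,
        (⟨n j, by rw [mem_rootField, hn]; exact Subtype.prop _⟩ : rootField p L) • b' j := by
      apply pow_p_injective p
      rw [sum_pow_char]
      conv_lhs =>
        rw [← b.linearCombination_repr (y ^ p), Finsupp.linearCombination_apply, Finsupp.sum]
      refine Finset.sum_congr rfl fun j _ ↦ ?_
      simp [Subfield.smul_def, mul_pow, hb', hn]
    rw [h1]
    exact sum_mem fun j _ ↦ Submodule.smul_mem _ _ (Submodule.subset_span ⟨j, rfl⟩)
  refine ⟨ι, Module.Basis.mk hli hsp, i₀, ?_, by simpa using hb'k, ?_⟩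
  · apply pow_p_injective p
    rw [Module.Basis.mk_apply, hb', hb1, one_pow]
  · intro c hc i
    set B := Module.Basis.mk hli hsp with hB
    have h1 : c ^ p = Finsupp.linearCombination L b
        ((B.repr c).mapRange (fun g : rootField p L ↦ (⟨(g : E) ^ p, g.2⟩ : L))
          (Subtype.ext (by simp [(Fact.out : p.Prime).ne_zero]))) := by
      conv_lhs => rw [← B.linearCombination_repr c, Finsupp.linearCombination_apply, Finsupp.sum]
      rw [sum_pow_char, Finsupp.linearCombination_apply,
        Finsupp.sum_mapRange_index (by simp), Finsupp.sum]
      refine Finset.sum_congr rfl fun j _ ↦ ?_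
      simp [Subfield.smul_def, mul_pow, hB, hb']
    have h2 := hkk _ (pow_mem hc p) i
    rw [h1, Module.Basis.repr_linearCombination, Finsupp.mapRange_apply] at h2
    obtain ⟨d, hd, hd'⟩ := h.root _ h2
    rwa [← pow_p_injective p hd']

/-- The coefficients of an element of `L` with respect to the powers of an element of `L` lie
in `L`. -/
theorem exists_coeff_mem {L : Subfield E} (hL : Descends k L) {η : E} (hηL : η ∈ L)
    (hη : η ∉ powField E p) {x : E} (hx : x ∈ L) :
    ∃ u : ℕ → E, (∀ a, u a ∈ L ∧ u a ∈ powField E p) ∧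
      x = ∑ a ∈ Finset.range p, u a * η ^ a := by
  obtain ⟨ι, b, i₀, hb1, hbk, hkk⟩ := hL
  obtain ⟨u, hu, hsum⟩ := exists_pow_coeff h.finrank hη x
  -- The coordinate at `i₀`, where the basis vector is `1`, is an `L`-linear projection of `E` onto
  -- `L`. It fixes `x`, commutes with multiplication by `η ^ a`, and preserves `p`-th powers.
  refine ⟨fun a ↦ b.repr (u a) i₀, fun a ↦
    ⟨Subtype.prop _, h.repr_mem_powField hbk hkk (hu a) i₀⟩, ?_⟩
  have h1 : b.repr x i₀ = (⟨x, hx⟩ : L) := by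
    have : x = (⟨x, hx⟩ : L) • b i₀ := by simp [hb1, Subfield.smul_def]
    conv_lhs => rw [this]
    simp
  have h2 := congrArg (fun y ↦ (b.repr y i₀ : E)) hsum
  simp only [h1, map_sum, Finsupp.finsetSum_apply] at h2
  rw [h2]
  push_cast
  refine Finset.sum_congr rfl fun a _ ↦ ?_
  have : u a * η ^ a = (⟨η ^ a, pow_mem hηL a⟩ : L) • u a := by
    rw [Subfield.smul_def, smul_eq_mul, mul_comm]
  rw [this, map_smul, Finsupp.smul_apply, smul_eq_mul]
  push_cast
  rw [mul_comm]

end IsCurveVal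

end CurveValuation

/-! ### Existence of a generator of the valuation ring over its `p`-th powers -/

section Generator

variable {E : Type u} [Field E] {p : ℕ} [Fact p.Prime] [CharP E p]
  {v : E → ℤ} {k : Subfield E} {t : E}

/-- The `k`-span of the valuation ring of `L`. -/
def valSpan (hv : IsIntVal v) (k L : Subfield E) : Submodule k E :=
  Submodule.span k {x | x ∈ L ∧ x ∈ hv.fil 0}

/-- An element `η` of the valuation ring of `L` whose powers form a basis over the subring of
`p`-th powers. -/
structure IsGenerator (p : ℕ) [Fact p.Prime] [CharP E p] (hv : IsIntVal v) (L : Subfield E)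
    (η : E) : Prop where
  mem : η ∈ L
  mem_fil : η ∈ hv.fil 0
  notMem : η ∉ powField E p
  exists_coeff : ∀ x ∈ L, x ∈ hv.fil 0 → ∃ u : ℕ → E,
    (∀ a, u a ∈ L ∧ u a ∈ powField E p ∧ u a ∈ hv.fil 0) ∧
      x = ∑ a ∈ Finset.range p, u a * η ^ a

namespace IsIntVal

variable (hv : IsIntVal v)
include hv

/-- The restriction of `v` to `L` need not be normalized; division with remainder by the least
positive value shows that it divides all the others. -/
theorem exists_uniformizer {L : Subfield E} (hL : ∃ x ∈ L, x ≠ 0 ∧ 0 < v x) :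
    ∃ π ∈ L, π ≠ 0 ∧ 0 < v π ∧ ∀ x ∈ L, x ≠ 0 → v π ∣ v x := by
  classical
  have hex : ∃ n : ℕ, ∃ x ∈ L, x ≠ 0 ∧ 0 < v x ∧ v x = n := by
    obtain ⟨x, hx, hx0, hpos⟩ := hL
    exact ⟨(v x).toNat, x, hx, hx0, hpos, by omega⟩
  obtain ⟨π, hπ, hπ0, hpos, hn⟩ := Nat.find_spec hex
  refine ⟨π, hπ, hπ0, hpos, fun x hx hx0 ↦ ?_⟩
  by_contra hdvd
  have hz : π ^ (-(v x / v π)) ≠ 0 := zpow_ne_zero _ hπ0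
  have hval : v (x * π ^ (-(v x / v π))) = v x % v π := by
    rw [hv.map_mul hx0 hz, hv.map_zpow hπ0]
    have := Int.emod_add_mul_ediv (v x) (v π)
    linarith
  have hlt := Int.emod_lt_of_pos (v x) hpos
  have hge := Int.emod_nonneg (v x) hpos.ne'
  have hne : v x % v π ≠ 0 := fun h ↦ hdvd (Int.dvd_of_emod_eq_zero h)
  refine Nat.find_min hex (m := (v x % v π).toNat) (by omega)
    ⟨x * π ^ (-(v x / v π)), mul_mem hx (zpow_mem hπ _), mul_ne_zero hx0 hz, by omega, by omega⟩

theorem mul_sub_mul_mem {z c z' c' : E} (hz : z ∈ hv.fil 0) (hc' : c' ∈ hv.fil 0)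
    (h1 : z - c ∈ hv.fil 1) (h2 : z' - c' ∈ hv.fil 1) : z * z' - c * c' ∈ hv.fil 1 := by
  have : z * z' - c * c' = z * (z' - c') + c' * (z - c) := by ring
  rw [this]
  exact add_mem (hv.mul_mem_fil_of_mem_zero hz h2) (hv.mul_mem_fil_of_mem_zero hc' h1)

end IsIntVal

namespace IsCurveVal

variable (h : IsCurveVal p v k t)
include h

theorem pow_sub_pow_mem {z c : E} (hz : z ∈ h.fil 0) (hc : c ∈ h.fil 0) (h1 : z - c ∈ h.fil 1)
    (n : ℕ) : z ^ n - c ^ n ∈ h.fil 1 := by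
  induction n with
  | zero => simp
  | succ n ih =>
    rw [pow_succ, pow_succ]
    exact h.mul_sub_mul_mem (h.pow_mem_fil_zero hz n) hc ih h1

/-- The residue field, as a subfield of `k`, of the valuation ring of a subfield. -/
def residueSubfield (L : Subfield E) : Subfield E where
  carrier := {c | c ∈ k ∧ ∃ z ∈ L, z ∈ h.fil 0 ∧ z - c ∈ h.fil 1}
  mul_mem' := by
    rintro c c' ⟨hc, z, hz, hz0, hzc⟩ ⟨hc', z', hz', hz0', hzc'⟩
    exact ⟨mul_mem hc hc', z * z', mul_mem hz hz', h.mul_mem_fil_zero hz0 hz0',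
      h.mul_sub_mul_mem hz0 (h.mem_fil_of_mem hc') hzc hzc'⟩
  one_mem' := ⟨one_mem k, 1, one_mem L, h.one_mem_fil, by simp⟩
  add_mem' := by
    rintro c c' ⟨hc, z, hz, hz0, hzc⟩ ⟨hc', z', hz', hz0', hzc'⟩
    exact ⟨add_mem hc hc', z + z', add_mem hz hz', add_mem hz0 hz0', by
      rw [add_sub_add_comm]
      exact add_mem hzc hzc'⟩
  zero_mem' := ⟨zero_mem k, 0, zero_mem L, zero_mem _, by simp⟩
  neg_mem' := by
    rintro c ⟨hc, z, hz, hz0, hzc⟩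
    exact ⟨neg_mem hc, -z, neg_mem hz, neg_mem hz0, by
      rw [neg_sub_neg, ← neg_sub]
      exact neg_mem hzc⟩
  inv_mem' := by
    rintro c ⟨hc, z, hz, hz0, hzc⟩
    by_cases hc0 : c = 0
    · subst hc0
      exact ⟨by simp, 0, zero_mem L, zero_mem _, by simp⟩
    have h1 := h.val_add_of_mem hc0 (y := z - c) (by rwa [h.val_k c hc hc0])
    rw [add_sub_cancel, h.val_k c hc hc0] at h1
    have hzi : z⁻¹ ∈ h.fil 0 := fun _ ↦ by rw [h.map_inv h1.1, h1.2, neg_zero]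
    refine ⟨inv_mem hc, z⁻¹, inv_mem hz, hzi, ?_⟩
    have h2 : z⁻¹ - c⁻¹ = (z⁻¹ * c⁻¹) * -(z - c) := by
      have := h1.1
      field_simp
      ring
    rw [h2]
    exact h.mul_mem_fil_of_mem_zero
      (h.mul_mem_fil_zero hzi (h.mem_fil_of_mem (inv_mem hc))) (neg_mem hzc)

/-- In the unramified case the residue field of `L` is not that of its subfield of `p`-th
powers. -/
theorem exists_residue_notMem {L : Subfield E} {π : E} (hπ : π ∈ L) (hπF : π ∈ powField E p)
    (hπ0 : π ≠ 0) (hpos : 0 < v π) (hdvd : ∀ x ∈ L, x ≠ 0 → v π ∣ v x) {N : ℤ}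
    (hN : ∀ x ∈ h.fil N, x ∈ valSpan h.toIsIntVal k L) :
    ∃ y ∈ L, y ∈ h.fil 0 ∧ ∀ z ∈ L ⊓ powField E p, z ∈ h.fil 0 → y - z ∉ h.fil 1 := by
  by_contra! hcon
  -- Successive approximation: if every residue came from a `p`-th power in `L`, then, since `π` is
  -- itself such a `p`-th power, one could correct one power of `π` at a time.
  have approx (M : ℕ) : ∀ y ∈ L, y ∈ h.fil 0 →
      ∃ z ∈ L ⊓ powField E p, z ∈ h.fil 0 ∧ y - z ∈ h.fil M := by
    induction M with
    | zero => exact fun y _ hy ↦ ⟨0, zero_mem _, zero_mem _, by simpa using hy⟩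
    | succ M ih =>
      intro y hy hy0
      obtain ⟨z, hz, hz0, hyz⟩ := hcon y hy hy0
      have h1 : (y - z) * π⁻¹ ∈ h.fil 0 := by
        intro hne
        have hyz0 := left_ne_zero_of_mul hne
        rw [h.map_mul hyz0 (inv_ne_zero hπ0), h.map_inv hπ0]
        have := Int.le_of_dvd (by have := hyz hyz0; omega) (hdvd _ (sub_mem hy hz.1) hyz0)
        omega
      obtain ⟨z', hz', hz0', hyz'⟩ := ih _ (mul_mem (sub_mem hy hz.1) (inv_mem hπ)) h1
      have hπ0' : π ∈ h.fil 0 := fun _ ↦ hpos.le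
      refine ⟨z + π * z', add_mem hz (mul_mem ⟨hπ, hπF⟩ hz'),
        add_mem hz0 (h.mul_mem_fil_zero hπ0' hz0'), ?_⟩
      have h2 : y - (z + π * z') = π * ((y - z) * π⁻¹ - z') := by
        field_simp
        ring
      rw [h2]
      refine h.fil_mono ?_ (h.mul_mem_fil (h.mem_fil_val π) hyz')
      push_cast
      omega
  have approx' (M : ℕ) : ∀ x ∈ valSpan h.toIsIntVal k L,
      ∃ a ∈ powField E p, x - a ∈ h.fil M := by
    intro x hx
    induction hx using Submodule.span_induction with
    | mem x hx =>
      obtain ⟨z, hz, -, hxz⟩ := approx M x hx.1 hx.2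
      exact ⟨z, hz.2, hxz⟩
    | zero => exact ⟨0, zero_mem _, by simp⟩
    | add x y _ _ hx hy =>
      obtain ⟨a, ha, hxa⟩ := hx
      obtain ⟨b, hb, hyb⟩ := hy
      exact ⟨a + b, add_mem ha hb, by
        rw [add_sub_add_comm]
        exact add_mem hxa hyb⟩
    | smul c x _ hx =>
      obtain ⟨a, ha, hxa⟩ := hx
      refine ⟨c * a, mul_mem (h.mem_powField_of_mem c.2) ha, ?_⟩
      rw [Subfield.smul_def, smul_eq_mul, ← mul_sub]
      exact h.mul_mem_fil_of_mem_zero (h.mem_fil_of_mem c.2) hxa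
  have hp := (Fact.out : p.Prime)
  -- An exponent at least `N` and prime to `p`: `t ^ j` lies in the span, yet an element agreeing
  -- with it beyond order `j` has value `j` and cannot be a `p`-th power.
  set j := p * N.natAbs + 1 with hj
  have hvt : v (t ^ j) = j := by rw [h.map_pow h.t_ne, h.val_t, mul_one]
  have hjN : N ≤ j := by
    have : N.natAbs ≤ p * N.natAbs := Nat.le_mul_of_pos_left _ hp.pos
    omega
  obtain ⟨a, ha, hta⟩ := approx' (j + 1) (t ^ j) (hN _ fun _ ↦ by rw [hvt]; exact hjN)
  have h1 := h.val_add_of_mem (pow_ne_zero j h.t_ne) (y := -(t ^ j - a))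
    (neg_mem (by rw [hvt]; exact_mod_cast hta))
  rw [← sub_eq_add_neg, sub_sub_cancel, hvt] at h1
  have h2 := h1.2 ▸ h.dvd_val ha h1.1
  have h3 := (Nat.dvd_add_right (dvd_mul_right p N.natAbs)).mp (Int.natCast_dvd_natCast.mp h2)
  exact hp.one_lt.ne' (Nat.dvd_one.mp h3)

/-- Residual independence of the powers of an element whose residue is not a residue of a `p`-th
power. -/
theorem coeff_mem_fil_of_residue {L : Subfield E} {y : E} (hyL : y ∈ L) (hy0 : y ∈ h.fil 0)
    (hy : ∀ z ∈ L ⊓ powField E p, z ∈ h.fil 0 → y - z ∉ h.fil 1) {u : ℕ → E}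
    (hu : ∀ a, u a ∈ L ⊓ powField E p)
    (hsum : ∑ a ∈ Finset.range p, u a * y ^ a ∈ h.fil 0) {a : ℕ} (ha : a < p) :
    u a ∈ h.fil 0 := by
  classical
  by_contra hcon
  have hp := (Fact.out : p.Prime)
  have hua : u a ≠ 0 ∧ v (u a) < 0 := by
    by_contra h1
    push Not at h1
    exact hcon h1
  -- Dividing by the coefficient of least, hence negative, value makes all coefficients integral and
  -- the sum of positive value, so that it reduces to a relation between residues.
  obtain ⟨b, hb, hmin⟩ := Finset.exists_min_image ((Finset.range p).filter fun i ↦ u i ≠ 0)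
    (fun i ↦ v (u i)) ⟨a, by simp [ha, hua.1]⟩
  simp only [Finset.mem_filter, Finset.mem_range] at hb hmin
  have hvb : v (u b) < 0 := (hmin a ⟨ha, hua.1⟩).trans_lt hua.2
  have hinv := inv_ne_zero hb.2
  have hw (i : ℕ) (hi : i < p) : u i * (u b)⁻¹ ∈ h.fil 0 := by
    intro h0
    have hi0 := left_ne_zero_of_mul h0
    rw [h.map_mul hi0 hinv, h.map_inv hb.2]
    have := hmin i ⟨hi, hi0⟩
    omega
  set F₀ := h.residueSubfield (L ⊓ powField E p) with hF₀
  obtain ⟨c, hck, hyc⟩ := h.residue y hy0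
  have hcF : c ∉ F₀ := by
    rintro ⟨-, z, hz, hz0, hzc⟩
    refine hy z hz hz0 ?_
    rw [← sub_sub_sub_cancel_right y z c]
    exact sub_mem hyc hzc
  have hcp : c ^ p ∈ F₀ := ⟨pow_mem hck p, y ^ p, ⟨pow_mem hyL p, pow_mem_powField p y⟩,
    h.pow_mem_fil_zero hy0 p, h.pow_sub_pow_mem hy0 (h.mem_fil_of_mem hck) hyc p⟩
  -- The residue `c` of `y` is not in `F₀` but `c ^ p` is, so the powers of `c` below `p` are
  -- independent over `F₀`. The reduced relation has coefficient `1` at `b`, a contradiction.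
  have hirr : Irreducible (Polynomial.X ^ p - Polynomial.C (⟨c ^ p, hcp⟩ : F₀)) := by
    refine X_pow_sub_C_irreducible_of_prime hp fun b hb ↦ hcF ?_
    have : (b : E) ^ p = c ^ p := congrArg Subtype.val hb
    exact pow_p_injective p this ▸ b.2
  have hmin' : (minpoly F₀ c).natDegree = p := by
    rw [← minpoly.eq_of_irreducible_of_monic hirr (x := c)
      (by simp [Algebra.algebraMap_eq_smul_one, Subfield.smul_def])
      (Polynomial.monic_X_pow_sub_C _ hp.ne_zero), Polynomial.natDegree_X_pow_sub_C]
  have hli := linearIndependent_pow (K := F₀) c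
  rw [hmin'] at hli
  have hres (i : ℕ) : ∃ w : F₀, i < p → u i * (u b)⁻¹ - w ∈ h.fil 1 := by
    by_cases hi : i < p
    · obtain ⟨w, hwk, hw1⟩ := h.residue _ (hw i hi)
      exact ⟨⟨w, hwk, _, mul_mem (hu i) (inv_mem (hu b)), hw i hi, hw1⟩, fun _ ↦ hw1⟩
    · exact ⟨0, fun h ↦ absurd h hi⟩
  choose w hw1 using hres
  have hsum1 : (∑ i ∈ Finset.range p, u i * y ^ i) * (u b)⁻¹ ∈ h.fil 1 := by
    refine h.fil_mono (n := 0 + 1) (by omega) (h.mul_mem_fil hsum fun _ ↦ ?_)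
    rw [h.map_inv hb.2]
    omega
  have hdiff : (∑ i ∈ Finset.range p, u i * y ^ i) * (u b)⁻¹ -
      ∑ i ∈ Finset.range p, (w i : E) * c ^ i ∈ h.fil 1 := by
    rw [Finset.sum_mul, ← Finset.sum_sub_distrib]
    refine sum_mem fun i hi ↦ ?_
    rw [Finset.mem_range] at hi
    rw [mul_right_comm]
    exact h.mul_sub_mul_mem (hw i hi) (h.pow_mem_fil_zero (h.mem_fil_of_mem hck) i) (hw1 i hi)
      (h.pow_sub_pow_mem hy0 (h.mem_fil_of_mem hck) hyc i)
  have hzero : ∑ i ∈ Finset.range p, (w i : E) * c ^ i = 0 := by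
    refine h.eq_zero_of_mem (sum_mem fun i _ ↦ mul_mem (w i).2.1 (pow_mem hck i)) ?_
    have := sub_mem hsum1 hdiff
    rwa [sub_sub_cancel] at this
  rw [Finset.sum_range] at hzero
  have hwb : w b = 0 := Fintype.linearIndependent_iff.mp hli (fun i ↦ w i)
    (by simpa [Subfield.smul_def] using hzero) ⟨b, hb.1⟩
  have h5 := hw1 b hb.1
  rw [hwb, mul_inv_cancel₀ hb.2] at h5
  simp only [ZeroMemClass.coe_zero, sub_zero] at h5
  have h6 := h5 one_ne_zero
  rw [h.map_one] at h6
  omega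

/-- A dichotomy for `L` over its subfield of `p`-th powers in `E`. If the extension is ramified, a
uniformizer generates, since values separate its powers. Otherwise the subfield contains a
uniformizer of `L`, the residue field must grow, and a lift of a new residue generates. -/
theorem exists_isGenerator {L : Subfield E} (hL : Descends k L) (hpos : ∃ x ∈ L, x ≠ 0 ∧ 0 < v x)
    {N : ℤ} (hN : ∀ x ∈ h.fil N, x ∈ valSpan h.toIsIntVal k L) :
    ∃ η, IsGenerator p h.toIsIntVal L η := by
  have hp := (Fact.out : p.Prime)
  obtain ⟨π, hπ, hπ0, hπpos, hdvd⟩ := h.exists_uniformizer hpos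
  by_cases hram : ∀ x ∈ L ⊓ powField E p, x ≠ 0 → (p : ℤ) * v π ∣ v x
  · have hπF : π ∉ powField E p := fun hF ↦ by
      have := Int.le_of_dvd hπpos (hram π ⟨hπ, hF⟩ hπ0)
      have h2 : (2 : ℤ) ≤ p := by exact_mod_cast hp.two_le
      nlinarith
    refine ⟨π, hπ, fun _ ↦ hπpos.le, hπF, fun x hx hx0 ↦ ?_⟩
    obtain ⟨u, hu, hsum⟩ := h.exists_coeff_mem hL hπ hπF hx
    refine ⟨fun a ↦ if a < p then u a else 0, fun a ↦ ?_, ?_⟩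
    · by_cases ha : a < p
      swap
      · simp only [if_neg ha]
        exact ⟨zero_mem _, zero_mem _, zero_mem _⟩
      simp only [if_pos ha]
      refine ⟨(hu a).1, (hu a).2, fun h0 ↦ ?_⟩
      have h1 := h.mem_fil_of_sum_mem (Finset.range p) (fun a ↦ u a * π ^ a) ?_ (hsum ▸ hx0)
        (Finset.mem_range.mpr ha)
      · have h2 := h1 (mul_ne_zero h0 (pow_ne_zero a hπ0))
        rw [h.map_mul h0 (pow_ne_zero a hπ0), h.map_pow hπ0] at h2
        obtain ⟨m, hm⟩ := hram _ (hu a) h0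
        rw [hm] at h2 ⊢
        by_contra hneg
        have hm0 : m ≤ -1 := by
          by_contra hm0
          exact hneg (mul_nonneg (by positivity) (by omega))
        have : (a : ℤ) < p := by exact_mod_cast ha
        nlinarith [mul_pos (show (0 : ℤ) < p by exact_mod_cast hp.pos) hπpos]
      · intro i hi j hj hi0 hj0 hij
        rw [Finset.mem_range] at hi hj
        rw [h.map_mul (left_ne_zero_of_mul hi0) (right_ne_zero_of_mul hi0),
          h.map_mul (left_ne_zero_of_mul hj0) (right_ne_zero_of_mul hj0), h.map_pow hπ0,
          h.map_pow hπ0] at hij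
        obtain ⟨m, hm⟩ := hram _ (hu i) (left_ne_zero_of_mul hi0)
        obtain ⟨n, hn⟩ := hram _ (hu j) (left_ne_zero_of_mul hj0)
        rw [hm, hn] at hij
        have h3 : (p : ℤ) * m + i = p * n + j :=
          mul_right_cancel₀ hπpos.ne' (by linarith)
        have h4 : (p : ℤ) ∣ (i : ℤ) - j := ⟨n - m, by linarith⟩
        have h5 := Int.eq_zero_of_abs_lt_dvd h4 (by rw [abs_lt]; omega)
        omega
    · rw [hsum]
      exact Finset.sum_congr rfl fun a ha ↦ by simp only [if_pos (Finset.mem_range.mp ha)]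
  · push Not at hram
    obtain ⟨x, hx, hx0, hxd⟩ := hram
    obtain ⟨j, hj⟩ := hdvd x hx.1 hx0
    have hpj : ¬ (p : ℤ) ∣ j := fun ⟨m, hm⟩ ↦ hxd ⟨m, by rw [hj, hm]; ring⟩
    -- Bézout for `p` and `j = v x / v π`: combining `x` with `π ^ p` gives an element of value `v
    -- π` inside the subfield of `p`-th powers.
    obtain ⟨α, β, hαβ⟩ :=
      (Nat.prime_iff_prime_int.mp hp).irreducible.coprime_iff_not_dvd.mpr hpj
    have hxz : x ^ β ≠ 0 := zpow_ne_zero _ hx0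
    have hπz : (π ^ p) ^ α ≠ 0 := zpow_ne_zero _ (pow_ne_zero p hπ0)
    set π' := x ^ β * (π ^ p) ^ α with hπ'
    have hval : v π' = v π := by
      rw [hπ', h.map_mul hxz hπz, h.map_zpow hx0, h.map_zpow (pow_ne_zero p hπ0), h.map_pow hπ0,
        hj]
      linear_combination (v π) * hαβ
    have hπp : π ^ p ∈ L ⊓ powField E p := ⟨pow_mem hπ p, pow_mem_powField p π⟩
    have hπ'm : π' ∈ L ⊓ powField E p := mul_mem (zpow_mem hx _) (zpow_mem hπp _)
    obtain ⟨y, hyL, hy0, hy⟩ := h.exists_residue_notMem hπ'm.1 hπ'm.2 (mul_ne_zero hxz hπz)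
      (hval ▸ hπpos) (hval ▸ hdvd) hN
    have hyF : y ∉ powField E p := fun hF ↦ hy y ⟨hyL, hF⟩ hy0 (by simp)
    refine ⟨y, hyL, hy0, hyF, fun x hx hx0 ↦ ?_⟩
    obtain ⟨u, hu, hsum⟩ := h.exists_coeff_mem hL hyL hyF hx
    refine ⟨fun a ↦ if a < p then u a else 0, fun a ↦ ?_, ?_⟩
    · by_cases ha : a < p
      · simp only [if_pos ha]
        exact ⟨(hu a).1, (hu a).2, h.coeff_mem_fil_of_residue hyL hy0 hy hu (hsum ▸ hx0) ha⟩
      · simp only [if_neg ha]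
        exact ⟨zero_mem _, zero_mem _, zero_mem _⟩
    · rw [hsum]
      exact Finset.sum_congr rfl fun a ha ↦ by simp only [if_pos (Finset.mem_range.mp ha)]

end IsCurveVal

end Generator

/-! ### The conductor recursion and the sum of conductor and differential exponents -/

section ConductorFormula

variable {E : Type u} [Field E] {p : ℕ} [Fact p.Prime] [CharP E p]
  {v : E → ℤ} {k : Subfield E} {t : E}

theorem valSpan_mono (hv : IsIntVal v) {L L' : Subfield E} (h : L ≤ L') :
    valSpan hv k L ≤ valSpan hv k L' :=
  Submodule.span_mono fun _ hx ↦ ⟨h hx.1, hx.2⟩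

/-- `D` kills the coefficients of the expansion in powers of `η`, so `y` is the formal derivative
evaluated at `η`. Thus `D η` generates all derivatives of integral elements of `L`. -/
theorem IsGenerator.exists_derivation_eq {hv : IsIntVal v} {L : Subfield E} {η : E}
    (hη : IsGenerator p hv L η) (D : Derivation (powField E p) E E) {x : E} (hx : x ∈ L)
    (hx0 : x ∈ hv.fil 0) : ∃ y ∈ L, y ∈ hv.fil 0 ∧ D x = y * D η := by
  obtain ⟨u, hu, hsum⟩ := hη.exists_coeff x hx hx0
  have hcast (a : ℕ) : (a : E) ∈ hv.fil 0 := by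
    induction a with
    | zero => simp
    | succ a ih => simpa using add_mem ih hv.one_mem_fil
  refine ⟨∑ a ∈ Finset.range p, u a * (a * η ^ (a - 1)),
    sum_mem fun a _ ↦ mul_mem (hu a).1 (mul_mem (natCast_mem _ a) (pow_mem hη.mem _)),
    sum_mem fun a _ ↦ hv.mul_mem_fil_zero (hu a).2.2
      (hv.mul_mem_fil_zero (hcast a) (hv.pow_mem_fil_zero hη.mem_fil _)), ?_⟩
  rw [hsum, map_sum, Finset.sum_mul]
  refine Finset.sum_congr rfl fun a _ ↦ ?_
  rw [IsCurveVal.derivation_mul D (hu a).2.1, D.leibniz_pow]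
  simp only [nsmul_eq_mul, smul_eq_mul]
  ring

namespace IsCurveVal

variable (h : IsCurveVal p v k t)
include h

theorem valSpan_le_fil {L : Subfield E} {x : E} (hx : x ∈ valSpan h.toIsIntVal k L) :
    x ∈ h.fil 0 := by
  induction hx using Submodule.span_induction with
  | mem x hx => exact hx.2
  | zero => exact zero_mem _
  | add x y _ _ hx hy => exact add_mem hx hy
  | smul c x _ hx => exact h.mul_mem_fil_zero (h.mem_fil_of_mem c.2) hx

/-- The `k`-span of the `p`-th powers in the valuation ring of `L`. -/
theorem pow_mem_valSpan_iff {L : Subfield E} {y : E} :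
    y ^ p ∈ valSpan h.toIsIntVal k (L ⊓ powField E p) ↔
      y ∈ valSpan h.toIsIntVal k (rootField p L) := by
  have hp := (Fact.out : p.Prime)
  constructor
  · intro hy
    suffices H : ∀ z ∈ valSpan h.toIsIntVal k (L ⊓ powField E p),
        ∃ y ∈ valSpan h.toIsIntVal k (rootField p L), y ^ p = z by
      obtain ⟨y', hy', he⟩ := H _ hy
      rwa [← pow_p_injective p he]
    intro z hz
    induction hz using Submodule.span_induction with
    | mem z hz =>
      obtain ⟨y, rfl⟩ := (mem_powField p).mp hz.1.2
      refine ⟨y, Submodule.subset_span ⟨hz.1.1, fun hy0 ↦ ?_⟩, rfl⟩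
      have := hz.2 (pow_ne_zero p hy0)
      rw [h.map_pow hy0] at this
      exact nonneg_of_mul_nonneg_right this (by exact_mod_cast hp.pos)
    | zero => exact ⟨0, zero_mem _, by simp [hp.ne_zero]⟩
    | add x y _ _ hx hy =>
      obtain ⟨a, ha, rfl⟩ := hx
      obtain ⟨b, hb, rfl⟩ := hy
      exact ⟨a + b, add_mem ha hb, by rw [add_pow_char]⟩
    | smul c x _ hx =>
      obtain ⟨a, ha, rfl⟩ := hx
      obtain ⟨d, hd, hd'⟩ := h.root c c.2
      refine ⟨d * a, Submodule.smul_mem _ (⟨d, hd⟩ : k) ha, ?_⟩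
      rw [mul_pow, hd', Subfield.smul_def, smul_eq_mul]
  · intro hy
    induction hy using Submodule.span_induction with
    | mem y hy =>
      exact Submodule.subset_span ⟨⟨hy.1, pow_mem_powField p y⟩, h.pow_mem_fil_zero hy.2 p⟩
    | zero => simp [hp.ne_zero]
    | add x y _ _ hx hy =>
      rw [add_pow_char]
      exact add_mem hx hy
    | smul c x _ hx =>
      rw [Subfield.smul_def, smul_eq_mul, mul_pow]
      exact Submodule.smul_mem _ (c ^ p) hx

theorem valSpan_inf_le {L : Subfield E} {x : E}
    (hx : x ∈ valSpan h.toIsIntVal k (L ⊓ powField E p)) : x ∈ powField E p := by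
  induction hx using Submodule.span_induction with
  | mem x hx => exact hx.1.2
  | zero => exact zero_mem _
  | add x y _ _ hx hy => exact add_mem hx hy
  | smul c x _ hx => exact mul_mem (h.mem_powField_of_mem c.2) hx

theorem exists_coeff_of_mem_valSpan {L : Subfield E} {η : E}
    (hη : IsGenerator p h.toIsIntVal L η) {x : E} (hx : x ∈ valSpan h.toIsIntVal k L) :
    ∃ u : ℕ → E, (∀ a, u a ∈ valSpan h.toIsIntVal k (L ⊓ powField E p)) ∧
      x = ∑ a ∈ Finset.range p, u a * η ^ a := by
  induction hx using Submodule.span_induction with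
  | mem x hx =>
    obtain ⟨u, hu, hsum⟩ := hη.exists_coeff x hx.1 hx.2
    exact ⟨u, fun a ↦ Submodule.subset_span ⟨⟨(hu a).1, (hu a).2.1⟩, (hu a).2.2⟩, hsum⟩
  | zero => exact ⟨0, fun _ ↦ zero_mem _, by simp⟩
  | add x y _ _ hx hy =>
    obtain ⟨u, hu, rfl⟩ := hx
    obtain ⟨w, hw, rfl⟩ := hy
    exact ⟨u + w, fun a ↦ add_mem (hu a) (hw a), by simp [add_mul, Finset.sum_add_distrib]⟩
  | smul c x _ hx =>
    obtain ⟨u, hu, rfl⟩ := hx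
    exact ⟨fun a ↦ c • u a, fun a ↦ Submodule.smul_mem _ c (hu a), by
      simp [Finset.smul_sum]⟩

theorem mul_pow_mem_valSpan {L : Subfield E} {η : E} (hη : IsGenerator p h.toIsIntVal L η) {x : E}
    (hx : x ∈ valSpan h.toIsIntVal k (L ⊓ powField E p)) (a : ℕ) :
    x * η ^ a ∈ valSpan h.toIsIntVal k L := by
  induction hx using Submodule.span_induction with
  | mem x hx => exact Submodule.subset_span ⟨mul_mem hx.1.1 (pow_mem hη.mem a),
      h.mul_mem_fil_zero hx.2 (h.pow_mem_fil_zero hη.mem_fil a)⟩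
  | zero => simp
  | add x y _ _ hx hy =>
    rw [add_mul]
    exact add_mem hx hy
  | smul c x _ hx =>
    rw [smul_mul_assoc]
    exact Submodule.smul_mem _ c hx

/-- How the conductor changes when the field of constants is enlarged by its `p`-th roots. -/
theorem fil_le_valSpan_iff (D : Derivation (powField E p) E E) (hD : D t = 1) {L : Subfield E}
    {η : E} (hη : IsGenerator p h.toIsIntVal L η) {c₁ : ℤ}
    (hc : ∀ s, (∀ x ∈ h.fil s, x ∈ valSpan h.toIsIntVal k (rootField p L)) ↔ c₁ ≤ s) (s : ℤ) :
    (∀ x ∈ h.fil s, x ∈ valSpan h.toIsIntVal k L) ↔ (p - 1) * v (D η) + p * c₁ ≤ s := by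
  have hp := (Fact.out : p.Prime)
  have hp0 : (0 : ℤ) < p := by exact_mod_cast hp.pos
  -- Two bases are used together: powers of `η` describe the span, while powers of `ζ = η - w`,
  -- having distinct values, describe the filtration. Since `D w = 0`, also `v ζ = v (D η) + 1`.
  obtain ⟨w, hw, hne, hndvd⟩ := h.exists_sub_val hη.notMem
  obtain ⟨l, hl0, hl1, hl2⟩ := exists_topCoeff h.finrank hη.notMem
  set ζ := η - w with hζ
  have hDη : D η = D ζ := by
    rw [hζ, map_sub, derivation_eq_zero D hw, sub_zero]
  have hm : v (D η) = v ζ - 1 := hDη ▸ (h.derivation_val D hD hne hndvd).2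
  have hζF : ζ ∉ powField E p := fun hF ↦ hndvd (h.dvd_val hF hne)
  -- `ζ ^ n` is `η ^ n` plus lower powers of `η` with `p`-th power coefficients, so `l` is the top
  -- coefficient for both bases.
  have hlζ (n : ℕ) (hn : n < p) : l (ζ ^ n) = if n = p - 1 then 1 else 0 := by
    have hterm (i : ℕ) : η ^ i * (-w) ^ (n - i) * (n.choose i : E) =
        ((-w) ^ (n - i) * (n.choose i : E)) * η ^ i := by ring
    rw [hζ, sub_eq_add_neg, add_pow, map_sum, Finset.sum_range_succ, Finset.sum_eq_zero, zero_add]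
    · simp only [Nat.sub_self, pow_zero, mul_one, Nat.choose_self, Nat.cast_one]
      split_ifs with h1
      · rw [h1, hl1]
      · exact hl0 n (by omega)
    · intro i hi
      rw [Finset.mem_range] at hi
      rw [hterm, linearMap_mul (mul_mem (pow_mem (neg_mem hw) _) (natCast_mem _ _)),
        hl0 i (by omega), mul_zero]
  have hlsum (u : ℕ → E) (hu : ∀ a, u a ∈ powField E p) :
      l (∑ a ∈ Finset.range p, u a * ζ ^ a) = u (p - 1) := by
    rw [map_sum, Finset.sum_eq_single (p - 1)]
    · rw [linearMap_mul (hu _), hlζ _ (Nat.sub_lt hp.pos one_pos), if_pos rfl, mul_one]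
    · intro b hb hb'
      rw [linearMap_mul (hu _), hlζ _ (Finset.mem_range.mp hb), if_neg hb', mul_zero]
    · intro h1
      simp [hp.pos] at h1
  -- The powers of `η` are dual to themselves in reversed order under `l`, so membership in the span
  -- can be tested by `l` alone.
  have hlη (u : ℕ → E) (hu : ∀ a, u a ∈ powField E p) (i : ℕ) (hi : i < p) :
      l (η ^ i * ∑ a ∈ Finset.range p, u a * η ^ a) = u (p - 1 - i) := by
    rw [Finset.mul_sum, map_sum, Finset.sum_eq_single (p - 1 - i)]
    · rw [mul_left_comm, linearMap_mul (hu _), ← pow_add,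
        show i + (p - 1 - i) = p - 1 by omega, hl1, mul_one]
    · intro b hb hb'
      rw [Finset.mem_range] at hb
      rw [mul_left_comm, linearMap_mul (hu _), ← pow_add]
      rcases lt_or_ge (i + b) p with h1 | h1
      · rw [hl0 _ (by omega), mul_zero]
      · rw [hl2 _ h1 (by omega), mul_zero]
    · intro h1
      exact absurd (Finset.mem_range.mpr (by omega)) h1
  constructor
  · intro hs
    -- The ceiling of `(s - (p - 1) * v ζ) / p`: the least `r` such that `r ≤ v y` forces `y ^ p * ζ
    -- ^ (p - 1)` to have value at least `s`.
    set r : ℤ := -((-(s - (p - 1) * v ζ)) / p) with hr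
    have hr1 : s ≤ p * r + (p - 1) * v ζ := by
      have := Int.mul_ediv_self_le (x := -(s - (p - 1) * v ζ)) hp0.ne'
      rw [hr]
      linarith
    have hr2 : p * r < s - (p - 1) * v ζ + p := by
      have := Int.lt_mul_ediv_self_add (x := -(s - (p - 1) * v ζ)) hp0
      rw [hr]
      linarith
    have hcr : c₁ ≤ r := by
      rw [← hc]
      intro y hy
      rw [← h.pow_mem_valSpan_iff]
      have hz : y ^ p * ζ ^ (p - 1) ∈ h.fil s := by
        intro h0
        have hy0 : y ≠ 0 := fun hy0 ↦ h0 (by simp [hy0, hp.ne_zero])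
        rw [h.map_mul (pow_ne_zero p hy0) (pow_ne_zero _ hne), h.map_pow hy0, h.map_pow hne,
          Nat.cast_pred hp.pos]
        have := mul_le_mul_of_nonneg_left (hy hy0) hp0.le
        linarith
      obtain ⟨u, hu, hsum⟩ := h.exists_coeff_of_mem_valSpan hη (hs _ hz)
      have h1 := hlη u (fun a ↦ h.valSpan_inf_le (hu a)) 0 hp.pos
      rw [pow_zero, one_mul, ← hsum, linearMap_mul (pow_mem_powField p y),
        hlζ _ (Nat.sub_lt hp.pos one_pos), if_pos rfl, mul_one] at h1
      rw [h1]
      exact hu _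
    rw [hm]
    have := mul_le_mul_of_nonneg_left hcr hp0.le
    nlinarith
  · intro hs x hx
    -- The top term `y ^ p * ζ ^ (p - 1)` of `z` has value at least `s`, which gives `c₁ - 1 < v y`;
    -- integrality then yields `c₁ ≤ v y`.
    have key (z : E) (hz : z ∈ h.fil s) :
        l z ∈ valSpan h.toIsIntVal k (L ⊓ powField E p) := by
      obtain ⟨u, hu, hsum⟩ := exists_pow_coeff h.finrank hζF z
      have h1 := h.mem_fil_of_sum_mem (Finset.range p) (fun a ↦ u a * ζ ^ a)
        (h.distinct_val hne hndvd hu) (hsum ▸ hz)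
        (Finset.mem_range.mpr (Nat.sub_lt hp.pos one_pos))
      rw [hsum, hlsum u hu]
      obtain ⟨y, hy⟩ := (mem_powField p).mp (hu (p - 1))
      rw [← hy, h.pow_mem_valSpan_iff]
      refine (hc c₁).mpr le_rfl y fun hy0 ↦ ?_
      have h2 := h1 (mul_ne_zero (hy ▸ pow_ne_zero p hy0) (pow_ne_zero _ hne))
      rw [← hy, h.map_mul (pow_ne_zero p hy0) (pow_ne_zero _ hne), h.map_pow hy0, h.map_pow hne,
        Nat.cast_pred hp.pos] at h2
      rw [hm] at hs
      have h3 : (p : ℤ) * c₁ < p * (v y + 1) := by nlinarith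
      have := lt_of_mul_lt_mul_left h3 hp0.le
      omega
    obtain ⟨u, hu, hsum⟩ := exists_pow_coeff h.finrank hη.notMem x
    rw [hsum]
    refine sum_mem fun a ha ↦ ?_
    rw [Finset.mem_range] at ha
    refine h.mul_pow_mem_valSpan hη ?_ a
    have h1 := hlη u hu (p - 1 - a) (by omega)
    rw [← hsum, show p - 1 - (p - 1 - a) = a by omega] at h1
    rw [← h1]
    exact key _ (h.mul_mem_fil_of_mem_zero (h.pow_mem_fil_zero hη.mem_fil _) hx)

/-- The uniformizer generates the full valuation ring over its `p`-th powers: `0 ≤ p * v w + a` with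
`a < p` forces `0 ≤ v w`. -/
theorem exists_coeff_t {x : E} (hx : x ∈ h.fil 0) :
    ∃ w : ℕ → E, (∀ a, w a ∈ h.fil 0) ∧ x = ∑ a ∈ Finset.range p, w a ^ p * t ^ a := by
  have hp := (Fact.out : p.Prime)
  obtain ⟨u, hu, hsum⟩ := exists_pow_coeff h.finrank h.t_notMem x
  choose w hw using fun a ↦ (mem_powField p).mp (hu a)
  refine ⟨fun a ↦ if a < p then w a else 0, fun a ↦ ?_, ?_⟩
  · dsimp only
    split_ifs with ha
    swap
    · exact zero_mem _
    intro h0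
    have h1 := h.mem_fil_of_sum_mem (Finset.range p) (fun a ↦ u a * t ^ a)
      (h.distinct_val h.t_ne h.not_dvd_val_t hu) (hsum ▸ hx) (Finset.mem_range.mpr ha)
    have h2 := h1 (mul_ne_zero (hw a ▸ pow_ne_zero p h0) (pow_ne_zero _ h.t_ne))
    rw [← hw, h.map_mul (pow_ne_zero p h0) (pow_ne_zero _ h.t_ne), h.map_pow h0,
      h.map_pow h.t_ne, h.val_t] at h2
    have h3 : (p : ℤ) * 0 < p * (v (w a) + 1) := by
      have : (a : ℤ) < p := by exact_mod_cast ha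
      linarith
    have := lt_of_mul_lt_mul_left h3 (by positivity)
    omega
  · rw [hsum]
    refine Finset.sum_congr rfl fun a ha ↦ ?_
    simp only [if_pos (Finset.mem_range.mp ha), hw]

theorem derivation_mem_fil_zero (D : Derivation (powField E p) E E) (hD : D t = 1) {x : E}
    (hx : x ∈ h.fil 0) : D x ∈ h.fil 0 := by
  obtain ⟨w, hw, hsum⟩ := h.exists_coeff_t hx
  rw [hsum, map_sum]
  refine sum_mem fun a _ ↦ ?_
  rw [derivation_mul D (pow_mem_powField p _), D.leibniz_pow, hD]
  simp only [nsmul_eq_mul, smul_eq_mul, mul_one]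
  exact h.mul_mem_fil_zero (h.pow_mem_fil_zero (hw a) p)
    (h.mul_mem_fil_zero (h.mem_fil_of_mem (natCast_mem k a))
      (h.pow_mem_fil_zero (fun _ ↦ by rw [h.val_t]; omega) _))

theorem derivation_ne_zero (D : Derivation (powField E p) E E) (hD : D t = 1) {η : E}
    (hη : η ∉ powField E p) : D η ≠ 0 := by
  obtain ⟨w, hw, hne, hndvd⟩ := h.exists_sub_val hη
  have := (h.derivation_val D hD hne hndvd).1
  rwa [map_sub, derivation_eq_zero D hw, sub_zero] at this

/-- An element of value at least `N` is a constant times `t ^ N` plus one of value at least `N + 1`;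
since `t ^ N` lies in the span, the bound descends to `0`. -/
theorem fil_le_valSpan_of_t_mem {L : Subfield E} (ht : t ∈ L) {N : ℕ}
    (hN : ∀ x ∈ h.fil N, x ∈ valSpan h.toIsIntVal k L) :
    ∀ x ∈ h.fil 0, x ∈ valSpan h.toIsIntVal k L := by
  have ht0 : t ∈ h.fil 0 := fun _ ↦ by rw [h.val_t]; omega
  induction N with
  | zero => exact hN
  | succ N ih =>
    refine ih fun x hx ↦ ?_
    have hx' : x * (t ^ N)⁻¹ ∈ h.fil 0 := by
      intro h0
      rw [h.map_mul (left_ne_zero_of_mul h0) (right_ne_zero_of_mul h0),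
        h.map_inv (pow_ne_zero _ h.t_ne), h.map_pow h.t_ne, h.val_t]
      have := hx (left_ne_zero_of_mul h0)
      omega
    obtain ⟨c, hc, hxc⟩ := h.residue _ hx'
    have h1 : x = c * t ^ N + (x * (t ^ N)⁻¹ - c) * t ^ N := by
      have := pow_ne_zero N h.t_ne
      field_simp
      ring
    rw [h1]
    refine add_mem ?_ (hN _ ?_)
    · exact Submodule.smul_mem _ (⟨c, hc⟩ : k)
        (Submodule.subset_span ⟨pow_mem ht N, h.pow_mem_fil_zero ht0 N⟩)
    · push_cast
      rw [add_comm]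
      refine h.mul_mem_fil hxc fun _ ↦ ?_
      rw [h.map_pow h.t_ne, h.val_t, mul_one]

/-- The sum of the conductor exponent and the differential exponent is the value of an element
of the valuation ring of `L`. -/
theorem exists_val_eq_conductor_add (D : Derivation (powField E p) E E) (hD : D t = 1) (n : ℕ)
    (L : Subfield E) (hL : Descends k L) (ht : t ^ p ^ n ∈ L) {N : ℕ}
    (hN : ∀ x ∈ h.fil N, x ∈ valSpan h.toIsIntVal k L) :
    ∃ c η r, (∀ s, (∀ x ∈ h.fil s, x ∈ valSpan h.toIsIntVal k L) ↔ c ≤ s) ∧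
      IsGenerator p h.toIsIntVal L η ∧ r ∈ L ∧ r ∈ h.fil 0 ∧ r ≠ 0 ∧ v r = c + v (D η) := by
  have hp := (Fact.out : p.Prime)
  have ht0 : t ∈ h.fil 0 := fun _ ↦ by rw [h.val_t]; omega
  obtain ⟨η, hη⟩ := h.exists_isGenerator hL ⟨t ^ p ^ n, ht, pow_ne_zero _ h.t_ne, by
    rw [h.map_pow h.t_ne, h.val_t, mul_one]
    exact_mod_cast pow_pos hp.pos n⟩ hN
  have hDη := h.derivation_ne_zero D hD hη.notMem
  -- The exponent `n` drops by one on passing from `L` to `rootField p L`, whose elements include `t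
  -- ^ p ^ n` when `t ^ p ^ (n + 1)` lies in `L`.
  induction n generalizing L η with
  | zero =>
    rw [pow_zero, pow_one] at ht
    refine ⟨0, η, 1, fun s ↦ ⟨fun hs ↦ ?_, fun hs x hx ↦ ?_⟩, hη, one_mem L, h.one_mem_fil,
      one_ne_zero, ?_⟩
    · have h1 := h.valSpan_le_fil (hs (t ^ s) fun _ ↦ by rw [h.map_zpow h.t_ne, h.val_t, mul_one])
        (zpow_ne_zero _ h.t_ne)
      rwa [h.map_zpow h.t_ne, h.val_t, mul_one] at h1
    · exact h.fil_le_valSpan_of_t_mem ht hN x (h.fil_mono hs hx)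
    -- Here `1 = D t = y * D η` with both factors integral, so `D η` is a unit and both exponents
    -- are `0`.
    · obtain ⟨y, -, hy0, hy⟩ := hη.exists_derivation_eq D ht ht0
      rw [hD] at hy
      have hyne : y ≠ 0 := by
        rintro rfl
        simp at hy
      have h1 := congrArg v hy
      rw [h.map_mul hyne hDη] at h1
      have h2 := hy0 hyne
      have h3 := h.derivation_mem_fil_zero D hD hη.mem_fil hDη
      rw [h.map_one] at h1 ⊢
      omega
  | succ n ih =>
    have hN' : ∀ x ∈ h.fil N, x ∈ valSpan h.toIsIntVal k (rootField p L) :=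
      fun x hx ↦ valSpan_mono _ (le_rootField L) (hN x hx)
    have ht' : t ^ p ^ n ∈ rootField p L := by
      rwa [mem_rootField, ← pow_mul, ← pow_succ]
    have hL' := h.descends_rootField hL
    obtain ⟨η', hη'⟩ := h.exists_isGenerator hL' ⟨t ^ p ^ n, ht', pow_ne_zero _ h.t_ne, by
      rw [h.map_pow h.t_ne, h.val_t, mul_one]
      exact_mod_cast pow_pos hp.pos n⟩ hN'
    obtain ⟨c₁, η₁, r₁, hc₁, hη₁, hr₁L, hr₁0, hr₁ne, hr₁⟩ := ih _ hL' ht' hN' η' hη'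
      (h.derivation_ne_zero D hD hη'.notMem)
    have hDη₁ := h.derivation_ne_zero D hD hη₁.notMem
    obtain ⟨y, hyL, hy0, hy⟩ := hη₁.exists_derivation_eq D (le_rootField L hη.mem) hη.mem_fil
    have hyne : y ≠ 0 := by
      rintro rfl
      rw [zero_mul] at hy
      exact hDη hy
    have hvy : v (D η) = v y + v (D η₁) := by rw [hy, h.map_mul hyne hDη₁]
    -- Adding `v (D η)` to the conductor gives `p * (c₁ + v (D η)) = p * (c₁ + v (D η₁) + v y)`, the
    -- value of `(r₁ * y) ^ p`; the power lies in `L` because `r₁ * y` lies in `rootField p L`.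
    refine ⟨(p - 1) * v (D η) + p * c₁, η, (r₁ * y) ^ p, h.fil_le_valSpan_iff D hD hη hc₁, hη,
      mul_mem hr₁L hyL, h.pow_mem_fil_zero (h.mul_mem_fil_zero hr₁0 hy0) p,
      pow_ne_zero _ (mul_ne_zero hr₁ne hyne), ?_⟩
    rw [h.map_pow (mul_ne_zero hr₁ne hyne), h.map_mul hr₁ne hyne, hr₁, hvy]
    ring

end IsCurveVal

end ConductorFormula

/-! ### The integer-valued valuation of a discrete valuation ring -/

section FractionValuation

open IsDiscreteValuationRing

variable (B E : Type u) [CommRing B] [IsDomain B] [IsDiscreteValuationRing B] [Field E]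
  [Algebra B E] [IsFractionRing B E]

/-- The normalized valuation on the field of fractions of a discrete valuation ring, with integer
values. -/
noncomputable def fracVal (x : E) : ℤ :=
  -WithZero.log ((IsDiscreteValuationRing.maximalIdeal B).valuation E x)

variable {B E}

theorem isIntVal_fracVal : IsIntVal (fracVal B E) where
  map_mul {x y} hx hy := by
    unfold fracVal
    rw [_root_.map_mul, WithZero.log_mul (by simpa using hx) (by simpa using hy)]
    ring
  map_add {x y} hx hy hxy := by
    unfold fracVal
    have hx' : (IsDiscreteValuationRing.maximalIdeal B).valuation E x ≠ 0 := by simpa using hx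
    have hy' : (IsDiscreteValuationRing.maximalIdeal B).valuation E y ≠ 0 := by simpa using hy
    have hxy' : (IsDiscreteValuationRing.maximalIdeal B).valuation E (x + y) ≠ 0 := by
      simpa using hxy
    have h := ((IsDiscreteValuationRing.maximalIdeal B).valuation E).map_add x y
    rcases le_max_iff.mp h with h | h
    · have := (WithZero.log_le_log hxy' hx').mpr h
      omega
    · have := (WithZero.log_le_log hxy' hy').mpr h
      omega

theorem mem_fil_fracVal {x : E} :
    x ∈ (isIntVal_fracVal (B := B) (E := E)).fil 0 ↔ ∃ b : B, algebraMap B E b = x := by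
  rw [IsIntVal.mem_fil]
  constructor
  · intro h
    by_cases hx : x = 0
    · exact ⟨0, by simp [hx]⟩
    apply exists_lift_of_le_one
    have hx' : (IsDiscreteValuationRing.maximalIdeal B).valuation E x ≠ 0 := by simpa using hx
    rw [← WithZero.log_le_log hx' one_ne_zero, WithZero.log_one]
    have := h hx
    unfold fracVal at this
    omega
  · rintro ⟨b, rfl⟩ hb
    have hx' : (IsDiscreteValuationRing.maximalIdeal B).valuation E (algebraMap B E b) ≠ 0 := by
      simpa using hb
    have := (WithZero.log_le_log hx' one_ne_zero).mpr
      ((IsDiscreteValuationRing.maximalIdeal B).valuation_le_one b)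
    rw [WithZero.log_one] at this
    unfold fracVal
    omega

theorem algebraMap_mem_fil (b : B) :
    algebraMap B E b ∈ (isIntVal_fracVal (B := B) (E := E)).fil 0 := mem_fil_fracVal.mpr ⟨b, rfl⟩

theorem fracVal_unit (u : Bˣ) : fracVal B E (algebraMap B E u) = 0 := by
  have hv := isIntVal_fracVal (B := B) (E := E)
  have h0 : algebraMap B E u ≠ 0 := by simp
  have h0' : algebraMap B E (u⁻¹ : Bˣ) ≠ 0 := by simp
  have h1 := hv.map_mul h0 h0'
  rw [← _root_.map_mul, Units.mul_inv, _root_.map_one, hv.map_one] at h1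
  have := algebraMap_mem_fil (E := E) (u : B) h0
  have := algebraMap_mem_fil (E := E) ((u⁻¹ : Bˣ) : B) h0'
  omega

theorem fracVal_irreducible {ϖ : B} (hϖ : Irreducible ϖ) :
    fracVal B E (algebraMap B E ϖ) = 1 := by
  unfold fracVal
  rw [IsDedekindDomain.HeightOneSpectrum.valuation_of_algebraMap,
    IsDedekindDomain.HeightOneSpectrum.intValuation_singleton _ hϖ.ne_zero
      hϖ.maximalIdeal_eq]
  simp

theorem addVal_eq_fracVal {b : B} (hb : b ≠ 0) :
    ∃ n : ℕ, addVal B b = n ∧ fracVal B E (algebraMap B E b) = n := by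
  obtain ⟨ϖ, hϖ⟩ := exists_irreducible B
  obtain ⟨n, u, rfl⟩ := eq_unit_mul_pow_irreducible hb hϖ
  refine ⟨n, addVal_def' u hϖ n, ?_⟩
  have hv := isIntVal_fracVal (B := B) (E := E)
  have h0 : algebraMap B E ϖ ≠ 0 := by simpa using hϖ.ne_zero
  rw [_root_.map_mul, _root_.map_pow, hv.map_mul (by simp) (pow_ne_zero _ h0), hv.map_pow h0,
    fracVal_unit, fracVal_irreducible hϖ]
  ring

theorem addVal_eq_iff {b : B} {n : ℕ} :
    addVal B b = n ↔ b ≠ 0 ∧ fracVal B E (algebraMap B E b) = n := by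
  constructor
  · intro h
    have hb : b ≠ 0 := by
      rintro rfl
      simp at h
    obtain ⟨m, h1, h2⟩ := addVal_eq_fracVal (E := E) hb
    rw [h1, Nat.cast_inj] at h
    exact ⟨hb, h ▸ h2⟩
  · rintro ⟨hb, h⟩
    obtain ⟨m, h1, h2⟩ := addVal_eq_fracVal (E := E) hb
    rw [h1]
    exact_mod_cast h2.symm.trans h

theorem mem_span_pow_iff {ϖ : B} (hϖ : Irreducible ϖ) {b : B} {n : ℕ} :
    b ∈ Ideal.span {ϖ ^ n} ↔
      algebraMap B E b ∈ (isIntVal_fracVal (B := B) (E := E)).fil n := by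
  have hv := isIntVal_fracVal (B := B) (E := E)
  rw [Ideal.mem_span_singleton, IsIntVal.mem_fil]
  by_cases hb : b = 0
  · simp [hb]
  obtain ⟨m, h1, h2⟩ := addVal_eq_fracVal (E := E) hb
  rw [← addVal_le_iff_dvd, hϖ.addVal_pow, h1, h2]
  simp [hb]

end FractionValuation

/-! ### Colengths of powers of the maximal ideal, and the conductor of the value semigroup -/

section Invariants

open IsDiscreteValuationRing

variable {k A B E : Type u} [Field k] [CommRing A] [CommRing B] [IsDomain B]
  [IsDiscreteValuationRing B] [Field E] [Algebra k A] [Algebra k B] [Algebra A B]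
  [IsScalarTower k A B] [Algebra B E] [IsFractionRing B E]

/-- The residue field of `B` is `k`. -/
def IsResidueField (k B : Type u) [Field k] [CommRing B] [IsLocalRing B] [Algebra k B] : Prop :=
  ∀ b : B, ∃ c : k, b - algebraMap k B c ∈ IsLocalRing.maximalIdeal B

theorem exists_sub_mem_span (hres : IsResidueField k B) {ϖ : B} (hϖ : Irreducible ϖ) (b : B) :
    ∃ c : k, ∃ b' : B, b = algebraMap k B c + ϖ * b' := by
  obtain ⟨c, hc⟩ := hres b
  rw [hϖ.maximalIdeal_eq, Ideal.mem_span_singleton] at hc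
  obtain ⟨b', hb'⟩ := hc
  exact ⟨c, b', by rw [← hb']; ring⟩

variable (E) in
include E in
theorem finrank_quotient_pow (hres : IsResidueField k B) {ϖ : B} (hϖ : Irreducible ϖ) (n : ℕ) :
    Module.Finite k (B ⧸ Ideal.span {ϖ ^ n}) ∧
      Module.finrank k (B ⧸ Ideal.span {ϖ ^ n}) = n := by
  let f : (Fin n → k) →ₗ[k] B ⧸ Ideal.span {ϖ ^ n} :=
    ((Ideal.Quotient.mkₐ k (Ideal.span {ϖ ^ n})).toLinearMap).comp
      (Fintype.linearCombination k fun i : Fin n ↦ ϖ ^ (i : ℕ))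
  have hf (c : Fin n → k) : f c = Ideal.Quotient.mk _ (∑ i, algebraMap k B (c i) * ϖ ^ (i : ℕ)) := by
    simp [f, Fintype.linearCombination_apply, Algebra.smul_def]
  have hv := isIntVal_fracVal (B := B) (E := E)
  have hϖ0 : algebraMap B E ϖ ≠ 0 := by simpa using hϖ.ne_zero
  have hval (c : k) (hc : c ≠ 0) (i : ℕ) :
      fracVal B E (algebraMap B E (algebraMap k B c * ϖ ^ i)) = i := by
    have hu : IsUnit (algebraMap k B c) := (IsUnit.mk0 c hc).map _
    rw [map_mul, map_pow, hv.map_mul (by simpa using hc) (pow_ne_zero _ hϖ0), ← hu.unit_spec,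
      fracVal_unit, hv.map_pow hϖ0, fracVal_irreducible hϖ]
    ring
  have hinj : Function.Injective f := by
    rw [injective_iff_map_eq_zero]
    intro c hc
    rw [hf, Ideal.Quotient.eq_zero_iff_mem, mem_span_pow_iff (E := E) hϖ, map_sum] at hc
    funext i
    by_contra hi
    have h1 := hv.mem_fil_of_sum_mem Finset.univ
      (fun i : Fin n ↦ algebraMap B E (algebraMap k B (c i) * ϖ ^ (i : ℕ))) ?_ hc
      (Finset.mem_univ i)
    · have h2 := h1 (by simpa [hϖ.ne_zero] using hi)
      rw [hval _ hi] at h2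
      have := i.2
      omega
    · intro i _ j _ hi hj hij
      have hi' : c i ≠ 0 := by
        intro h
        simp [h] at hi
      have hj' : c j ≠ 0 := by
        intro h
        simp [h] at hj
      rw [hval _ hi', hval _ hj'] at hij
      exact Fin.ext (by exact_mod_cast hij)
  have hsurj : Function.Surjective f := by
    intro x
    obtain ⟨b, rfl⟩ := Ideal.Quotient.mk_surjective x
    suffices H : ∀ m : ℕ, ∃ (c : ℕ → k) (b' : B),
        b = ∑ i ∈ Finset.range m, algebraMap k B (c i) * ϖ ^ i + ϖ ^ m * b' by
      obtain ⟨c, b', hb⟩ := H n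
      refine ⟨fun i ↦ c i, ?_⟩
      rw [hf, ← Finset.sum_range (fun i ↦ algebraMap k B (c i) * ϖ ^ i), Ideal.Quotient.eq,
        ← neg_mem_iff, neg_sub, Ideal.mem_span_singleton]
      exact ⟨b', by rw [hb]; ring⟩
    intro m
    induction m with
    | zero => exact ⟨0, b, by simp⟩
    | succ m ih =>
      obtain ⟨c, b', hb⟩ := ih
      obtain ⟨d, b'', rfl⟩ := exists_sub_mem_span hres hϖ b'
      refine ⟨fun i ↦ if i = m then d else c i, b'', ?_⟩
      rw [hb, Finset.sum_range_succ]
      dsimp only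
      rw [if_pos rfl]
      have : ∑ i ∈ Finset.range m, algebraMap k B (if i = m then d else c i) * ϖ ^ i =
          ∑ i ∈ Finset.range m, algebraMap k B (c i) * ϖ ^ i :=
        Finset.sum_congr rfl fun i hi ↦ by rw [if_neg (Finset.mem_range.mp hi).ne]
      rw [this]
      ring
  let e := LinearEquiv.ofBijective f ⟨hinj, hsurj⟩
  exact ⟨Module.Finite.equiv e, by rw [← e.finrank_eq]; simp⟩

/-- The conductor of the value semigroup from the conductor ideal. -/
theorem conductor_eq [Algebra A E] [IsScalarTower A B E] (hres : IsResidueField k B) {c : ℤ}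
    (hc : ∀ s, (∀ x ∈ (isIntVal_fracVal (B := B) (E := E)).fil s,
      ∃ a : A, algebraMap A E a = x) ↔ c ≤ s) :
    (valueSemigroup A B)ᶜ.Finite ∧ (conductor A B : ℤ) = c := by
  have hv := isIntVal_fracVal (B := B) (E := E)
  obtain ⟨ϖ, hϖ⟩ := exists_irreducible B
  have hϖ0 : algebraMap B E ϖ ≠ 0 := by simpa using hϖ.ne_zero
  have hvϖ := fracVal_irreducible (E := E) hϖ
  have hmem (n : ℕ) : n ∈ valueSemigroup A B ↔
      ∃ a : A, algebraMap A E a ≠ 0 ∧ fracVal B E (algebraMap A E a) = n := by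
    unfold valueSemigroup
    rw [Set.mem_ofPred_eq]
    refine exists_congr fun a ↦ ?_
    rw [addVal_eq_iff (E := E), IsScalarTower.algebraMap_apply A B E]
    simp
  have hge (n : ℕ) (hn : c ≤ n) : n ∈ valueSemigroup A B := by
    rw [hmem]
    have hval : fracVal B E (algebraMap B E ϖ ^ n) = n := by rw [hv.map_pow hϖ0, hvϖ, mul_one]
    obtain ⟨a, ha⟩ := (hc n).mpr hn (algebraMap B E ϖ ^ n) (fun _ ↦ hval.ge)
    exact ⟨a, ha ▸ pow_ne_zero n hϖ0, ha ▸ hval⟩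
  have hc0 : 0 ≤ c := by
    obtain ⟨a, ha⟩ := (hc c).mpr le_rfl (algebraMap B E ϖ ^ c)
      (fun _ ↦ by rw [hv.map_zpow hϖ0, hvϖ, mul_one])
    have h1 := algebraMap_mem_fil (E := E) (algebraMap A B a)
    rw [← IsScalarTower.algebraMap_apply, ha] at h1
    have := h1 (zpow_ne_zero _ hϖ0)
    rwa [hv.map_zpow hϖ0, hvϖ, mul_one] at this
  lift c to ℕ using hc0
  -- If some `a` in `A` had value `c - 1`, any element of value at least `c - 1` would be a constant
  -- multiple of `a` plus an element of value at least `c`, hence in `A`, against the minimality of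
  -- `c`.
  have hgap (hpos : 0 < c) : c - 1 ∉ valueSemigroup A B := by
    rw [hmem]
    rintro ⟨a, ha0, hva⟩
    have : ((c : ℕ) : ℤ) ≤ (c - 1 : ℕ) := by
      rw [← hc]
      intro x hx
      have hxa : x * (algebraMap A E a)⁻¹ ∈ hv.fil 0 := by
        intro h0
        have hx0 := left_ne_zero_of_mul h0
        rw [hv.map_mul hx0 (inv_ne_zero ha0), hv.map_inv ha0, hva]
        have := hx hx0
        omega
      obtain ⟨b, hb⟩ := mem_fil_fracVal.mp hxa
      obtain ⟨d, b', rfl⟩ := exists_sub_mem_span hres hϖ b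
      have hx' : x = algebraMap A E (algebraMap k A d * a) +
          algebraMap B E (ϖ * b') * algebraMap A E a := by
        have h1 : algebraMap A E (algebraMap k A d) = algebraMap B E (algebraMap k B d) := by
          rw [IsScalarTower.algebraMap_apply A B E, ← IsScalarTower.algebraMap_apply k A B]
        rw [map_mul, h1, ← add_mul, ← map_add, hb, inv_mul_cancel_right₀ ha0]
      obtain ⟨a', ha'⟩ := (hc c).mpr le_rfl (algebraMap B E (ϖ * b') * algebraMap A E a) (by
        have h2 : algebraMap B E (ϖ * b') ∈ hv.fil 1 := by
          have : (1 : ℤ) = 1 + 0 := rfl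
          rw [map_mul, this]
          exact hv.mul_mem_fil (fun _ ↦ hvϖ.ge) (algebraMap_mem_fil b')
        have h3 := hv.mul_mem_fil h2 (hv.mem_fil_val (algebraMap A E a))
        rw [hva] at h3
        exact hv.fil_mono (by omega) h3)
      exact ⟨algebraMap k A d * a + a', by rw [map_add, ha', ← hx']⟩
    omega
  refine ⟨(Set.finite_Iio c).subset fun n hn ↦ ?_, ?_⟩
  · by_contra h
    exact hn (hge n (by simpa using h))
  · congr 1
    unfold conductor semigroupConductor
    rcases Nat.eq_zero_or_pos c with rfl | hpos
    · have : {c | 0 < c ∧ c ∈ valueSemigroup A B ∧ c - 1 ∉ valueSemigroup A B} = ∅ :=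
        Set.eq_empty_iff_forall_notMem.mpr fun n hn ↦ hn.2.2 (hge _ (by simp))
      rw [this]
      exact csSup_empty
    · refine IsGreatest.csSup_eq ⟨⟨hpos, hge c le_rfl, hgap hpos⟩, fun n hn ↦ ?_⟩
      by_contra h
      exact hn.2.2 (hge _ (by omega))

end Invariants

/-! ### Comparing colengths in a ring and in its normalization -/

section Multiplicity

theorem finrank_quotient_ker_of_surjective {k V W : Type*} [Field k] [AddCommGroup V]
    [AddCommGroup W] [Module k V] [Module k W] (f : V →ₗ[k] W) (hf : Function.Surjective f) :
    Module.finrank k W = Module.finrank k (V ⧸ LinearMap.ker f) :=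
  (f.quotKerEquivOfSurjective hf).finrank_eq.symm

variable {k A B : Type u} [Field k] [CommRing A] [CommRing B] [Algebra k A] [Algebra k B]
  [Algebra A B] [IsScalarTower k A B]

/-- If `A ⊆ B` has finite codimension, then an element of `A` has the same colength in both. -/
theorem finrank_quotient_span_eq [IsDomain B] (hinj : Function.Injective (algebraMap A B)) {a : A}
    (ha : a ≠ 0) {x : B} (hx : ∀ b, ∃ a', algebraMap A B a' = x * b)
    [Module.Finite k (B ⧸ Ideal.span {algebraMap A B a * x})] :
    Module.finrank k (A ⧸ Ideal.span {a}) =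
      Module.finrank k (B ⧸ Ideal.span {algebraMap A B a}) := by
  have ha' : algebraMap A B a ≠ 0 := by rwa [Ne, map_eq_zero_iff _ hinj]
  let i : A →ₗ[k] B := (IsScalarTower.toAlgHom k A B).toLinearMap
  have hi (y : A) : i y = algebraMap A B y := rfl
  let m : B →ₗ[k] B := LinearMap.mulLeft k (algebraMap A B a)
  have hm (y : B) : m y = algebraMap A B a * y := rfl
  -- `W` is `aA`. The quotient `B/aA` is filtered in two ways: by `aB/aA ≅ B/A` with quotient
  -- `B/aB`, and by `A/aA` with quotient `B/A`. Comparing dimensions cancels `B/A`.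
  let W : Submodule k B := LinearMap.range (m.comp i)
  have hW (b : B) : b ∈ W ↔ ∃ y : A, algebraMap A B (a * y) = b := by
    simp [W, hi, hm]
  -- Since `x` multiplies `B` into `A`, the ideal `axB` is contained in `aA`.
  have hfin : Module.Finite k (B ⧸ W) := by
    let q : (B ⧸ (Ideal.span {algebraMap A B a * x}).restrictScalars k) →ₗ[k] B ⧸ W :=
      Submodule.factor (by
        intro b hb
        rw [Submodule.restrictScalars_mem, Ideal.mem_span_singleton] at hb
        obtain ⟨b, rfl⟩ := hb
        obtain ⟨y, hy⟩ := hx b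
        rw [hW]
        exact ⟨y, by rw [map_mul, hy]; ring⟩)
    have h0 : Module.Finite k (B ⧸ (Ideal.span {algebraMap A B a * x}).restrictScalars k) :=
      inferInstanceAs (Module.Finite k (B ⧸ Ideal.span {algebraMap A B a * x}))
    exact Module.Finite.of_surjective q (Submodule.factor_surjective _)
  let f : B →ₗ[k] B ⧸ W := W.mkQ.comp m
  let g : A →ₗ[k] B ⧸ W := W.mkQ.comp i
  have hkf : LinearMap.ker f = LinearMap.range i := by
    ext b
    simp only [f, LinearMap.mem_ker, LinearMap.comp_apply, Submodule.mkQ_apply,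
      Submodule.Quotient.mk_eq_zero, hW, LinearMap.mem_range, hi, hm]
    refine exists_congr fun y ↦ ?_
    rw [map_mul, mul_right_inj' ha']
  have hkg : LinearMap.ker g = (Ideal.span {a}).restrictScalars k := by
    ext y
    simp only [g, LinearMap.mem_ker, LinearMap.comp_apply, Submodule.mkQ_apply,
      Submodule.Quotient.mk_eq_zero, hW, hi, Submodule.restrictScalars_mem,
      Ideal.mem_span_singleton, hinj.eq_iff]
    exact exists_congr fun z ↦ eq_comm
  have e1 : Module.finrank k (LinearMap.range f) = Module.finrank k (B ⧸ LinearMap.range i) := by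
    rw [finrank_quotient_ker_of_surjective f.rangeRestrict f.surjective_rangeRestrict,
      LinearMap.ker_rangeRestrict, hkf]
  have e2 : Module.finrank k (LinearMap.range g) = Module.finrank k (A ⧸ Ideal.span {a}) := by
    rw [finrank_quotient_ker_of_surjective g.rangeRestrict g.surjective_rangeRestrict,
      LinearMap.ker_rangeRestrict, hkg]
    rfl
  have e3 : Module.finrank k ((B ⧸ W) ⧸ LinearMap.range f) =
      Module.finrank k (B ⧸ Ideal.span {algebraMap A B a}) := by
    rw [finrank_quotient_ker_of_surjective ((LinearMap.range f).mkQ.comp W.mkQ)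
      ((Submodule.mkQ_surjective _).comp (Submodule.mkQ_surjective _))]
    have : LinearMap.ker ((LinearMap.range f).mkQ.comp W.mkQ) =
        (Ideal.span {algebraMap A B a}).restrictScalars k := by
      ext b
      rw [LinearMap.mem_ker, LinearMap.comp_apply, Submodule.mkQ_apply,
        Submodule.Quotient.mk_eq_zero, Submodule.restrictScalars_mem, Ideal.mem_span_singleton,
        LinearMap.mem_range]
      constructor
      · rintro ⟨y, hy⟩
        rw [LinearMap.comp_apply, Submodule.mkQ_apply, Submodule.mkQ_apply,
          Submodule.Quotient.eq, hW, hm] at hy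
        obtain ⟨z, hz⟩ := hy
        exact ⟨y - algebraMap A B z, by rw [mul_sub, ← map_mul, hz]; ring⟩
      · rintro ⟨y, rfl⟩
        exact ⟨y, rfl⟩
    rw [this]
    rfl
  have e4 : Module.finrank k ((B ⧸ W) ⧸ LinearMap.range g) =
      Module.finrank k (B ⧸ LinearMap.range i) := by
    rw [finrank_quotient_ker_of_surjective ((LinearMap.range g).mkQ.comp W.mkQ)
      ((Submodule.mkQ_surjective _).comp (Submodule.mkQ_surjective _))]
    have : LinearMap.ker ((LinearMap.range g).mkQ.comp W.mkQ) = LinearMap.range i := by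
      ext b
      rw [LinearMap.mem_ker, LinearMap.comp_apply, Submodule.mkQ_apply,
        Submodule.Quotient.mk_eq_zero, LinearMap.mem_range, LinearMap.mem_range]
      constructor
      · rintro ⟨y, hy⟩
        rw [LinearMap.comp_apply, Submodule.mkQ_apply, Submodule.mkQ_apply,
          Submodule.Quotient.eq, hW, hi] at hy
        obtain ⟨z, hz⟩ := hy
        exact ⟨y - a * z, by rw [hi, map_sub, hz]; ring⟩
      · rintro ⟨y, rfl⟩
        exact ⟨y, rfl⟩
    rw [this]
  have h1 := Submodule.finrank_quotient_add_finrank (LinearMap.range f)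
  have h2 := Submodule.finrank_quotient_add_finrank (LinearMap.range g)
  rw [e1, e3] at h1
  rw [e2, e4] at h2
  omega

end Multiplicity

/-! ### The cokernel of `α` as relative differentials -/

section Differentials

open IsDiscreteValuationRing

variable {k A B E : Type u} [Field k] [CommRing A] [CommRing B] [Algebra k A] [Algebra k B]
  [Algebra A B] [IsScalarTower k A B]

/-- The cokernel of `α` is the module of relative differentials. -/
noncomputable def cokerAlphaEquiv : CokerAlpha k A B ≃ₗ[B] Ω[B⁄A] :=
  (Submodule.quotEquivOfEq _ _ (KaehlerDifferential.range_mapBaseChange k A B)).trans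
    ((KaehlerDifferential.map k A B B).quotKerEquivOfSurjective
      (KaehlerDifferential.map_surjective k A B))

variable [IsDomain B] [IsDiscreteValuationRing B] [Field E] [Algebra B E] [IsFractionRing B E]
  {p : ℕ} [Fact p.Prime] [CharP E p] {K : Subfield E} {t : B}

/-- The relative differentials of `B` over `A` are generated by `dt`, with annihilator exactly `(t ^
e)`. On one side `D` modulo `t ^ e` is an `A`-derivation taking `t` to `1`; on the other, `dη = 0`
is a unit multiple of `t ^ e` times `dt`. -/
theorem finrank_cokerAlpha [Algebra A E] [IsScalarTower A B E]
    (h : IsCurveVal p (fracVal B E) K (algebraMap B E t)) (ht : Irreducible t)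
    (hres : IsResidueField k B) (D : Derivation (powField E p) E E)
    (hD : D (algebraMap B E t) = 1) {e : ℕ}
    (he : ∀ a : A, D (algebraMap A E a) ∈ h.fil e)
    {η : A} (hη0 : D (algebraMap A E η) ≠ 0) (hη : fracVal B E (D (algebraMap A E η)) = e) :
    Module.Finite k (CokerAlpha k A B) ∧ Module.finrank k (CokerAlpha k A B) = e := by
  have hinj : Function.Injective (algebraMap B E) := IsFractionRing.injective B E
  choose d hd using fun b : B ↦
    mem_fil_fracVal.mp (h.derivation_mem_fil_zero D hD (algebraMap_mem_fil b))
  have hd_add (x y : B) : d (x + y) = d x + d y := hinj (by simp [hd])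
  have hd_mul (x y : B) : d (x * y) = x * d y + y * d x := hinj (by simp [hd])
  have hdt : d t = 1 := hinj (by rw [hd, hD, map_one])
  have hdA (a : A) : d (algebraMap A B a) ∈ Ideal.span {t ^ e} := by
    rw [mem_span_pow_iff (E := E) ht, hd, ← IsScalarTower.algebraMap_apply]
    exact he a
  let δ : Derivation A B (B ⧸ Ideal.span {t ^ e}) := Derivation.mk'
    { toFun := fun b ↦ Ideal.Quotient.mk _ (d b)
      map_add' := fun x y ↦ by rw [hd_add, map_add]
      map_smul' := fun a x ↦ by
        rw [RingHom.id_apply, Algebra.smul_def, hd_mul, map_add, map_mul (Ideal.Quotient.mk _) x,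
          Ideal.Quotient.eq_zero_iff_mem.mpr (hdA a), mul_zero, add_zero,
          ← Algebra.smul_def]
        rfl }
    (fun x y ↦ by
      simp only [LinearMap.coe_mk, AddHom.coe_mk, hd_mul, map_add]
      rfl)
  have hδ (b : B) : δ b = Ideal.Quotient.mk _ (d b) := rfl
  let φ : B →ₗ[B] Ω[B⁄A] := LinearMap.toSpanSingleton B _ (KaehlerDifferential.D A B t)
  have hφ (b : B) : φ b = b • KaehlerDifferential.D A B t := rfl
  -- Expand `b` in powers of `t` with `p`-th power coefficients, which have zero differential.
  have hDB (b : B) : KaehlerDifferential.D A B b = d b • KaehlerDifferential.D A B t := by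
    obtain ⟨w, hw, hsum⟩ := h.exists_coeff_t (algebraMap_mem_fil b)
    choose w' hw' using fun a ↦ mem_fil_fracVal.mp (hw a)
    have hb : b = ∑ a ∈ Finset.range p, w' a ^ p * t ^ a := hinj (by simp [hsum, hw'])
    have hcp : (p : B) = 0 := hinj (by simp)
    have hpow (x : B) : KaehlerDifferential.D A B (x ^ p) = 0 := by
      rw [Derivation.leibniz_pow, ← Nat.cast_smul_eq_nsmul B, hcp, zero_smul]
    have hdpow (x : B) : d (x ^ p) = 0 := hinj (by
      rw [hd, map_zero, map_pow]
      exact IsCurveVal.derivation_eq_zero D (pow_mem_powField p _))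
    have hdt' (a : ℕ) : d (t ^ a) = a * t ^ (a - 1) := hinj (by
      rw [hd, map_pow, D.leibniz_pow, hD]
      simp)
    have hd_sum (s : Finset ℕ) (f : ℕ → B) : d (∑ i ∈ s, f i) = ∑ i ∈ s, d (f i) :=
      hinj (by simp [hd])
    rw [hb, map_sum, hd_sum, Finset.sum_smul]
    refine Finset.sum_congr rfl fun a _ ↦ ?_
    rw [Derivation.leibniz, hpow, smul_zero, add_zero, Derivation.leibniz_pow, hd_mul, hdpow,
      mul_zero, add_zero, hdt', mul_smul, mul_smul, Nat.cast_smul_eq_nsmul]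
  have hsurj : Function.Surjective φ := by
    rw [← LinearMap.range_eq_top, eq_top_iff, ← KaehlerDifferential.span_range_derivation,
      Submodule.span_le]
    rintro _ ⟨b, rfl⟩
    exact ⟨d b, by rw [hφ, hDB b]⟩
  have hker : LinearMap.ker φ = Ideal.span {t ^ e} := by
    refine le_antisymm (fun b hb ↦ ?_) ?_
    · rw [LinearMap.mem_ker, hφ] at hb
      have h1 := congrArg δ.liftKaehlerDifferential hb
      rw [map_smul, Derivation.liftKaehlerDifferential_comp_D, hδ, hdt, map_zero] at h1
      rw [← Ideal.Quotient.eq_zero_iff_mem]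
      simpa [Algebra.smul_def] using h1
    · rw [Ideal.span_le, Set.singleton_subset_iff, SetLike.mem_coe, LinearMap.mem_ker, hφ]
      have h1 : d (algebraMap A B η) • KaehlerDifferential.D A B t = 0 := by
        rw [← hDB, Derivation.map_algebraMap]
      have hdη : algebraMap B E (d (algebraMap A B η)) = D (algebraMap A E η) := by
        rw [hd, ← IsScalarTower.algebraMap_apply]
      have hne : d (algebraMap A B η) ≠ 0 := by
        intro h0
        rw [h0, map_zero] at hdη
        exact hη0 hdη.symm
      obtain ⟨n, u, hu⟩ := eq_unit_mul_pow_irreducible hne ht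
      have hn : n = e := by
        have h2 := addVal_def _ u ht n hu
        have h3 := (addVal_eq_iff (E := E)).mpr ⟨hne, (hdη ▸ hη :
          fracVal B E (algebraMap B E (d (algebraMap A B η))) = e)⟩
        exact_mod_cast h2.symm.trans h3
      rw [hu, hn, mul_smul, ← Units.smul_def] at h1
      exact (smul_eq_zero_iff_eq u).mp h1
  let e₁ : (B ⧸ Ideal.span {t ^ e}) ≃ₗ[B] CokerAlpha k A B :=
    ((Submodule.quotEquivOfEq _ _ hker.symm).trans
      (φ.quotKerEquivOfSurjective hsurj)).trans cokerAlphaEquiv.symm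
  obtain ⟨h1, h2⟩ := finrank_quotient_pow E hres ht e
  exact ⟨Module.Finite.equiv (e₁.restrictScalars k),
    ((e₁.restrictScalars k).finrank_eq).symm.trans h2⟩

end Differentials

/-! ### Finiteness of the normalization over a perfect field -/

section FiniteNormalization

theorem finite_of_finite_comp {R S T : Type*} [CommRing R] [CommRing S] [CommRing T]
    [IsNoetherianRing R] (f : R →+* S) (g : S →+* T) (hg : Function.Injective g)
    (h : (g.comp f).Finite) : f.Finite := by
  algebraize [f, g, g.comp f]
  exact Module.Finite.of_injective (IsScalarTower.toAlgHom R S T).toLinearMap hg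

/-- The iterated Frobenius endomorphism of a polynomial ring over a perfect field is finite. -/
theorem finite_iterateFrobenius_mvPolynomial {k : Type*} [Field k] (p : ℕ) [Fact p.Prime]
    [CharP k p] [PerfectRing k p] (s n : ℕ) :
    (iterateFrobenius (MvPolynomial (Fin s) k) p n).Finite := by
  apply RingHom.IsIntegral.to_finite
  · intro x
    refine ⟨Polynomial.X ^ p ^ n - Polynomial.C x,
      Polynomial.monic_X_pow_sub_C _ (pow_ne_zero _ (Fact.out : p.Prime).ne_zero), ?_⟩
    simp [iterateFrobenius_def]
  · classical
    let := (iterateFrobenius (MvPolynomial (Fin s) k) p n).toAlgebra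
    refine ⟨⟨Finset.univ.image MvPolynomial.X, ?_⟩⟩
    rw [eq_top_iff]
    intro f _
    induction f using MvPolynomial.induction_on with
    | C c =>
      obtain ⟨d, rfl⟩ := (bijective_iterateFrobenius k p n).2 c
      have : MvPolynomial.C (iterateFrobenius k p n d) =
          algebraMap (MvPolynomial (Fin s) k) (MvPolynomial (Fin s) k) (MvPolynomial.C d) := by
        change _ = iterateFrobenius _ p n _
        simp [iterateFrobenius_def]
      rw [this]
      exact Subalgebra.algebraMap_mem _ _
    | add f g hf hg => exact add_mem (hf trivial) (hg trivial)
    | mul_X f i hf =>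
      exact mul_mem (hf trivial) (Algebra.subset_adjoin (by simp))

/-- A Noetherian normal domain with finite Frobenius endomorphisms has finite normalization in
every finite extension of its field of fractions. -/
theorem finite_integralClosure_of_finite_iterateFrobenius (P F : Type*) {E : Type*} [CommRing P]
    [IsDomain P] [IsNoetherianRing P] [IsIntegrallyClosed P] (p : ℕ) [Fact p.Prime] [CharP P p]
    [Field F] [Algebra P F] [IsFractionRing P F] [Field E] [Algebra P E] [Algebra F E]
    [IsScalarTower P F E] [FiniteDimensional F E] (hP : ∀ n, (iterateFrobenius P p n).Finite) :
    Module.Finite P (integralClosure P E) := by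
  have : CharP F p := charP_of_injective_algebraMap (IsFractionRing.injective P F) p
  have : CharP E p := charP_of_injective_algebraMap (algebraMap F E).injective p
  let S := separableClosure F E
  have : CharP S p := charP_of_injective_algebraMap (algebraMap F S).injective p
  have : ExpChar S p := .prime Fact.out
  have : IsScalarTower P S E := .of_algebraMap_eq fun _ ↦ rfl
  obtain ⟨n, hn⟩ : ∃ n, ∀ a : E, a ^ p ^ n ∈ (algebraMap S E).range :=
    (IsPurelyInseparable.hasExponent_iff' S E p).mp inferInstance
  have hfin : Module.Finite P (integralClosure P S) :=
    IsIntegralClosure.finite P F S (integralClosure P S)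
  -- Raising to the power `p ^ n` carries `E` into the separable closure `S`, over which
  -- normalization is already finite. This map is injective and semilinear over the iterated
  -- Frobenius of `P`, which is finite, so finiteness transfers.
  let ψ : integralClosure P E →+* integralClosure P S :=
    { toFun := fun x ↦ ⟨⟨(x : E) ^ p ^ n, by
          obtain ⟨y, hy⟩ := hn x
          rw [← hy]
          exact y.2⟩, by
        rw [mem_integralClosure_iff, ← isIntegral_algebraMap_iff (B := E) (algebraMap S E).injective]
        exact x.2.pow _⟩
      map_one' := by ext; simp
      map_mul' := fun x y ↦ by ext; simp [mul_pow]
      map_zero' := by ext; simp [(Fact.out : p.Prime).ne_zero]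
      map_add' := fun x y ↦ by
        ext
        simp [add_pow_char_pow] }
  have hψ (x) : ((ψ x : S) : E) = (x : E) ^ p ^ n := rfl
  have hψi : Function.Injective ψ := fun x y h ↦ by
    have h1 := congrArg (fun z : integralClosure P S ↦ ((z : S) : E)) h
    simp only [hψ] at h1
    exact Subtype.ext (iterateFrobenius_inj E p n h1)
  have hcomp : ψ.comp (algebraMap P (integralClosure P E)) =
      (algebraMap P (integralClosure P S)).comp (iterateFrobenius P p n) := by
    refine RingHom.ext fun x ↦ ?_
    apply Subtype.ext
    apply Subtype.ext
    change (algebraMap P E x) ^ p ^ n = algebraMap P E (iterateFrobenius P p n x)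
    rw [iterateFrobenius_def, map_pow]
  have h1 : (ψ.comp (algebraMap P (integralClosure P E))).Finite := by
    rw [hcomp]
    exact RingHom.Finite.comp (RingHom.finite_algebraMap.mpr hfin)
      (hP n)
  exact RingHom.finite_algebraMap.mp (finite_of_finite_comp _ ψ hψi h1)

variable {k : Type u} [Field k] {E : Type u} [Field E] [Algebra k E] [Algebra.EssFiniteType k E]

attribute [local instance] FractionRing.liftAlgebra in
/-- The normalization of a polynomial ring in a finitely generated algebraic extension of its
field of fractions is finite. -/
theorem finite_integralClosure_mvPolynomial (p : ℕ) [Fact p.Prime] [CharP k p] [PerfectRing k p]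
    {s : ℕ} [Algebra (MvPolynomial (Fin s) k) E]
    [IsScalarTower k (MvPolynomial (Fin s) k) E] [FaithfulSMul (MvPolynomial (Fin s) k) E]
    [Algebra.IsAlgebraic (MvPolynomial (Fin s) k) E] :
    Module.Finite (MvPolynomial (Fin s) k) (integralClosure (MvPolynomial (Fin s) k) E) := by
  have : IsScalarTower k (FractionRing (MvPolynomial (Fin s) k)) E :=
    IsScalarTower.of_algebraMap_eq fun x ↦ by
      rw [IsScalarTower.algebraMap_apply k (MvPolynomial (Fin s) k) E,
        IsScalarTower.algebraMap_apply k (MvPolynomial (Fin s) k)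
          (FractionRing (MvPolynomial (Fin s) k)),
        ← IsScalarTower.algebraMap_apply (MvPolynomial (Fin s) k)
          (FractionRing (MvPolynomial (Fin s) k)) E]
  have : Algebra.EssFiniteType (FractionRing (MvPolynomial (Fin s) k)) E := .of_comp k _ E
  have : Algebra.IsAlgebraic (FractionRing (MvPolynomial (Fin s) k)) E :=
    (IsFractionRing.comap_isAlgebraic_iff (A := MvPolynomial (Fin s) k)).mp inferInstance
  have : FiniteDimensional (FractionRing (MvPolynomial (Fin s) k)) E :=
    Algebra.finite_of_essFiniteType_of_isAlgebraic
  exact finite_integralClosure_of_finite_iterateFrobenius _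
    (FractionRing (MvPolynomial (Fin s) k)) p (finite_iterateFrobenius_mvPolynomial p s)

/-- The conductor of the normalization of a domain essentially of finite type over a perfect
field is nonzero. -/
theorem exists_conductor (p : ℕ) [Fact p.Prime] [CharP k p] [PerfectRing k p]
    {A : Type u} [CommRing A] [IsDomain A] [Algebra k A]
    [Algebra.EssFiniteType k A] [Algebra A E] [IsScalarTower k A E] [IsFractionRing A E] :
    ∃ g : A, g ≠ 0 ∧ ∀ x : E, IsIntegral A x →
      ∃ a : A, algebraMap A E a = algebraMap A E g * x := by
  classical
  let O := Algebra.EssFiniteType.subalgebra k A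
  let M := Algebra.EssFiniteType.submonoid k A
  -- Noether normalization of a finitely generated subalgebra `O` of which `A` is a localization.
  obtain ⟨s, φ, hφi, hφ⟩ := exists_finite_inj_algHom_of_fg k O
  let P := MvPolynomial (Fin s) k
  let : Algebra P O := φ.toRingHom.toAlgebra
  let : Algebra P E := ((algebraMap O E).comp φ.toRingHom).toAlgebra
  have : IsScalarTower P O E := .of_algebraMap_eq fun _ ↦ rfl
  have : IsScalarTower k P O := .of_algebraMap_eq fun x ↦ (φ.commutes x).symm
  have : IsScalarTower k P E := .of_algebraMap_eq fun x ↦ by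
    rw [IsScalarTower.algebraMap_apply P O E, ← IsScalarTower.algebraMap_apply k P O,
      ← IsScalarTower.algebraMap_apply k O E]
  have hM : M ≤ nonZeroDivisors O := by
    intro x hx
    rw [mem_nonZeroDivisors_iff_ne_zero]
    rintro rfl
    have : IsUnit (algebraMap O A 0) := hx
    simp at this
  have hOA (a : A) : ∃ o o' : O, o' ≠ 0 ∧ algebraMap A E a = algebraMap O E o / algebraMap O E o' := by
    obtain ⟨⟨o, m⟩, ho⟩ := IsLocalization.surj M a
    have hm : (m : O) ≠ 0 := nonZeroDivisors.ne_zero (hM m.2)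
    refine ⟨o, m, hm, ?_⟩
    rw [eq_div_iff, IsScalarTower.algebraMap_apply O A E, IsScalarTower.algebraMap_apply O A E,
      ← map_mul, ho]
    rw [IsScalarTower.algebraMap_apply O A E, Ne, map_eq_zero_iff _ (IsFractionRing.injective A E)]
    exact fun h0 ↦ hm (Subtype.ext h0)
  have : FaithfulSMul O E := by
    rw [faithfulSMul_iff_algebraMap_injective, IsScalarTower.algebraMap_eq O A E]
    exact (IsFractionRing.injective A E).comp Subtype.val_injective
  have : IsFractionRing O E := IsFractionRing.of_field O E fun z ↦ by
    obtain ⟨a, b, -, rfl⟩ := IsFractionRing.div_surjective (A := A) z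
    obtain ⟨o₁, o₂, -, h1⟩ := hOA a
    obtain ⟨o₃, o₄, -, h2⟩ := hOA b
    exact ⟨o₁ * o₄, o₂ * o₃, by rw [h1, h2, div_div_div_eq, map_mul, map_mul]⟩
  have : FaithfulSMul P E := by
    rw [faithfulSMul_iff_algebraMap_injective]
    exact (IsFractionRing.injective O E).comp hφi
  have : Module.Finite P O := hφ
  have : Algebra.IsAlgebraic P O := inferInstance
  have : Algebra.IsAlgebraic O E := IsLocalization.isAlgebraic E (nonZeroDivisors O)
  have : Algebra.IsAlgebraic P E := Algebra.IsAlgebraic.trans P O E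
  have hfin := finite_integralClosure_mvPolynomial p (k := k) (E := E) (s := s)
  obtain ⟨σ, hσ⟩ := hfin.fg_top
  -- A common denominator for module generators of the integral closure; its image in `A` is the
  -- required `g`.
  obtain ⟨b, hb⟩ := IsLocalization.exist_integer_multiples_of_finset (nonZeroDivisors O)
    (σ.image Subtype.val)
  have hC (c : E) (hc : IsIntegral P c) : ∃ o : O, algebraMap O E o = algebraMap O E b * c := by
    have hmem : (⟨c, hc⟩ : integralClosure P E) ∈ Submodule.span P (σ : Set _) := hσ ▸ trivial
    suffices H : ∀ x ∈ Submodule.span P (σ : Set (integralClosure P E)),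
        ∃ o : O, algebraMap O E o = algebraMap O E b * (x : E) from H _ hmem
    intro x hx
    induction hx using Submodule.span_induction with
    | mem x hx =>
      obtain ⟨o, ho⟩ := hb x (by simpa using hx)
      exact ⟨o, by rw [ho, Algebra.smul_def]⟩
    | zero => exact ⟨0, by simp⟩
    | add x y _ _ hx hy =>
      obtain ⟨o, ho⟩ := hx
      obtain ⟨o', ho'⟩ := hy
      exact ⟨o + o', by rw [map_add, ho, ho']; push_cast; ring⟩
    | smul c x _ hx =>
      obtain ⟨o, ho⟩ := hx
      refine ⟨algebraMap P O c * o, ?_⟩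
      rw [map_mul, ho, ← IsScalarTower.algebraMap_apply P O E]
      change _ = algebraMap O E b * (c • (x : E))
      rw [Algebra.smul_def]
      ring
  refine ⟨algebraMap O A b, ?_, fun x hx ↦ ?_⟩
  · intro h0
    have h1 := nonZeroDivisors.coe_ne_zero b
    exact h1 (Subtype.ext h0)
  · obtain ⟨m, hm⟩ := IsIntegral.exists_multiple_integral_of_isLocalization M x hx
    obtain ⟨o, ho⟩ := hC (m • x) (isIntegral_trans (R := P) (A := O) _ hm)
    obtain ⟨u, hu⟩ : IsUnit (algebraMap O A m) := m.2
    refine ⟨(u⁻¹ : Aˣ) * algebraMap O A o, ?_⟩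
    rw [map_mul, ← IsScalarTower.algebraMap_apply O A E, ho, ← IsScalarTower.algebraMap_apply O A E]
    have h1 : m • x = algebraMap A E u * x := by
      rw [Submonoid.smul_def, Algebra.smul_def, IsScalarTower.algebraMap_apply O A E, hu]
    have h2 : algebraMap A E (u⁻¹ : Aˣ) * algebraMap A E u = 1 := by
      rw [← map_mul, Units.inv_mul, map_one]
    rw [h1]
    linear_combination (algebraMap O E b * x) * h2

end FiniteNormalization

/-! ### The degree of a function field over its `p`-th powers -/

section PBasis

variable {k : Type u} [Field k] (p : ℕ) [Fact p.Prime] [CharP k p] [PerfectField k]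
  {E : Type u} [Field E] [CharP E p] [Algebra k E] [Algebra.EssFiniteType k E]

/-- A function field of one variable over a perfect field has degree at most `p` over its subfield
of `p`-th powers. -/
theorem finrank_powField_le (htr : Algebra.trdeg k E = 1) :
    Module.Finite (powField E p) E ∧ Module.finrank (powField E p) E ≤ p := by
  have hp := (Fact.out : p.Prime)
  obtain ⟨s, hs, hsep⟩ := exists_isTranscendenceBasis_and_isSeparable_of_perfectField k E
  have hcard : s.card = 1 := by
    have := hs.cardinalMk_eq_trdeg
    rw [htr] at this
    simpa using this
  obtain ⟨x, rfl⟩ := Finset.card_eq_one.mp hcard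
  -- With `x` a separating transcendental and `F = k(x)`, separability gives `F(y) = F(y ^ p)`;
  -- perfectness of `k` puts `F` inside the field generated by `x` over the `p`-th powers.
  have htop : IntermediateField.adjoin (powField E p) {x} = ⊤ := by
    rw [eq_top_iff]
    intro y _
    have hexp : ExpChar k p := .prime hp
    have hperf : PerfectRing k p := PerfectField.toPerfectRing p
    set F := IntermediateField.adjoin k (({x} : Finset E) : Set E) with hF
    have hexpF : ExpChar F p := expChar_of_injective_algebraMap (algebraMap k F).injective p
    have h1 := IntermediateField.adjoin_simple_eq_adjoin_pow_expChar_of_isSeparable' F E y p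
    have h2 : y ∈ IntermediateField.adjoin F {y ^ p} := by
      rw [← h1]
      exact IntermediateField.mem_adjoin_simple_self F y
    have hle : F.toSubfield ≤ (IntermediateField.adjoin (powField E p) {x}).toSubfield := by
      rw [hF, IntermediateField.adjoin_toSubfield, Subfield.closure_le]
      rintro z (⟨c, rfl⟩ | hz)
      · obtain ⟨d, hd⟩ := surjective_frobenius k p c
        have : algebraMap k E c ∈ powField E p :=
          (mem_powField p).mpr ⟨algebraMap k E d, by rw [← map_pow, ← hd, frobenius_def]⟩
        exact IntermediateField.algebraMap_mem _ (⟨_, this⟩ : powField E p)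
      · have hz' : z = x := by simpa using hz
        rw [hz']
        exact IntermediateField.mem_adjoin_simple_self _ x
    have h3 : y ∈ (IntermediateField.adjoin F {y ^ p}).toSubfield := h2
    rw [IntermediateField.adjoin_toSubfield] at h3
    have h4 : Subfield.closure (Set.range (algebraMap F E) ∪ {y ^ p}) ≤
        (IntermediateField.adjoin (powField E p) {x}).toSubfield := by
      rw [Subfield.closure_le]
      rintro z (⟨c, rfl⟩ | hz)
      · exact hle c.2
      · rw [Set.mem_singleton_iff.mp hz]
        exact IntermediateField.algebraMap_mem _ (⟨_, pow_mem_powField p y⟩ : powField E p)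
    exact h4 h3
  have hmonic := Polynomial.monic_X_pow_sub_C (⟨x ^ p, pow_mem_powField p x⟩ : powField E p)
    hp.ne_zero
  have hroot : Polynomial.aeval x (Polynomial.X ^ p -
      Polynomial.C (⟨x ^ p, pow_mem_powField p x⟩ : powField E p)) = 0 := by
    simp [Algebra.algebraMap_eq_smul_one, Subfield.smul_def]
  have hint : IsIntegral (powField E p) x := ⟨_, hmonic, hroot⟩
  have hfd := IntermediateField.adjoin.finiteDimensional hint
  have hfr := IntermediateField.adjoin.finrank hint
  rw [htop] at hfd hfr
  have e := (IntermediateField.topEquiv (F := powField E p) (E := E)).toLinearEquiv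
  refine ⟨Module.Finite.equiv e, ?_⟩
  rw [← e.finrank_eq, hfr]
  have := minpoly.min _ _ hmonic hroot
  exact (Polynomial.natDegree_le_natDegree this).trans (Polynomial.natDegree_X_pow_sub_C).le

end PBasis

/-! ### Purely inseparable extensions of constants, and descent to the fraction field of `R` -/

section ConstantExtension

set_option linter.unusedSectionVars false

/-- `A` is obtained from the `K`-algebra `R` by a purely inseparable extension `k` of the field of
constants: it is free over `R` with a basis that comes from a basis of `k` over `K`. -/
structure IsConstantExtension (p : ℕ) (K R k A : Type u) [CommRing K] [CommRing R] [CommRing k]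
    [CommRing A] [Algebra K R] [Algebra R A] [Algebra k A] : Prop where
  pow_mem : ∀ a : A, ∃ (n : ℕ) (r : R), algebraMap R A r = a ^ p ^ n
  exists_basis : ∃ (ι : Type u) (b : Module.Basis ι R A) (i₀ : ι), b i₀ = 1 ∧
    (∀ i, b i ∈ (algebraMap k A).range) ∧
    ∀ (c : k) (i), b.repr (algebraMap k A c) i ∈ (algebraMap K R).range

variable {p : ℕ} [Fact p.Prime] {K R k A E : Type u} [Field K] [CommRing R] [IsDomain R]
  [Field k] [CommRing A] [IsDomain A] [Algebra K R] [Algebra R A] [Algebra k A] [Field E]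
  [Algebra A E] [IsFractionRing A E] [Algebra R E] [IsScalarTower R A E]

variable (R E) in
/-- The field of fractions of `R` inside `E`. -/
noncomputable def fracSubfield [FaithfulSMul R E] : Subfield E :=
  (IsFractionRing.lift (A := R) (K := FractionRing R)
    (FaithfulSMul.algebraMap_injective R E)).fieldRange

theorem mem_fracSubfield [FaithfulSMul R E] {x : E} :
    x ∈ fracSubfield R E ↔ ∃ r s : R, s ≠ 0 ∧ x = algebraMap R E r / algebraMap R E s := by
  constructor
  · rintro ⟨y, rfl⟩
    obtain ⟨r, s, hs, rfl⟩ := IsFractionRing.div_surjective (A := R) y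
    exact ⟨r, s, nonZeroDivisors.ne_zero hs, by simp⟩
  · rintro ⟨r, s, -, rfl⟩
    exact ⟨algebraMap R _ r / algebraMap R _ s, by simp⟩

theorem algebraMap_mem_fracSubfield [FaithfulSMul R E] (r : R) :
    algebraMap R E r ∈ fracSubfield R E := mem_fracSubfield.mpr ⟨r, 1, one_ne_zero, by simp⟩

theorem mem_fracSubfield_iff_of_isIntegral [FaithfulSMul R E] [IsIntegrallyClosed R] {x : E}
    (hx : _root_.IsIntegral R x) : x ∈ fracSubfield R E ↔ ∃ r : R, algebraMap R E r = x := by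
  refine ⟨?_, fun ⟨r, hr⟩ ↦ hr ▸ algebraMap_mem_fracSubfield r⟩
  rintro ⟨y, rfl⟩
  let φ : FractionRing R →ₐ[R] E :=
    IsFractionRing.liftAlgHom (g := Algebra.ofId R E) (FaithfulSMul.algebraMap_injective R E)
  obtain ⟨r, rfl⟩ := IsIntegrallyClosed.isIntegral_iff.mp
    ((isIntegral_algHom_iff φ φ.toRingHom.injective).mp hx)
  exact ⟨r, (φ.commutes r).symm⟩

namespace IsConstantExtension

variable (h : IsConstantExtension p K R k A)
include h

theorem isIntegral : Algebra.IsIntegral R A := by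
  refine ⟨fun a ↦ ?_⟩
  obtain ⟨n, r, hr⟩ := h.pow_mem a
  exact .of_pow (pow_pos (Fact.out : p.Prime).pos n) (hr ▸ isIntegral_algebraMap)

theorem faithfulSMul : FaithfulSMul R A := by
  obtain ⟨ι, b, i₀, -⟩ := h.exists_basis
  have : Nonempty ι := ⟨i₀⟩
  have : Module.Free R A := .of_basis b
  infer_instance

theorem exists_pow_mem_pair (a b : A) : ∃ (n : ℕ) (r s : R),
    algebraMap R A r = a ^ p ^ n ∧ algebraMap R A s = b ^ p ^ n := by
  obtain ⟨n, r, hr⟩ := h.pow_mem a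
  obtain ⟨m, s, hs⟩ := h.pow_mem b
  refine ⟨n + m, r ^ p ^ m, s ^ p ^ n, ?_, ?_⟩
  · rw [map_pow, hr, ← pow_mul, pow_add]
  · rw [map_pow, hs, ← pow_mul, pow_add, mul_comm]

theorem exists_pow_eq_div (x : E) : ∃ (n : ℕ) (r s : R), algebraMap R E s ≠ 0 ∧
    x ^ p ^ n = algebraMap R E r / algebraMap R E s := by
  obtain ⟨a, b, hb, rfl⟩ := IsFractionRing.div_surjective (A := A) x
  obtain ⟨n, r, s, hr, hs⟩ := h.exists_pow_mem_pair a b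
  refine ⟨n, r, s, ?_, ?_⟩
  · rw [IsScalarTower.algebraMap_apply R A E, hs, map_pow]
    exact pow_ne_zero _ (by simpa using nonZeroDivisors.ne_zero hb)
  · rw [IsScalarTower.algebraMap_apply R A E, hr, IsScalarTower.algebraMap_apply R A E, hs,
      map_pow, map_pow, div_pow]

theorem exists_pow_mem_fracSubfield [FaithfulSMul R E] (x : E) :
    ∃ n : ℕ, x ^ p ^ n ∈ fracSubfield R E := by
  obtain ⟨n, r, s, hs, hx⟩ := h.exists_pow_eq_div x
  exact ⟨n, mem_fracSubfield.mpr ⟨r, s, fun h0 ↦ hs (by simp [h0]), hx⟩⟩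

/-- Each nonzero element of `A` divides one of its `p ^ n`-th powers coming from `R`, so inverting
the nonzero elements of `R` inverts all of them. -/
theorem isLocalization : IsLocalization (Algebra.algebraMapSubmonoid A (nonZeroDivisors R)) E := by
  have := h.faithfulSMul
  have hp := (Fact.out : p.Prime)
  have hle : Algebra.algebraMapSubmonoid A (nonZeroDivisors R) ≤ nonZeroDivisors A :=
    map_le_nonZeroDivisors_of_injective _ (FaithfulSMul.algebraMap_injective R A) le_rfl
  refine (IsLocalization.iff_of_le_of_exists_dvd _ (nonZeroDivisors A) hle fun b hb ↦ ?_).mpr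
    inferInstance
  obtain ⟨n, r, hr⟩ := h.pow_mem b
  refine ⟨_, ⟨r, ?_, rfl⟩, ?_⟩
  · rw [SetLike.mem_coe, mem_nonZeroDivisors_iff_ne_zero]
    rintro rfl
    rw [map_zero] at hr
    exact pow_ne_zero _ (nonZeroDivisors.ne_zero hb) hr.symm
  · rw [hr]
    exact dvd_pow_self b (pow_ne_zero _ hp.ne_zero)

-- The basis of `A` over `R` localizes to one of `E` over the fraction field of `R`, with the same
-- coordinates on constants.
attribute [local instance] FractionRing.liftAlgebra in
theorem descends [FaithfulSMul R E] [Algebra K k] [Algebra K A] [IsScalarTower K k A]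
    [IsScalarTower K R A] [Algebra k E] [IsScalarTower k A E] :
    Descends (algebraMap k E).fieldRange (fracSubfield R E) := by
  obtain ⟨ι, b, i₀, hi₀, hk, hrepr⟩ := h.exists_basis
  have := h.isLocalization (E := E)
  let bE := b.localizationLocalization (FractionRing R) (nonZeroDivisors R) E
  let e : FractionRing R ≃+* fracSubfield R E := RingEquiv.ofBijective
    (IsFractionRing.lift (A := R) (K := FractionRing R)
      (FaithfulSMul.algebraMap_injective R E)).rangeRestrictField
    ⟨RingHom.injective _, fun ⟨_, y, hy⟩ ↦ ⟨y, Subtype.ext hy⟩⟩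
  have he (x) : (e x : E) = algebraMap (FractionRing R) E x := rfl
  let bL := bE.mapCoeffs e fun c x ↦ by
    rw [Subfield.smul_def, he, smul_eq_mul, Algebra.smul_def]
  refine ⟨ι, bL, i₀, ?_, fun i ↦ ?_, ?_⟩
  · simp [bL, bE, hi₀]
  · obtain ⟨c, hc⟩ := hk i
    refine ⟨c, ?_⟩
    rw [Module.Basis.mapCoeffs_apply, Module.Basis.localizationLocalization_apply, ← hc,
      ← IsScalarTower.algebraMap_apply]
  · rintro _ ⟨c, rfl⟩ i
    have h1 : bL.repr (algebraMap k E c) i = e (bE.repr (algebraMap k E c) i) := by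
      simp [bL, Module.Basis.mapCoeffs]
    obtain ⟨c', hc'⟩ := hrepr c i
    rw [h1, he, IsScalarTower.algebraMap_apply k A E,
      Module.Basis.localizationLocalization_repr_algebraMap, ← hc',
      ← IsScalarTower.algebraMap_apply R (FractionRing R) E, IsScalarTower.algebraMap_apply R A E,
      ← IsScalarTower.algebraMap_apply K R A, IsScalarTower.algebraMap_apply K k A,
      ← IsScalarTower.algebraMap_apply k A E]
    exact ⟨_, rfl⟩

/-- The span of the valuation ring of the field of fractions of `R` is `A`. -/
theorem mem_valSpan_iff [FaithfulSMul R E] [Algebra k E] [IsScalarTower k A E] {v : E → ℤ}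
    (hv : IsIntVal v)
    (hR : ∀ x ∈ fracSubfield R E, x ∈ hv.fil 0 ↔ ∃ r : R, algebraMap R E r = x) {x : E} :
    x ∈ valSpan hv (algebraMap k E).fieldRange (fracSubfield R E) ↔
      ∃ a : A, algebraMap A E a = x := by
  constructor
  · intro hx
    induction hx using Submodule.span_induction with
    | mem x hx =>
      obtain ⟨r, rfl⟩ := (hR x hx.1).mp hx.2
      exact ⟨algebraMap R A r, (IsScalarTower.algebraMap_apply R A E r).symm⟩
    | zero => exact ⟨0, map_zero _⟩
    | add x y _ _ hx hy =>
      obtain ⟨a, rfl⟩ := hx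
      obtain ⟨b, rfl⟩ := hy
      exact ⟨a + b, map_add _ _ _⟩
    | smul c x _ hx =>
      obtain ⟨a, rfl⟩ := hx
      obtain ⟨_, c, rfl⟩ := c
      refine ⟨algebraMap k A c * a, ?_⟩
      rw [map_mul, ← IsScalarTower.algebraMap_apply]
      rfl
  · rintro ⟨a, rfl⟩
    obtain ⟨ι, b, i₀, -, hk, -⟩ := h.exists_basis
    rw [← b.linearCombination_repr a, Finsupp.linearCombination_apply, Finsupp.sum, map_sum]
    refine Submodule.sum_mem _ fun i _ ↦ ?_
    obtain ⟨c, hc⟩ := hk i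
    have hr := algebraMap_mem_fracSubfield (E := E) (b.repr a i)
    have := Submodule.smul_mem (valSpan hv (algebraMap k E).fieldRange (fracSubfield R E))
      ⟨algebraMap k E c, c, rfl⟩ (Submodule.subset_span ⟨hr, (hR _ hr).mpr ⟨_, rfl⟩⟩)
    convert this using 1
    rw [Algebra.smul_def, map_mul, ← hc, ← IsScalarTower.algebraMap_apply,
      ← IsScalarTower.algebraMap_apply, Subfield.smul_def, smul_eq_mul, mul_comm]

end IsConstantExtension

end ConstantExtension

/-! ### The normalization is a discrete valuation ring with residue field `k` -/

section Normalization

set_option linter.unusedSectionVars false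

variable {p : ℕ} [Fact p.Prime] {K R k A B E : Type u} [Field K] [CommRing R] [IsDomain R]
  [IsDiscreteValuationRing R] [Field k] [CommRing A] [IsDomain A] [Algebra K R] [Algebra R A]
  [Algebra k A] [Field E] [Algebra A E] [IsFractionRing A E] [Algebra R E] [IsScalarTower R A E]
  [FaithfulSMul R E]
  [CommRing B] [IsDomain B] [Algebra A B] [Algebra B E] [IsScalarTower A B E]
  [IsIntegralClosure B A E]

namespace IsConstantExtension

variable (h : IsConstantExtension p K R k A)
include h

/-- The normalization meets the fraction field of `R` in `R` alone, because it is integral over `R`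
and `R` is integrally closed. -/
theorem exists_algebraMap_eq_iff {x : E} (hx : x ∈ fracSubfield R E) :
    (∃ b : B, algebraMap B E b = x) ↔ ∃ r : R, algebraMap R E r = x := by
  have := h.isIntegral
  constructor
  · rintro ⟨b, rfl⟩
    have h1 : _root_.IsIntegral A (algebraMap B E b) := IsIntegralClosure.isIntegral_iff.mpr ⟨b, rfl⟩
    exact (mem_fracSubfield_iff_of_isIntegral (isIntegral_trans (R := R) _ h1)).mp hx
  · rintro ⟨r, rfl⟩
    exact ⟨algebraMap A B (algebraMap R A r), by
      rw [← IsScalarTower.algebraMap_apply A B E, ← IsScalarTower.algebraMap_apply R A E]⟩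

/-- A `p ^ n`-th power of `x` is a fraction of elements of `R`; divisibility is total in `R`, so
that power of `x` or of `x⁻¹` lies in `R`, making `x` or `x⁻¹` integral. -/
theorem valuationRing [IsFractionRing B E] : ValuationRing B := by
  rw [ValuationRing.iff_isInteger_or_isInteger B E]
  intro x
  obtain ⟨n, r, s, hs, hx⟩ := h.exists_pow_eq_div x
  have hpos : 0 < p ^ n := pow_pos (Fact.out : p.Prime).pos n
  have key (y : E) (r s : R) (hs : algebraMap R E s ≠ 0)
      (hy : y ^ p ^ n = algebraMap R E r / algebraMap R E s) (hd : s ∣ r) :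
      IsLocalization.IsInteger B y := by
    obtain ⟨u, rfl⟩ := hd
    rw [map_mul, mul_div_cancel_left₀ _ hs, IsScalarTower.algebraMap_apply R A E] at hy
    exact IsIntegralClosure.isIntegral_iff.mp (IsIntegral.of_pow hpos (hy ▸ isIntegral_algebraMap))
  rcases ValuationRing.dvd_total r s with hd | hd
  · by_cases hr : algebraMap R E r = 0
    · left
      rw [hr, zero_div] at hx
      rw [eq_zero_of_pow_eq_zero hx]
      exact IsLocalization.isInteger_zero
    · exact .inr (key x⁻¹ s r hr (by rw [inv_pow, hx, inv_div]) hd)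
  · exact .inl (key x r s hs hx hd)

variable (E) in
include E in
theorem not_isUnit {r : R} (hr : ¬IsUnit r) : ¬IsUnit (algebraMap A B (algebraMap R A r)) := by
  rintro ⟨u, hu⟩
  have hinv : algebraMap B E (u⁻¹ : Bˣ) = (algebraMap R E r)⁻¹ := by
    apply eq_inv_of_mul_eq_one_left
    rw [IsScalarTower.algebraMap_apply R A E,
      IsScalarTower.algebraMap_apply A B E, ← hu, ← map_mul, Units.inv_mul, map_one]
  obtain ⟨s, hs⟩ := (h.exists_algebraMap_eq_iff (B := B)
    (inv_mem (algebraMap_mem_fracSubfield r))).mp ⟨_, hinv⟩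
  refine hr (IsUnit.of_mul_eq_one s (FaithfulSMul.algebraMap_injective R E ?_))
  rw [map_mul, hs, map_one, mul_inv_cancel₀]
  intro h0
  rw [h0, inv_zero] at hinv
  exact (u⁻¹).isUnit.map (algebraMap B E) |>.ne_zero hinv

/-- Multiplication by `g` embeds `B` into the Noetherian ring `A` as an `A`-module, so the valuation
ring `B` is Noetherian. -/
theorem isDiscreteValuationRing [IsFractionRing B E] [IsNoetherianRing A] {g : A} (hg0 : g ≠ 0)
    (hg : ∀ b : B, ∃ a : A, algebraMap A B a = algebraMap A B g * b) :
    IsDiscreteValuationRing B := by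
  have hval := h.valuationRing (B := B) (E := E)
  have hinj : Function.Injective (algebraMap A B) := by
    have := IsFractionRing.injective A E
    rw [IsScalarTower.algebraMap_eq A B E] at this
    exact .of_comp this
  have hnoeth : IsNoetherianRing B := by
    let m : B →ₗ[A] B := LinearMap.mulLeft A (algebraMap A B g)
    have hm : ∀ b, m b ∈ LinearMap.range (Algebra.linearMap A B) := fun b ↦ hg b
    have hmi : Function.Injective (m.codRestrict _ hm) := by
      intro x y hxy
      exact mul_left_cancel₀ ((map_ne_zero_iff _ hinj).mpr hg0) (congrArg Subtype.val hxy)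
    have : IsNoetherian A B := isNoetherian_of_injective _ hmi
    exact isNoetherian_of_tower A this
  have hnf : ¬IsField B := by
    obtain ⟨ϖ, hϖ⟩ := IsDiscreteValuationRing.exists_irreducible R
    intro hB
    let := hB.toField
    refine h.not_isUnit E (B := B) hϖ.not_isUnit (isUnit_iff_ne_zero.mpr ?_)
    have := h.faithfulSMul
    exact (map_ne_zero_iff _ hinj).mpr ((map_ne_zero_iff _
      (FaithfulSMul.algebraMap_injective R A)).mpr hϖ.ne_zero)
  exact ((IsDiscreteValuationRing.TFAE B hnf).out 0 1).mpr hval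

-- Some `b ^ p ^ n` lies in `R`, and a monic polynomial over `K` sends it into the maximal ideal.
-- That polynomial splits over `k`, so some factor `b ^ p ^ n - d ^ p ^ n = (b - d) ^ p ^ n` lies in
-- the maximal ideal of `B`.
variable (E) in
include E in
theorem isResidueField [Algebra K k] [Algebra K A] [IsScalarTower K k A]
    [IsScalarTower K R A] [Algebra k B] [IsScalarTower k A B] [IsAlgClosed k]
    [CharP k p] [IsLocalRing B] [Module.Finite K (IsLocalRing.ResidueField R)] : IsResidueField k B := by
  intro b
  have : CharP B p := charP_of_injective_algebraMap (algebraMap k B).injective p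
  have hBi : Function.Injective (algebraMap B E) := IsIntegralClosure.algebraMap_injective B A E
  obtain ⟨n, hn⟩ := h.exists_pow_mem_fracSubfield (algebraMap B E b)
  have hpos : 0 < p ^ n := pow_pos (Fact.out : p.Prime).pos n
  obtain ⟨r, hr⟩ := (h.exists_algebraMap_eq_iff (B := B) hn).mp ⟨b ^ p ^ n, map_pow _ _ _⟩
  have hrb : algebraMap A B (algebraMap R A r) = b ^ p ^ n := by
    apply hBi
    rw [← IsScalarTower.algebraMap_apply A B E, ← IsScalarTower.algebraMap_apply R A E, hr, map_pow]
  obtain ⟨f, hf, hfr⟩ := Algebra.IsIntegral.isIntegral (R := K) (IsLocalRing.residue R r)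
  have hfr' : Polynomial.aeval r f ∈ IsLocalRing.maximalIdeal R := by
    rw [← IsLocalRing.residue_eq_zero_iff, ← hfr]
    change _ = Polynomial.aeval (IsLocalRing.residue R r) f
    rw [← IsLocalRing.ResidueField.algebraMap_eq, Polynomial.aeval_algebraMap_apply]
  have hfm : algebraMap A B (algebraMap R A (Polynomial.aeval r f)) ∈
      IsLocalRing.maximalIdeal B := h.not_isUnit E hfr'
  have hfk : algebraMap A B (algebraMap R A (Polynomial.aeval r f)) =
      Polynomial.aeval (b ^ p ^ n) (f.map (algebraMap K k)) := by
    rw [← Polynomial.aeval_algebraMap_apply, ← Polynomial.aeval_map_algebraMap k,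
      ← Polynomial.aeval_algebraMap_apply, hrb]
  have hsplit := IsAlgClosed.splits (f.map (algebraMap K k))
  rw [hfk, hsplit.eq_prod_roots_of_monic (hf.map _), map_multiset_prod, Multiset.map_map,
    (IsLocalRing.maximalIdeal.isMaximal B).isPrime.multiset_prod_mem_iff_exists_mem] at hfm
  obtain ⟨y, hy, hym⟩ := hfm
  obtain ⟨c, -, rfl⟩ := Multiset.mem_map.mp hy
  obtain ⟨d, rfl⟩ := IsAlgClosed.exists_pow_nat_eq c hpos
  refine ⟨d, (IsLocalRing.maximalIdeal.isMaximal B).isPrime.mem_of_pow_mem (p ^ n) ?_⟩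
  rw [sub_pow_char_pow, ← map_pow]
  simpa using hym

end IsConstantExtension

end Normalization

/-! ### The divisibility for a constant extension -/

section Divisibility

set_option linter.unusedSectionVars false

variable {p : ℕ} [Fact p.Prime] {K R k A B E : Type u} [Field K] [CommRing R] [IsDomain R]
  [IsDiscreteValuationRing R] [Field k] [CommRing A] [IsDomain A] [Algebra K R] [Algebra R A]
  [Algebra k A] [Algebra K k] [Algebra K A] [IsScalarTower K k A] [IsScalarTower K R A]
  [Field E] [Algebra A E] [IsFractionRing A E] [Algebra R E] [IsScalarTower R A E]
  [FaithfulSMul R E] [Algebra k E] [IsScalarTower k A E]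
  [CommRing B] [IsDomain B] [Algebra A B] [Algebra B E] [IsScalarTower A B E]
  [IsIntegralClosure B A E] [IsFractionRing B E] [Algebra k B] [IsScalarTower k A B]
  [IsAlgClosed k] [CharP k p] [Algebra.EssFiniteType k A]

theorem trdeg_eq_of_isAlgebraic (K R k E : Type u) [Field K] [CommRing R] [IsDomain R] [Field k]
    [Field E] [Algebra K R] [Algebra K k] [Algebra K E] [Algebra R E] [Algebra k E]
    [IsScalarTower K R E] [IsScalarTower K k E] [FaithfulSMul R E] [Algebra.IsAlgebraic R E]
    [Algebra.IsAlgebraic K k] : Algebra.trdeg k E = Algebra.trdeg K R := by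
  have h1 := trdeg_add_eq K R (A := E)
  have h2 := trdeg_add_eq K k (A := E)
  rw [trdeg_eq_zero (R := R), add_zero] at h1
  rw [trdeg_eq_zero (R := K), zero_add] at h2
  rw [h1, h2]

namespace IsConstantExtension

variable (h : IsConstantExtension p K R k A)
include h

theorem isAlgebraic : Algebra.IsAlgebraic R E := by
  have := h.isIntegral
  have := h.faithfulSMul
  have : Algebra.IsAlgebraic A E := IsLocalization.isAlgebraic E (nonZeroDivisors A)
  exact Algebra.IsAlgebraic.trans R A E

variable (E B) in
include E in
theorem exists_conductor_mul :
    ∃ g : A, g ≠ 0 ∧ ∀ b : B, ∃ a : A, algebraMap A B a = algebraMap A B g * b := by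
  have : Algebra.EssFiniteType A E := .of_isLocalization E (nonZeroDivisors A)
  have : Algebra.EssFiniteType k E := .comp k A E
  have : PerfectRing k p := inferInstance
  obtain ⟨g, hg0, hg⟩ := exists_conductor (k := k) (A := A) (E := E) p
  refine ⟨g, hg0, fun b ↦ ?_⟩
  obtain ⟨a, ha⟩ := hg (algebraMap B E b) (IsIntegralClosure.isIntegral_iff.mpr ⟨b, rfl⟩)
  refine ⟨a, IsIntegralClosure.algebraMap_injective B A E ?_⟩
  rw [map_mul, ← IsScalarTower.algebraMap_apply, ← IsScalarTower.algebraMap_apply, ha]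

variable (E B) in
include E in
theorem isDiscreteValuationRing_of_essFiniteType : IsDiscreteValuationRing B := by
  have : IsNoetherianRing A := Algebra.EssFiniteType.isNoetherianRing k A
  obtain ⟨g, hg0, hg⟩ := h.exists_conductor_mul B E
  exact h.isDiscreteValuationRing (E := E) hg0 hg

variable [IsDiscreteValuationRing B] [Module.Finite K (IsLocalRing.ResidueField R)]

theorem isCurveVal [CharP E p] [Algebra K E] [IsScalarTower K R E] [IsScalarTower K k E]
    [Algebra.IsAlgebraic K k] (htr : Algebra.trdeg K R = 1) {t : B} (ht : Irreducible t) :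
    IsCurveVal p (fracVal B E) (algebraMap k E).fieldRange (algebraMap B E t) := by
  have hv := isIntVal_fracVal (B := B) (E := E)
  have hkB : ∀ c : k, algebraMap k E c = algebraMap B E (algebraMap k B c) := fun c ↦ by
    rw [IsScalarTower.algebraMap_apply k A B, IsScalarTower.algebraMap_apply k A E,
      ← IsScalarTower.algebraMap_apply A B E]
  have hfr : Module.Finite (powField E p) E ∧ Module.finrank (powField E p) E ≤ p := by
    have : Algebra.EssFiniteType A E := .of_isLocalization E (nonZeroDivisors A)
    have : Algebra.EssFiniteType k E := .comp k A E
    have := h.isAlgebraic (E := E)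
    exact finrank_powField_le (k := k) p (by rw [trdeg_eq_of_isAlgebraic K R k E, htr])
  exact
    { hv with
      val_t := fracVal_irreducible ht
      t_ne := (map_ne_zero_iff _ (IsFractionRing.injective B E)).mpr ht.ne_zero
      val_k := by
        rintro _ ⟨c, rfl⟩ hc
        have hc0 : c ≠ 0 := fun h0 ↦ hc (by simp [h0])
        obtain ⟨u, hu⟩ := (isUnit_iff_ne_zero.mpr hc0).map (algebraMap k B)
        rw [hkB, ← hu, fracVal_unit]
      root := by
        rintro _ ⟨c, rfl⟩
        obtain ⟨d, rfl⟩ := IsAlgClosed.exists_pow_nat_eq c (Fact.out : p.Prime).pos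
        exact ⟨_, ⟨d, rfl⟩, (map_pow _ _ _).symm⟩
      residue := by
        intro x hx
        obtain ⟨b, rfl⟩ := mem_fil_fracVal.mp hx
        obtain ⟨c, b', rfl⟩ := exists_sub_mem_span (h.isResidueField E (B := B)) ht b
        refine ⟨_, ⟨c, rfl⟩, ?_⟩
        rw [hkB, map_add, add_sub_cancel_left, map_mul]
        have := hv.mul_mem_fil (hv.mem_fil_val (algebraMap B E t)) (algebraMap_mem_fil b')
        rwa [fracVal_irreducible ht, add_zero] at this
      finite := hfr.1
      finrank_le := hfr.2 }

/-- The value of a uniformizer of `R` is the colength of the ideal that it generates in `A`. -/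
theorem fracVal_uniformizer {ϖ : R} (hϖ : ϖ ≠ 0) : fracVal B E (algebraMap R E ϖ) =
    Module.finrank k (A ⧸ Ideal.span {algebraMap R A ϖ}) := by
  have hv := isIntVal_fracVal (B := B) (E := E)
  have := h.faithfulSMul
  have hres := h.isResidueField E (B := B)
  have hinj : Function.Injective (algebraMap A B) := by
    have := IsFractionRing.injective A E
    rw [IsScalarTower.algebraMap_eq A B E] at this
    exact .of_comp this
  obtain ⟨t, ht⟩ := IsDiscreteValuationRing.exists_irreducible B
  obtain ⟨g, hg0, hg⟩ := h.exists_conductor_mul B E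
  have hϖA : algebraMap R A ϖ ≠ 0 :=
    (map_ne_zero_iff _ (FaithfulSMul.algebraMap_injective R A)).mpr hϖ
  have hϖB : algebraMap A B (algebraMap R A ϖ) ≠ 0 := (map_ne_zero_iff _ hinj).mpr hϖA
  have hgB : algebraMap A B g ≠ 0 := (map_ne_zero_iff _ hinj).mpr hg0
  obtain ⟨n, hn⟩ := IsDiscreteValuationRing.associated_pow_irreducible (mul_ne_zero hϖB hgB) ht
  obtain ⟨m, hm⟩ := IsDiscreteValuationRing.associated_pow_irreducible hϖB ht
  have : Module.Finite k (B ⧸ Ideal.span {algebraMap A B (algebraMap R A ϖ) * algebraMap A B g}) := by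
    rw [Ideal.span_singleton_eq_span_singleton.mpr hn]
    exact (finrank_quotient_pow E hres ht n).1
  rw [finrank_quotient_span_eq hinj hϖA hg, Ideal.span_singleton_eq_span_singleton.mpr hm,
    (finrank_quotient_pow E hres ht m).2]
  obtain ⟨u, hu⟩ := hm.symm
  have ht0 : algebraMap B E t ≠ 0 := (map_ne_zero_iff _ (IsFractionRing.injective B E)).mpr ht.ne_zero
  rw [IsScalarTower.algebraMap_apply R A E, IsScalarTower.algebraMap_apply A B E, ← hu, map_mul,
    hv.map_mul (by simpa using fun h0 ↦ absurd h0 ht.ne_zero)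
      (u.isUnit.map (algebraMap B E)).ne_zero, fracVal_unit, add_zero, map_pow, hv.map_pow ht0,
    fracVal_irreducible ht, mul_one]

theorem finrank_dvd_fracVal (hdeg : ∀ ϖ : R, Irreducible ϖ →
      Module.finrank k (A ⧸ Ideal.span {algebraMap R A ϖ}) =
        Module.finrank K (IsLocalRing.ResidueField R)) {r : R} (hr : r ≠ 0) :
    (Module.finrank K (IsLocalRing.ResidueField R) : ℤ) ∣ fracVal B E (algebraMap R E r) := by
  have hv := isIntVal_fracVal (B := B) (E := E)
  obtain ⟨ϖ, hϖ⟩ := IsDiscreteValuationRing.exists_irreducible R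
  obtain ⟨n, u, rfl⟩ := IsDiscreteValuationRing.eq_unit_mul_pow_irreducible hr hϖ
  have hϖ0 : algebraMap R E ϖ ≠ 0 :=
    (map_ne_zero_iff _ (FaithfulSMul.algebraMap_injective R E)).mpr hϖ.ne_zero
  obtain ⟨u', hu'⟩ := (u.isUnit.map (algebraMap R A)).map (algebraMap A B)
  rw [map_mul, map_pow, hv.map_mul (u.isUnit.map (algebraMap R E)).ne_zero (pow_ne_zero _ hϖ0),
    hv.map_pow hϖ0, h.fracVal_uniformizer hϖ.ne_zero, hdeg ϖ hϖ, IsScalarTower.algebraMap_apply R A E,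
    IsScalarTower.algebraMap_apply A B E, ← hu', fracVal_unit, zero_add]
  exact dvd_mul_left _ _

-- The element `r` whose value is the sum of the two exponents is integral in the fraction field of
-- `R`, hence lies in `R`, where all values are multiples of the residue degree.
variable (E B) in
include E in
theorem finrank_dvd [Algebra K E] [IsScalarTower K R E] [IsScalarTower K k E]
    [Algebra.IsAlgebraic K k] (htr : Algebra.trdeg K R = 1)
    (hdeg : ∀ ϖ : R, Irreducible ϖ →
      Module.finrank k (A ⧸ Ideal.span {algebraMap R A ϖ}) =
        Module.finrank K (IsLocalRing.ResidueField R)) :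
    (valueSemigroup A B)ᶜ.Finite ∧ Module.Finite k (CokerAlpha k A B) ∧
      (Module.finrank K (IsLocalRing.ResidueField R) : ℤ) ∣
        (conductor A B : ℤ) + (diffDegree k A B : ℤ) - 1 := by
  have hv := isIntVal_fracVal (B := B) (E := E)
  have : CharP E p := charP_of_injective_algebraMap (algebraMap k E).injective p
  have hres := h.isResidueField E (B := B)
  obtain ⟨t, ht⟩ := IsDiscreteValuationRing.exists_irreducible B
  have hval := h.isCurveVal (E := E) htr ht
  obtain ⟨D, hD⟩ := exists_derivation hval.finrank hval.t_notMem
  obtain ⟨n, hn⟩ := h.exists_pow_mem_fracSubfield (algebraMap B E t)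
  have hR (x : E) (hx : x ∈ fracSubfield R E) :
      x ∈ hv.fil 0 ↔ ∃ r : R, algebraMap R E r = x :=
    mem_fil_fracVal.trans (h.exists_algebraMap_eq_iff hx)
  have hA (x : E) : x ∈ valSpan hv (algebraMap k E).fieldRange (fracSubfield R E) ↔
      ∃ a : A, algebraMap A E a = x := h.mem_valSpan_iff hv hR
  obtain ⟨g, hg0, hg⟩ := h.exists_conductor_mul B E
  have hgE : algebraMap A E g ≠ 0 := (map_ne_zero_iff _ (IsFractionRing.injective A E)).mpr hg0
  -- Elements of value at least that of `g` lie in `gB`, which is contained in `A`; this supplies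
  -- the starting bound on the conductor.
  have hN : ∀ x ∈ hv.fil ((fracVal B E (algebraMap A E g)).toNat : ℤ),
      x ∈ valSpan hv (algebraMap k E).fieldRange (fracSubfield R E) := by
    intro x hx
    have hx' : x / algebraMap A E g ∈ hv.fil 0 := by
      have h1 := hv.mul_mem_fil hx (hv.mem_fil_val (algebraMap A E g)⁻¹)
      rw [hv.map_inv hgE, ← div_eq_mul_inv] at h1
      refine hv.fil_mono ?_ h1
      have := Int.self_le_toNat (fracVal B E (algebraMap A E g))
      omega
    obtain ⟨b, hb⟩ := mem_fil_fracVal.mp hx'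
    obtain ⟨a, ha⟩ := hg b
    refine (hA x).mpr ⟨a, ?_⟩
    rw [IsScalarTower.algebraMap_apply A B E, ha, map_mul, hb, ← IsScalarTower.algebraMap_apply,
      mul_div_cancel₀ _ hgE]
  obtain ⟨c, η, r, hc, hη, hrL, hr0, hrne, hr⟩ :=
    hval.exists_val_eq_conductor_add D hD n _ h.descends hn hN
  have hcond := conductor_eq (k := k) (A := A) (B := B) (E := E) hres (c := c) fun s ↦ by
    rw [← hc s]
    exact forall₂_congr fun x _ ↦ (hA x).symm
  obtain ⟨η₀, hη₀⟩ := (hR η hη.mem).mp hη.mem_fil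
  have hDη := hval.derivation_ne_zero D hD hη.notMem
  have hDη0 : 0 ≤ fracVal B E (D η) := hval.derivation_mem_fil_zero D hD hη.mem_fil hDη
  obtain ⟨e, he⟩ := Int.eq_ofNat_of_zero_le hDη0
  have hηA : algebraMap A E (algebraMap R A η₀) = η := by
    rw [← IsScalarTower.algebraMap_apply R A E, hη₀]
  have hDA (a : A) : D (algebraMap A E a) ∈ hval.fil e := by
    have hx := (hA _).mpr ⟨a, rfl⟩
    generalize algebraMap A E a = x at hx
    induction hx using Submodule.span_induction with
    | mem x hx =>
      obtain ⟨y, -, hy, hxy⟩ := hη.exists_derivation_eq D hx.1 hx.2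
      rw [hxy, ← he]
      exact hv.mul_mem_fil_of_mem_zero hy (hv.mem_fil_val _)
    | zero => simp
    | add x y _ _ hx hy =>
      rw [map_add]
      exact add_mem hx hy
    | smul c x _ hx =>
      rw [Subfield.smul_def, smul_eq_mul, IsCurveVal.derivation_mul D (hval.mem_powField_of_mem c.2)]
      exact hv.mul_mem_fil_of_mem_zero (hval.mem_fil_of_mem c.2) hx
  have hcok := finrank_cokerAlpha (k := k) (A := A) hval ht hres D hD hDA
    (η := algebraMap R A η₀) (by rwa [hηA]) (by rw [hηA, he])
  refine ⟨hcond.1, hcok.1, ?_⟩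
  obtain ⟨r₀, rfl⟩ := (hR r hrL).mp hr0
  have hdvd := h.finrank_dvd_fracVal (B := B) (E := E) hdeg (r := r₀) (by rintro rfl; simp at hrne)
  rw [hr, he, ← hcond.2] at hdvd
  rw [diffDegree, hcok.2]
  convert hdvd using 1
  push_cast
  ring

end IsConstantExtension

end Divisibility

/-! ### The tensor product with the algebraic closure -/

section Geometric

variable (p : ℕ) [Fact p.Prime] (K R k : Type u) [Field K] [CharP K p] [CommRing R] [IsDomain R]
  [Algebra K R] [Field k] [Algebra K k]

attribute [local instance] Algebra.TensorProduct.rightAlgebra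

/-- A `K`-basis of `k` containing `1` gives the basis over `R`. On pure tensors the power condition
is pure inseparability; sums follow by Frobenius additivity after equalizing exponents. -/
theorem isConstantExtension_tensorProduct [IsPurelyInseparable K k] :
    IsConstantExtension p K R k (k ⊗[K] R) where
  pow_mem a := by
    have : CharP k p := charP_of_injective_algebraMap (algebraMap K k).injective p
    have : CharP R p := charP_of_injective_algebraMap (algebraMap K R).injective p
    have : ExpChar K p := .prime Fact.out
    induction a using TensorProduct.induction_on with
    | zero => exact ⟨0, 0, by simp⟩
    | tmul c r =>
      obtain ⟨n, d, hd⟩ := IsPurelyInseparable.pow_mem K p c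
      refine ⟨n, d • r ^ p ^ n, ?_⟩
      rw [Algebra.TensorProduct.tmul_pow, ← hd, Algebra.algebraMap_eq_smul_one d,
        TensorProduct.smul_tmul]
      rfl
    | add a b ha hb =>
      have : CharP (k ⊗[K] R) p := charP_of_injective_algebraMap
        (FaithfulSMul.algebraMap_injective K (k ⊗[K] R)) p
      obtain ⟨n, r, hr⟩ := ha
      obtain ⟨m, s, hs⟩ := hb
      refine ⟨n + m, r ^ p ^ m + s ^ p ^ n, ?_⟩
      rw [add_pow_char_pow, map_add, map_pow, map_pow, hr, hs, ← pow_mul, ← pow_mul, pow_add,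
        mul_comm (p ^ m)]
  exists_basis := by
    have hli : LinearIndepOn K id ({1} : Set k) := .singleton one_ne_zero
    let b := Module.Basis.extend hli
    have hb (i) : b i = i := Module.Basis.extend_apply_self hli i
    refine ⟨_, (Algebra.TensorProduct.basis R b).map
      (Algebra.TensorProduct.commRight K R k).toLinearEquiv,
      ⟨1, Module.Basis.subset_extend hli rfl⟩, ?_, fun i ↦ ⟨b i, ?_⟩, fun c i ↦ ⟨b.repr c i, ?_⟩⟩
    · simp [hb, Algebra.TensorProduct.one_def]
    · simp
    · simp only [Module.Basis.map_repr, LinearEquiv.trans_apply]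
      have : (Algebra.TensorProduct.commRight K R k).toLinearEquiv.symm (algebraMap k (k ⊗[K] R) c) =
        (1 : R) ⊗ₜ[K] c := rfl
      rw [this, Algebra.TensorProduct.basis_repr_tmul]
      simp

/-- By flatness the quotient is the base change to `k` of the residue field of `R`. -/
theorem finrank_tensorProduct_quotient [IsDiscreteValuationRing R] {ϖ : R} (hϖ : Irreducible ϖ) :
    Module.finrank k ((k ⊗[K] R) ⧸ Ideal.span {algebraMap R (k ⊗[K] R) ϖ}) =
      Module.finrank K (IsLocalRing.ResidueField R) := by
  let q : R →ₗ[K] IsLocalRing.ResidueField R := (IsScalarTower.toAlgHom K R _).toLinearMap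
  have hq : Function.Surjective q := IsLocalRing.residue_surjective
  have hex : Function.Exact (LinearMap.mulLeft K ϖ) q := by
    intro x
    change IsLocalRing.residue R x = 0 ↔ _
    rw [IsLocalRing.residue_eq_zero_iff, hϖ.maximalIdeal_eq, Ideal.mem_span_singleton]
    exact exists_congr fun y ↦ eq_comm
  have hex' := Module.Flat.lTensor_exact k hex
  have hker : LinearMap.ker (q.baseChange k) =
      (Ideal.span {algebraMap R (k ⊗[K] R) ϖ}).restrictScalars k := by
    ext x
    have hmul (y : k ⊗[K] R) : (LinearMap.mulLeft K ϖ).lTensor k y =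
        algebraMap R (k ⊗[K] R) ϖ * y := by
      induction y using TensorProduct.induction_on with
      | zero => simp
      | tmul c r =>
        change c ⊗ₜ (ϖ * r) = ((1 : k) ⊗ₜ[K] ϖ) * (c ⊗ₜ r)
        rw [Algebra.TensorProduct.tmul_mul_tmul, one_mul]
      | add a b ha hb => rw [map_add, ha, hb, mul_add]
    rw [Submodule.restrictScalars_mem, Ideal.mem_span_singleton]
    refine (hex' x).trans (exists_congr fun y ↦ ?_)
    rw [hmul, eq_comm]
  have hsurj : Function.Surjective (q.baseChange k) := LinearMap.lTensor_surjective k hq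
  rw [← Module.finrank_baseChange (R := k) (S := K), finrank_quotient_ker_of_surjective _ hsurj, hker]
  rfl

variable [IsSepClosed K] [IsDiscreteValuationRing R] [Algebra.EssFiniteType K R]
  [IsDomain (GeomRing K R)] [Module.Finite K (IsLocalRing.ResidueField R)]

include p in
/-- The divisibility for a discrete valuation ring that is geometrically integral and essentially
of finite type, of transcendence degree one, over a separably closed field. -/
theorem finrank_residueField_dvd (htr : Algebra.trdeg K R = 1) :
    ∃ _ : IsDiscreteValuationRing (GeomNormalization K R),
      (valueSemigroup (GeomRing K R) (GeomNormalization K R))ᶜ.Finite ∧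
      Module.Finite (AlgebraicClosure K)
        (CokerAlpha (AlgebraicClosure K) (GeomRing K R) (GeomNormalization K R)) ∧
      (Module.finrank K (IsLocalRing.ResidueField R) : ℤ) ∣
        (conductor (GeomRing K R) (GeomNormalization K R) : ℤ) +
          (diffDegree (AlgebraicClosure K) (GeomRing K R) (GeomNormalization K R) : ℤ) - 1 := by
  -- Separable closedness of `K` enters here: it makes the algebraic closure purely inseparable.
  have h := isConstantExtension_tensorProduct p K R (AlgebraicClosure K)
  have : CharP (AlgebraicClosure K) p :=
    charP_of_injective_algebraMap (algebraMap K (AlgebraicClosure K)).injective p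
  have := h.faithfulSMul
  have : Algebra.IsAlgebraic (GeomRing K R) (FractionRing (GeomRing K R)) :=
    IsLocalization.isAlgebraic _ (nonZeroDivisors (GeomRing K R))
  have : IsFractionRing (GeomNormalization K R) (FractionRing (GeomRing K R)) :=
    integralClosure.isFractionRing_of_algebraic fun x hx ↦
      IsFractionRing.injective (GeomRing K R) (FractionRing (GeomRing K R)) (by rw [hx, map_zero])
  have : FaithfulSMul R (FractionRing (GeomRing K R)) := by
    rw [faithfulSMul_iff_algebraMap_injective,
      IsScalarTower.algebraMap_eq R (GeomRing K R) (FractionRing (GeomRing K R))]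
    exact (IsFractionRing.injective (GeomRing K R) _).comp (FaithfulSMul.algebraMap_injective R _)
  have hdvr := h.isDiscreteValuationRing_of_essFiniteType (GeomNormalization K R)
    (FractionRing (GeomRing K R))
  exact ⟨hdvr, h.finrank_dvd (GeomNormalization K R) (FractionRing (GeomRing K R)) htr
    fun ϖ hϖ ↦ finrank_tensorProduct_quotient K R (AlgebraicClosure K) hϖ⟩

end Geometric

/-! ### Dimension theory of affine domains and their local rings -/

section Dimension

/-- Lying over and going up lift every chain of primes. -/
theorem ringKrullDim_le_of_isIntegral (R S : Type*) [CommRing R] [CommRing S] [Algebra R S]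
    [Algebra.IsIntegral R S] [FaithfulSMul R S] : ringKrullDim R ≤ ringKrullDim S := by
  refine iSup_le fun l ↦ ?_
  obtain ⟨P, hP⟩ := Algebra.IsIntegral.comap_surjective R S l.head
  have : P.asIdeal.LiesOver l.head.asIdeal := ⟨by rw [← hP]; rfl⟩
  obtain ⟨L, hL, -⟩ := Ideal.exists_ltSeries_of_hasGoingUp l P.asIdeal
  rw [← hL]
  exact le_iSup (fun l : LTSeries (PrimeSpectrum S) ↦ (l.length : WithBot ℕ∞)) L

variable (K S R : Type u) [Field K] [CommRing S] [IsDomain S] [Algebra K S]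
  [Algebra.FiniteType K S]

/-- An affine domain of Krull dimension at most one that is not a field has transcendence degree
one. -/
theorem trdeg_eq_one_of_ringKrullDim_le_one (hdim : ringKrullDim S ≤ 1) (hS : ¬IsField S) :
    Algebra.trdeg K S = 1 := by
  obtain ⟨s, φ, hφi, hφ⟩ := exists_integral_inj_algHom_of_fg K S
  let P := MvPolynomial (Fin s) K
  let : Algebra P S := φ.toRingHom.toAlgebra
  have : IsScalarTower K P S := .of_algebraMap_eq fun x ↦ (φ.commutes x).symm
  have : FaithfulSMul P S := (faithfulSMul_iff_algebraMap_injective P S).mpr hφi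
  have : Algebra.IsIntegral P S := ⟨hφ⟩
  have htr := trdeg_add_eq K P (A := S)
  rw [trdeg_eq_zero (R := P), add_zero, MvPolynomial.trdeg_of_isDomain] at htr
  have hle := (ringKrullDim_le_of_isIntegral P S).trans hdim
  rw [MvPolynomial.ringKrullDim_of_isNoetherianRing, ringKrullDim_eq_zero_of_field] at hle
  -- The number of variables in a Noether normalization is bounded by the dimension; if it were `0`,
  -- the domain `S` would be integral over `K` and so a field.
  have hs : s ≤ 1 := by
    simpa using hle
  have hs0 : s ≠ 0 := by
    rintro rfl
    have : Algebra.IsAlgebraic K S := trdeg_eq_zero_iff.mp (by rw [← htr]; simp)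
    exact hS (isField_of_isIntegral_of_isField' (Field.toIsField K))
  obtain rfl : s = 1 := by omega
  rw [← htr]
  simp

variable [CommRing R] [Algebra K R] [Algebra S R] [IsScalarTower K S R] (q : Ideal S)
  [q.IsMaximal] [IsLocalization.AtPrime R q]

-- The residue field is a quotient of `S`, hence a field of finite type over `K`, and the
-- Nullstellensatz applies.
omit [IsDomain S] in
include q in
theorem finite_residueField_of_isMaximal [IsLocalRing R] :
    Module.Finite K (IsLocalRing.ResidueField R) := by
  have hsurj : Function.Surjective (IsScalarTower.toAlgHom K S (IsLocalRing.ResidueField R)) := by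
    intro x
    obtain ⟨y, rfl⟩ := (IsLocalization.AtPrime.equivQuotMaximalIdeal q R).surjective x
    obtain ⟨z, rfl⟩ := Ideal.Quotient.mk_surjective y
    exact ⟨z, rfl⟩
  have : Algebra.FiniteType K (IsLocalRing.ResidueField R) := .of_surjective _ hsurj
  exact finite_of_finite_type_of_isJacobsonRing K _

include q in
theorem trdeg_eq_one_of_isLocalization [IsDomain R] (hdim : ringKrullDim S ≤ 1)
    (hS : ¬IsField S) : Algebra.trdeg K R = 1 := by
  have hinj : Function.Injective (algebraMap S R) :=
    IsLocalization.injective R (Ideal.primeCompl_le_nonZeroDivisors q)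
  have : FaithfulSMul S R := (faithfulSMul_iff_algebraMap_injective S R).mpr hinj
  have : Algebra.IsAlgebraic S R := IsLocalization.isAlgebraic R q.primeCompl
  have h := trdeg_add_eq K S (A := R)
  rwa [trdeg_eq_zero (R := S), add_zero, trdeg_eq_one_of_ringKrullDim_le_one K S hdim hS,
    eq_comm] at h

-- Regularity equates the minimal number of generators of the maximal ideal with the height of `q`,
-- which is at most `1`; since `S` is not a field, neither is `R`.
include q in
theorem isDiscreteValuationRing_of_isRegularLocalRing [IsDomain R] [IsRegularLocalRing R]
    (hdim : ringKrullDim S ≤ 1) (hS : ¬IsField S) : IsDiscreteValuationRing R := by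
  have hR := IsLocalization.AtPrime.ringKrullDim_eq_height q R
  have hle : (q.height : WithBot ℕ∞) ≤ 1 := (ringKrullDim_le_iff_height_le 1).mp hdim inferInstance
  have hne : ¬IsField R := by
    intro hR
    have hq : q ≠ ⊥ := by
      rintro rfl
      exact hS (Ring.isField_iff_maximal_bot.mpr inferInstance)
    obtain ⟨x, hx, hx0⟩ := Submodule.exists_mem_ne_zero_of_ne_bot hq
    have hinj : Function.Injective (algebraMap S R) :=
      IsLocalization.injective R (Ideal.primeCompl_le_nonZeroDivisors q)
    have hxm := (IsLocalization.AtPrime.to_map_mem_maximal_iff R q x).mpr hx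
    rw [IsLocalRing.isField_iff_maximalIdeal_eq.mp hR, Ideal.mem_bot] at hxm
    exact hx0 (hinj (by rw [hxm, map_zero]))
  have hreg := IsRegularLocalRing.spanFinrank_maximalIdeal (R := R)
  rw [hR] at hreg
  rw [← hreg] at hle
  have hle' : (IsLocalRing.maximalIdeal R).spanFinrank ≤ 1 := by exact_mod_cast hle
  have := ((tfae_of_isNoetherianRing_of_isLocalRing_of_isDomain R).out 5 1).mp
    (by rwa [← IsLocalRing.spanFinrank_maximalIdeal_eq_finrank_cotangentSpace])
  exact ((IsDiscreteValuationRing.TFAE R hne).out 0 1).mpr this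

-- The tensor product with `R` is the localization of the domain `k ⊗ S` at the image of `M`, which
-- avoids zero divisors.
omit [Algebra.FiniteType K S] [q.IsMaximal] [IsLocalization.AtPrime R q] in
theorem isDomain_tensorProduct_of_isLocalization (k : Type u) [Field k] [Algebra K k]
    [IsDomain (k ⊗[K] S)] (M : Submonoid S) (hM : M ≤ nonZeroDivisors S) [IsLocalization M R] :
    IsDomain (k ⊗[K] R) := by
  let : Algebra (k ⊗[K] S) (k ⊗[K] R) :=
    (Algebra.TensorProduct.map (AlgHom.id k k) (IsScalarTower.toAlgHom K S R)).toAlgebra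
  have : IsScalarTower k (k ⊗[K] S) (k ⊗[K] R) := .of_algebraMap_eq fun x ↦
    ((Algebra.TensorProduct.map (AlgHom.id k k) (IsScalarTower.toAlgHom K S R)).commutes x).symm
  have hloc := IsLocalization.tensorProduct_tensorProduct_right K k M R <| by
    ext x
    change Algebra.TensorProduct.map (AlgHom.id k k) (IsScalarTower.toAlgHom K S R) (1 ⊗ₜ x) = _
    simp
  refine IsLocalization.isDomain_of_le_nonZeroDivisors (R := k ⊗[K] S) (S := k ⊗[K] R)
    (M := M.map (Algebra.TensorProduct.includeRight (R := K) (A := k))) ?_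
  exact map_le_nonZeroDivisors_of_injective _
    (Algebra.TensorProduct.includeRight_injective (algebraMap K k).injective) hM

end Dimension

/-! ### From the scheme to an affine chart and its local ring -/

section Chart

variable {K : Type u} [Field K] {C : Scheme.{u}} (f : C ⟶ Spec (.of K))

/-- The coordinate ring of an open affine subscheme of a geometrically integral scheme is
geometrically integral. -/
theorem isDomain_tensorProduct_of_isOpenImmersion [GeometricallyIntegral f] (k S : Type u)
    [Field k] [Algebra K k] [CommRing S] [Nontrivial S] [Algebra K S] (i : Spec (.of S) ⟶ C)
    [IsOpenImmersion i] (hi : i ≫ f = Spec.map (CommRingCat.ofHom (algebraMap K S))) :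
    IsDomain (k ⊗[K] S) := by
  let y := Spec.map (CommRingCat.ofHom (algebraMap K k))
  have hZ : IsIntegral (Limits.pullback y f) :=
    pullback_of_geometrically' GeometricallyIntegral.geometrically_isIntegral k y
  -- Pasting pullback squares identifies the spectrum of `k ⊗ S` with an open subscheme of the
  -- integral scheme `Z`, the base change of `C` to `k`.
  have hpb := (IsPullback.of_hasPullback (Limits.pullback.snd y f) i).paste_horiz
    (IsPullback.of_hasPullback y f)
  rw [hi] at hpb
  let e := hpb.isoPullback ≪≫ pullbackSpecIso K k S
  have : Nontrivial (k ⊗[K] S) := (Algebra.TensorProduct.includeRight_injective (R := K) (A := k)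
    (B := S) (algebraMap K k).injective).nontrivial
  have : IsIntegral (Spec (.of (k ⊗[K] S))) :=
    isIntegral_of_isOpenImmersion (e.inv ≫ Limits.pullback.fst (Limits.pullback.snd y f) i)
  exact (affine_isIntegral_iff (.of (k ⊗[K] S))).mp this

theorem ringKrullDim_le_of_isOpenImmersion (S : Type u) [CommRing S] (i : Spec (.of S) ⟶ C)
    [IsOpenImmersion i] : ringKrullDim S ≤ topologicalKrullDim C := by
  rw [← PrimeSpectrum.topologicalKrullDim_eq_ringKrullDim]
  exact i.isOpenEmbedding.isInducing.topologicalKrullDim_le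

/-- Were `S` a field, `P` would be both open and closed; nonempty opens of the irreducible space are
dense, so `C` would be a single point, of dimension `0`. -/
theorem not_isField_of_isOpenImmersion [IsIntegral C] (hdim : ¬topologicalKrullDim C ≤ 0)
    (S : Type u) [CommRing S] (i : Spec (.of S) ⟶ C) [IsOpenImmersion i] {P : C}
    (hP : IsClosed ({P} : Set C)) (hPi : P ∈ Set.range i) : ¬IsField S := by
  intro hS
  let := hS.toField
  have hrange : Set.range i = {P} := by
    obtain ⟨x, rfl⟩ := hPi
    ext y
    constructor
    · rintro ⟨z, rfl⟩
      rw [Subsingleton.elim z x]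
      rfl
    · rintro rfl
      exact ⟨x, rfl⟩
  have hopen : IsOpen ({P} : Set C) := hrange ▸ i.isOpenEmbedding.isOpen_range
  have huniv : ({P} : Set C) = Set.univ := by
    rw [← hP.closure_eq]
    exact (hopen.dense (Set.singleton_nonempty P)).closure_eq
  have : Subsingleton C := Set.subsingleton_univ_iff.mp (huniv ▸ Set.subsingleton_singleton)
  exact hdim (topologicalKrullDim_zero_of_discreteTopology C)

section Stalk

variable {U : C.Opens} (hU : IsAffineOpen U)

/-- The structure map of the coordinate ring of an open subscheme. -/
noncomputable def sectionMap (U : C.Opens) : CommRingCat.of K ⟶ Γ(C, U) :=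
  (Scheme.ΓSpecIso (.of K)).inv ≫ f.appLE ⊤ U le_top

include hU in
theorem fromSpec_comp : hU.fromSpec ≫ f = Spec.map (sectionMap f U) := by
  rw [← IsAffineOpen.SpecMap_appLE_fromSpec f (isAffineOpen_top _) hU le_top, IsAffineOpen.fromSpec_top,
    Scheme.isoSpec_Spec_inv, sectionMap, Spec.map_comp]

include hU in
theorem finiteType_sectionMap [LocallyOfFiniteType f] : (sectionMap f U).hom.FiniteType := by
  have h := f.finiteType_appLE (isAffineOpen_top _) hU le_top
  rw [sectionMap, CommRingCat.hom_comp]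
  exact h.comp (RingHom.FiniteType.of_surjective _
    (Scheme.ΓSpecIso (.of K)).symm.commRingCatIsoToRingEquiv.surjective)

theorem germ_comp_sectionMap (P : C) (hP : P ∈ U) :
    (C.presheaf.germ U P hP).hom.comp (sectionMap f U).hom = structureMap f P := by
  rw [structureMap, sectionMap, ← CommRingCat.hom_comp]
  simp only [Scheme.Hom.appLE, Category.assoc, TopCat.Presheaf.germ_res]
  rfl

/-- The local ring of a geometrically integral curve over a field at a closed regular point is a
discrete valuation ring, of transcendence degree one, that is geometrically integral and
essentially of finite type. -/
theorem localRing_properties [LocallyOfFiniteType f] [GeometricallyIntegral f]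
    (hdim : topologicalKrullDim C = 1) (P : C) (hP : IsClosed ({P} : Set C))
    (hreg : IsRegularLocalRing (LocalRing f P)) (k : Type u) [Field k] [Algebra K k] :
    IsDomain (k ⊗[K] LocalRing f P) ∧ Module.Finite K (IsLocalRing.ResidueField (LocalRing f P)) ∧
      Algebra.EssFiniteType K (LocalRing f P) ∧ Algebra.trdeg K (LocalRing f P) = 1 ∧
      ∃ _ : IsDomain (LocalRing f P), IsDiscreteValuationRing (LocalRing f P) := by
  have hC : IsIntegral C := GeometricallyIntegral.isIntegral_of_subsingleton f
  obtain ⟨U, hU, hPU, -⟩ := exists_isAffineOpen_mem_and_subset (U := ⊤) (x := P) trivial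
  have : Nonempty U := ⟨⟨P, hPU⟩⟩
  let S : Type u := Γ(C, U)
  let q : Ideal S := (hU.primeIdealOf ⟨P, hPU⟩).asIdeal
  let : Algebra K S := (sectionMap f U).hom.toAlgebra
  let : Algebra S (LocalRing f P) := (C.presheaf.germ U P hPU).hom.toAlgebra
  have hloc : IsLocalization.AtPrime (LocalRing f P) q := hU.isLocalization_stalk ⟨P, hPU⟩
  have : IsScalarTower K S (LocalRing f P) :=
    .of_algebraMap_eq' (germ_comp_sectionMap f P hPU).symm
  have : Algebra.FiniteType K S := finiteType_sectionMap f hU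
  have hq : q.IsMaximal := hU.primeIdealOf_isMaximal_of_isClosed ⟨P, hPU⟩ hP
  have hS : IsDomain S := inferInstanceAs (IsDomain Γ(C, U))
  have hdomR : IsDomain (LocalRing f P) := inferInstanceAs (IsDomain (C.presheaf.stalk P))
  let i : Spec (.of S) ⟶ C := hU.fromSpec
  have hi : IsOpenImmersion i := inferInstanceAs (IsOpenImmersion hU.fromSpec)
  have hdimS : ringKrullDim S ≤ 1 := hdim ▸ ringKrullDim_le_of_isOpenImmersion S i
  have hPi : P ∈ Set.range i := by
    have : Set.range hU.fromSpec = (U : Set C) := hU.range_fromSpec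
    exact this ▸ hPU
  have hSf : ¬IsField S := not_isField_of_isOpenImmersion (by simp [hdim]) S i hP hPi
  have hdomS : IsDomain (k ⊗[K] S) :=
    isDomain_tensorProduct_of_isOpenImmersion f k S i (fromSpec_comp f hU)
  have : Algebra.EssFiniteType S (LocalRing f P) := .of_isLocalization _ q.primeCompl
  exact ⟨isDomain_tensorProduct_of_isLocalization K S (LocalRing f P) k q.primeCompl
    (Ideal.primeCompl_le_nonZeroDivisors q), finite_residueField_of_isMaximal K S _ q,
    .comp K S _, trdeg_eq_one_of_isLocalization K S _ q hdimS hSf, hdomR,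
    isDiscreteValuationRing_of_isRegularLocalRing S _ q hdimS hSf⟩

end Stalk

end Chart

end RegularCurve

/-- `C` is a geometrically integral curve over a separably closed field `K` of characteristic
`p > 0`, and `P` is a closed point at which `C` is regular. The first conjuncts say that the
valuation `ν₀` and the three numbers are well defined; the last one is the divisibility. -/
theorem mainTheorem8 {K : Type u} [Field K] [IsSepClosed K] (p : ℕ) [Fact p.Prime] [CharP K p]
    {C : Scheme.{u}} (f : C ⟶ Spec (.of K))
    [IsSeparated f] [LocallyOfFiniteType f] [QuasiCompact f] [GeometricallyIntegral f]
    (hdim : topologicalKrullDim C = 1)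
    (P : C) (hP : IsClosed ({P} : Set C))
    (hreg : IsRegularLocalRing (RegularCurve.LocalRing f P)) :
    ∃ (_ : IsDomain (RegularCurve.GeomRing K (RegularCurve.LocalRing f P)))
      (_ : IsDiscreteValuationRing
        (RegularCurve.GeomNormalization K (RegularCurve.LocalRing f P))),
      Module.Finite K (IsLocalRing.ResidueField (RegularCurve.LocalRing f P)) ∧
      (RegularCurve.valueSemigroup (RegularCurve.GeomRing K (RegularCurve.LocalRing f P))
        (RegularCurve.GeomNormalization K (RegularCurve.LocalRing f P)))ᶜ.Finite ∧
      Module.Finite (AlgebraicClosure K)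
        (RegularCurve.CokerAlpha (AlgebraicClosure K)
          (RegularCurve.GeomRing K (RegularCurve.LocalRing f P))
          (RegularCurve.GeomNormalization K (RegularCurve.LocalRing f P))) ∧
      (RegularCurve.pointDegree f P : ℤ) ∣
        (RegularCurve.conductor (RegularCurve.GeomRing K (RegularCurve.LocalRing f P))
            (RegularCurve.GeomNormalization K (RegularCurve.LocalRing f P)) : ℤ) +
          (RegularCurve.diffDegree (AlgebraicClosure K)
            (RegularCurve.GeomRing K (RegularCurve.LocalRing f P))
            (RegularCurve.GeomNormalization K (RegularCurve.LocalRing f P)) : ℤ) - 1 := by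
  obtain ⟨hdom, hfin, hess, htr, hdomR, hdvr⟩ :=
    RegularCurve.localRing_properties f hdim P hP hreg (AlgebraicClosure K)
  obtain ⟨hdvr', hgaps, hcoker, hdvd⟩ :=
    RegularCurve.finrank_residueField_dvd p K (RegularCurve.LocalRing f P) htr
  exact ⟨hdom, hdvr', hfin, hgaps, hcoker, hdvd⟩
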